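/- **Setting.** Let $\mathcal C,\mathcal V$ be finite-dimensional complex spaces with fixed bases and $a,b\ge 0$ integers. A *referee* is a tuple $R=(|\psi\rangle,V_1,\dots,V_{a+b},\Pi)$ of a unit vector $|\psi\rangle\in\mathcal C\otimes\mathcal V$, unitaries $V_i$ on $\mathcal C\otimes\mathcal V$ and an orthogonal projection $\Pi$ on $\mathcal C\otimes\mathcal V$; put $V_0=I$. Alice plays unitaries $A_1,\dots,A_a$ on $\mathcal C\otimes\mathcal A$ and Bob plays unitaries $B_1,\dots,B_b$ on $\mathcal C\otimes\mathcal B$, for finite-dimensional private spaces $\mathcal A,\mathcal B$ of their choice, initialised to $|0\rangle$. Bob wins with probability $$\Pr[\text{Bob wins}]=\bigl\|\Pi V_{a+b}B_bV_{a+b-1}\cdots B_1V_aA_aV_{a-1}\cdots V_1A_1|\psi\rangle|0\rangle|0\rangle\bigr\|^2,$$ and the value of the game is $\lambda(R)=\min_{(A_1,\dots,A_a)}\max_{(B_1,\dots,B_b)}\Pr[\text{Bob wins}]$. Let $\mathbf A(R)$ be the set of reduced states $\mathrm{Tr}_{\mathcal A}|\phi\rangle\langle\phi|$ on $\mathcal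 C\otimes\mathcal V$ with $|\phi\rangle=A_aV_{a-1}\cdots V_1A_1|\psi\rangle|0\rangle$, and $\mathbf P(R)$ the set of operators $(I\otimes\langle 0|)U^*(\Pi\otimes I)U(I\otimes|0\rangle)$ on $\mathcal C\otimes\mathcal V$ with $U=V_{a+b}B_b\cdots B_1V_a$. Write $\langle A,B\rangle=\mathrm{Tr}(A^*B)$. Put $\rho_0=|\psi\rangle\langle\psi|$. Density operators $\rho_1,\dots,\rho_a$ on $\mathcal C\otimes\mathcal V$ are *consistent with $R$* if $\mathrm{Tr}_{\mathcal C}\,\rho_{i+1}=\mathrm{Tr}_{\mathcal C}(V_i\rho_iV_i^*)$ for $0\le i<a$. For $\varepsilon>0$ let $$\mu_\varepsilon(R)=\min_{(\rho_1,\dots,\rho_a)}\ \max_{P,(\Pi_1,\dots,\Pi_a)}\ \langle\rho_a,P\rangle+\frac a\varepsilon\sum_{i=0}^{a-1}\bigl\langle \mathrm{Tr}_{\mathcal C}\,\rho_{i+1}-\mathrm{Tr}_{\mathcal C}(V_i\rho_iV_i^*),\,\Pi_{i+1}\bigr\rangle,$$ over all density operators $\rho_i$ on $\mathcal C\otimes\mathcal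 V$, all $P\in\mathbf P(R)$ and all $0\preceq\Pi_i\preceq I$ on $\mathcal V$. (In the definitions of $\lambda$, $\mu_\varepsilon$ and below, $\min$ and $\max$ may be read as $\inf$ and $\sup$.) For a payoff $f(x,y)$ with value $w=\min_x\max_yf(x,y)$, call $\tilde x$ *$\delta$-optimal* if $\max_yf(\tilde x,y)\le w+\delta$, and $\tilde y$ *$\delta$-optimal* if $\min_xf(x,\tilde y)\ge w-\delta$. Optimality for $\mu_\varepsilon(R)$ refers to the payoff displayed above, and optimality for $\lambda(R)$ to the payoff $\langle\rho,P\rangle$ with $\rho\in\mathbf A(R)$, $P\in\mathbf P(R)$. **Model of computation.** Parallel algorithms are uniform: one fixed program for all inputs, running synchronously on a shared memory of complex numbers, with exact arithmetic $(+,-,\times,{}^{-1}$, conjugation, comparison of real parts$)$ at unit cost and with exact extraction of the roots of a univariate polynomial of degree at most $d$, given by its coefficients, charged $(1+\log_2 d)^r$ parallel steps and $(1+d)^r$ operations, where $r$ is any fixed exponent. The inputs are $a,b,\dim\mathcal C,\dim\mathcal V$ and the entries of all vectors and matrices. **Theorem (Rounding theorem).** The following hold for every referee $R$ and all $\varepsilon,\delta>0$.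 1. $\lambda(R)\ \ge\ \mu_\varepsilon(R)\ >\ \lambda(R)-\varepsilon$. 2. If $(\tilde P,\tilde\Pi_1,\dots,\tilde\Pi_a)$ is $\delta$-optimal for $\mu_\varepsilon(R)$, then $\tilde P\in\mathbf P(R)$ is $(\delta+\varepsilon)$-optimal for $\lambda(R)$. 3. If $(\tilde\rho_1,\dots,\tilde\rho_a)$ is $\delta$-optimal for $\mu_\varepsilon(R)$, then there are density operators $(\tilde\rho_1',\dots,\tilde\rho_a')$ consistent with $R$ such that $\tilde\rho_a'\in\mathbf A(R)$ is $(\delta+\varepsilon)$-optimal for $\lambda(R)$. They are computed from $R$ and $(\tilde\rho_1,\dots,\tilde\rho_a)$ by a single parallel algorithm, the same for all $R,\varepsilon,\delta,\tilde\rho_i$, in parallel time $O\bigl(a\,\mathrm{polylog}(\dim(\mathcal C\otimes\mathcal V))\bigr)$ with a total number of operations polynomial in $a\cdot\dim(\mathcal C\otimes\mathcal V)$. (For $a=0$ read $1$ for $a$ in these bounds, and $\tilde\rho_0'=|\psi\rangle\langle\psi|$ for the final state; $\mathrm{polylog}(n)$ means $(1+\log_2 n)^{O(1)}$.) -/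

import Mathlib

open scoped Kronecker ComplexOrder Matrix

/-! ### Operators on a register pair -/

namespace DQIP

/-- Basis of the message register `C` together with the referee's private register `V`. -/
abbrev CV (c v : ℕ) : Type := Fin c × Fin v

/-- Operators on the space `C ⊗ V`. -/
abbrev Op (c v : ℕ) : Type := Matrix (CV c v) (CV c v) ℂ

/-- Density operators. -/
def IsDensity {n : Type} [Fintype n] (ρ : Matrix n n ℂ) : Prop :=
  ρ.PosSemidef ∧ ρ.trace = 1

/-- Measurement operators: `0 ≤ M ≤ I`. -/
def IsMeasurement {n : Type} [Fintype n] [DecidableEq n] (M : Matrix n n ℂ) : Prop :=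
  M.PosSemidef ∧ (1 - M).PosSemidef

/-- The inner product `⟨A, B⟩ = Tr (A* B)`; it is real for Hermitian `A`, `B`, and we record its
real part. -/
def inn {n : Type} [Fintype n] (A B : Matrix n n ℂ) : ℝ := (Aᴴ * B).trace.re

/-- The partial trace over `C`. -/
def trC {c v : ℕ} (M : Op c v) : Matrix (Fin v) (Fin v) ℂ :=
  fun i j => ∑ k : Fin c, M (k, i) (k, j)

/-! ### Referees and the game -/

/-- A referee `R = (|ψ⟩, V_1, …, V_{a+b}, Π)` who exchanges `a` rounds of messages with Alice and
then `b` rounds with Bob. `V ⟨i, _⟩` is the unitary `V_{i+1}`. -/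
structure Referee (a b c v : ℕ) where
  psi : CV c v → ℂ
  psi_unit : ∑ x, ‖psi x‖ ^ 2 = 1
  V : Fin (a + b) → Op c v
  V_unitary : ∀ i, V i ∈ Matrix.unitaryGroup (CV c v) ℂ
  Pi : Op c v
  Pi_proj : IsStarProjection Pi

/-- A player's actions over `n` rounds: a private register with basis `0, …, mem` (initialised to
`|0⟩`), and `n` unitaries acting on the message register and the private register. -/
structure Strategy (c n : ℕ) where
  mem : ℕ
  U : Fin n → Matrix (Fin c × Fin (mem + 1)) (Fin c × Fin (mem + 1)) ℂ
  U_unitary : ∀ i, U i ∈ Matrix.unitaryGroup (Fin c × Fin (mem + 1)) ℂ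

/-- The unitary of round `i + 1`. -/
def Strategy.op {c n : ℕ} (S : Strategy c n) (i : ℕ) :
    Matrix (Fin c × Fin (S.mem + 1)) (Fin c × Fin (S.mem + 1)) ℂ :=
  if h : i < n then S.U ⟨i, h⟩ else 1

/-- An operator on `C ⊗ V`, tensored with the identity of the private register(s) `P`. -/
def onCV {c v : ℕ} {P : Type} [DecidableEq P] (M : Op c v) :
    Matrix (CV c v × P) (CV c v × P) ℂ :=
  M ⊗ₖ (1 : Matrix P P ℂ)

/-- An operator on `C ⊗ P`, tensored with the identity of `V`. -/
def onCP {c v : ℕ} {P : Type} (M : Matrix (Fin c × P) (Fin c × P) ℂ) :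
    Matrix (CV c v × P) (CV c v × P) ℂ :=
  fun x y => if x.1.2 = y.1.2 then M (x.1.1, x.2) (y.1.1, y.2) else 0

/-- An operator on `C ⊗ A`, tensored with the identity of `B`. -/
def onCA {c : ℕ} {A B : Type} [DecidableEq B] (M : Matrix (Fin c × A) (Fin c × A) ℂ) :
    Matrix (Fin c × A × B) (Fin c × A × B) ℂ :=
  fun x y => if x.2.2 = y.2.2 then M (x.1, x.2.1) (y.1, y.2.1) else 0

/-- An operator on `C ⊗ B`, tensored with the identity of `A`. -/
def onCB {c : ℕ} {A B : Type} [DecidableEq A] (M : Matrix (Fin c × B) (Fin c × B) ℂ) :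
    Matrix (Fin c × A × B) (Fin c × A × B) ℂ :=
  fun x y => if x.2.1 = y.2.1 then M (x.1, x.2.2) (y.1, y.2.2) else 0

namespace Referee

variable {a b c v : ℕ} (R : Referee a b c v)

/-- The operator `V_i` for `i = 0, …, a + b`, with `V_0 = I`. -/
def W : ℕ → Op c v
  | 0 => 1
  | i + 1 => if h : i < a + b then R.V ⟨i, h⟩ else 1

/-- The state `A_k V_{k-1} A_{k-1} ⋯ V_1 A_1 |ψ⟩|p⟩` of the registers `C, V` and a private register
`P` with initial state `|p⟩`, where `A i` is the player's unitary of round `i + 1`. -/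
def aliceVec {P : Type} [Fintype P] [DecidableEq P] (p : P)
    (A : ℕ → Matrix (Fin c × P) (Fin c × P) ℂ) : ℕ → (CV c v × P → ℂ)
  | 0 => fun x => if x.2 = p then R.psi x.1 else 0
  | k + 1 => onCP (A k) *ᵥ (onCV (R.W k) *ᵥ aliceVec p A k)

/-- The operator `V_{a+k} B_k ⋯ V_{a+1} B_1 V_a`, where `B i` is the player's unitary of round
`i + 1`. -/
def bobOp {P : Type} [Fintype P] [DecidableEq P]
    (B : ℕ → Matrix (Fin c × P) (Fin c × P) ℂ) : ℕ → Matrix (CV c v × P) (CV c v × P) ℂ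
  | 0 => onCV (R.W a)
  | k + 1 => onCV (R.W (a + (k + 1))) * (onCP (B k) * bobOp B k)

/-- `Pr[Bob wins | (A_1,…,A_a), (B_1,…,B_b)]
= ‖Π V_{a+b} B_b ⋯ B_1 V_a A_a V_{a-1} ⋯ V_1 A_1 |ψ⟩|0⟩|0⟩‖²`. -/
noncomputable def winProb (SA : Strategy c a) (SB : Strategy c b) : ℝ :=
  ∑ x : CV c v × (Fin (SA.mem + 1) × Fin (SB.mem + 1)),
    ‖(onCV R.Pi *ᵥ (R.bobOp (fun i => onCB (SB.op i)) b *ᵥ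
        R.aliceVec (0, 0) (fun i => onCA (SA.op i)) a)) x‖ ^ 2

/-- The value of the game, `min_{(A_1,…,A_a)} max_{(B_1,…,B_b)} Pr[Bob wins]`, over all private
registers and all unitaries of the players. -/
noncomputable def lam : ℝ := ⨅ SA : Strategy c a, ⨆ SB : Strategy c b, R.winProb SA SB

/-- The state of `C, V` right after Alice's last action, when she plays `SA`. -/
def aliceState (SA : Strategy c a) : Op c v := fun x y =>
  ∑ q, R.aliceVec 0 SA.op a (x, q) * star (R.aliceVec 0 SA.op a (y, q))

/-- The measurement operator on `C, V` that the interaction with Bob induces when he plays `SB`: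
`(I ⊗ ⟨0|) U* Π U (I ⊗ |0⟩)` with `U = V_{a+b} B_b ⋯ B_1 V_a`. -/
def bobMeas (SB : Strategy c b) : Op c v := fun x y =>
  let U : Matrix (CV c v × Fin (SB.mem + 1)) (CV c v × Fin (SB.mem + 1)) ℂ := R.bobOp SB.op b
  let M : Matrix (CV c v × Fin (SB.mem + 1)) (CV c v × Fin (SB.mem + 1)) ℂ :=
    Uᴴ * onCV R.Pi * U
  M (x, 0) (y, 0)

/-- The set `𝐀(R)` of density operators admissible for Alice. -/
def admA : Set (Op c v) := Set.range R.aliceState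

/-- The set `𝐏(R)` of measurement operators admissible for Bob. -/
def admP : Set (Op c v) := Set.range R.bobMeas

/-! ### Transcripts and the relaxed value -/

/-- The states `ρ_0, ρ_1, …, ρ_a` with `ρ_0 = |ψ⟩⟨ψ|`; the given `ρ ⟨i, _⟩` is `ρ_{i+1}`. -/
def tr (ρ : Fin a → Op c v) : ℕ → Op c v
  | 0 => Matrix.vecMulVec R.psi (star R.psi)
  | i + 1 => if h : i < a then ρ ⟨i, h⟩ else 0

/-- The violation `Tr_C ρ_{i+1} - Tr_C (V_i ρ_i V_i*)` of the `i`-th consistency condition. -/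
def defect (ρ : Fin a → Op c v) (i : ℕ) : Matrix (Fin v) (Fin v) ℂ :=
  trC (R.tr ρ (i + 1)) - trC (R.W i * R.tr ρ i * (R.W i)ᴴ)

/-- `ρ_1, …, ρ_a` are density operators consistent with `R`. -/
def Consistent (ρ : Fin a → Op c v) : Prop :=
  (∀ i, IsDensity (ρ i)) ∧
    ∀ i < a, trC (R.tr ρ (i + 1)) = trC (R.W i * R.tr ρ i * (R.W i)ᴴ)

/-- Tuples `(ρ_1, …, ρ_a)` of density operators on `C ⊗ V`. -/
abbrev Tuple (_R : Referee a b c v) : Type := {ρ : Fin a → Op c v // ∀ i, IsDensity (ρ i)}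

/-- Tuples `(P, Π_1, …, Π_a)` with `P ∈ 𝐏(R)` and `Π_i` measurement operators on `V`. -/
abbrev Response : Type :=
  {P : Op c v // P ∈ R.admP} × {Q : Fin a → Matrix (Fin v) (Fin v) ℂ // ∀ i, IsMeasurement (Q i)}

/-- `⟨ρ_a, P⟩ + (a/ε) ∑_{i=0}^{a-1} ⟨Tr_C ρ_{i+1} - Tr_C (V_i ρ_i V_i*), Π_{i+1}⟩`. -/
noncomputable def penalized (ε : ℝ) (ρ : R.Tuple) (X : R.Response) : ℝ :=
  inn (R.tr ρ.1 a) X.1.1 + (a / ε) * ∑ i : Fin a, inn (R.defect ρ.1 i) (X.2.1 i)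

/-- The relaxed value `μ_ε(R)`. -/
noncomputable def mu (ε : ℝ) : ℝ := ⨅ ρ : R.Tuple, ⨆ X : R.Response, R.penalized ε ρ X

/-- The payoff `⟨ρ, P⟩` for `ρ ∈ 𝐀(R)` and `P ∈ 𝐏(R)`. -/
def payoff (ρ : {ρ : Op c v // ρ ∈ R.admA}) (P : {P : Op c v // P ∈ R.admP}) : ℝ := inn ρ.1 P.1

end Referee

/-- `x` is a `δ`-optimal choice of the minimizing party for the value `val` of `f`. -/
def MinOptimal {α β : Type} (f : α → β → ℝ) (val δ : ℝ) (x : α) : Prop :=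
  ⨆ y, f x y ≤ val + δ

/-- `y` is a `δ`-optimal choice of the maximizing party for the value `val` of `f`. -/
def MaxOptimal {α β : Type} (f : α → β → ℝ) (val δ : ℝ) (y : β) : Prop :=
  val - δ ≤ ⨅ x, f x y

/-! ### Parallel algorithms with exact complex arithmetic

A program is a finite piece of syntax. It works on a shared memory that holds countably many
arrays of complex numbers. Its one parallel instruction lets processors `0, …, n-1` each evaluate
a scalar expression of constant size on the current memory and write the value to a cell of its
own, all at once; programs are composed in sequence and by counted loops. Array indices, loop counts
and processor numbers are arithmetic expressions in the size parameters of the input, the loop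
counters and the processor number, so that they stay polynomial in the size parameters. -/

/-- Index expressions. `var i` is the `i`-th index variable. -/
inductive NExpr : Type
  | const (n : ℕ)
  | var (i : ℕ)
  | add (e f : NExpr)
  | sub (e f : NExpr)
  | mul (e f : NExpr)
  | div (e f : NExpr)
  | mod (e f : NExpr)
  | log (e : NExpr)

namespace NExpr

/-- Value of an index expression when the index variables have the values `ν`. -/
def eval (ν : ℕ → ℕ) : NExpr → ℕ
  | const n => n
  | var i => ν i
  | add e f => e.eval ν + f.eval ν
  | sub e f => e.eval ν - f.eval ν
  | mul e f => e.eval ν * f.eval ν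
  | div e f => e.eval ν / f.eval ν
  | mod e f => e.eval ν % f.eval ν
  | log e => Nat.log 2 (e.eval ν)

/-- Number of steps to evaluate an index expression. -/
def time : NExpr → ℕ
  | const _ => 1
  | var _ => 1
  | add e f => e.time + f.time + 1
  | sub e f => e.time + f.time + 1
  | mul e f => e.time + f.time + 1
  | div e f => e.time + f.time + 1
  | mod e f => e.time + f.time + 1
  | log e => e.time + 1

end NExpr

/-- The shared memory: `m i j` is entry `j` of array `i`. -/
abbrev Memory : Type := ℕ → ℕ → ℂ

/-- The `k`-th (from `0`) complex root of `∑_{j ≤ d} q_j X^j`, where the roots are listed with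
multiplicity in increasing lexicographic order of (real part, imaginary part); `0` if there is no
such root. -/
noncomputable def kthRoot (q : ℕ → ℂ) (d k : ℕ) : ℂ :=
  let p : Polynomial ℂ := ∑ j ∈ Finset.range (d + 1), Polynomial.C (q j) * Polynomial.X ^ j
  let l : List (ℝ ×ₗ ℝ) := (p.roots.map fun z => toLex (z.re, z.im)).sort (· ≤ ·)
  let z : ℝ ×ₗ ℝ := l.getD k (toLex (0, 0))
  ⟨(ofLex z).1, (ofLex z).2⟩

/-- Scalar expressions, evaluated by a single processor. `root arr off d k` is the `k`-th root of
the polynomial of degree at most `d` whose coefficients are the entries `off, …, off + d` of the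
array `arr`, lowest degree first. -/
inductive SExpr : Type
  | nat (e : NExpr)
  | imag
  | read (arr : ℕ) (e : NExpr)
  | add (x y : SExpr)
  | sub (x y : SExpr)
  | mul (x y : SExpr)
  | inv (x : SExpr)
  | conj (x : SExpr)
  | ifLE (x y s t : SExpr)
  | root (arr : ℕ) (off d k : NExpr)

namespace SExpr

open Classical in
/-- Value of a scalar expression; `ifLE x y s t` is `s` if `Re x ≤ Re y`, and `t` otherwise. -/
noncomputable def eval (ν : ℕ → ℕ) (m : Memory) : SExpr → ℂ
  | nat e => (e.eval ν : ℂ)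
  | imag => Complex.I
  | read arr e => m arr (e.eval ν)
  | add x y => x.eval ν m + y.eval ν m
  | sub x y => x.eval ν m - y.eval ν m
  | mul x y => x.eval ν m * y.eval ν m
  | inv x => (x.eval ν m)⁻¹
  | conj x => star (x.eval ν m)
  | ifLE x y s t => if (x.eval ν m).re ≤ (y.eval ν m).re then s.eval ν m else t.eval ν m
  | root arr off d k => kthRoot (fun j => m arr (off.eval ν + j)) (d.eval ν) (k.eval ν)

/-- Number of steps to evaluate a scalar expression. Every operation costs one step, except that
the extraction of a root of a polynomial of degree at most `d` costs `(1 + log₂ d) ^ r` parallel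
steps. -/
def time (r : ℕ) (ν : ℕ → ℕ) : SExpr → ℕ
  | nat e => e.time + 1
  | imag => 1
  | read _ e => e.time + 1
  | add x y => x.time r ν + y.time r ν + 1
  | sub x y => x.time r ν + y.time r ν + 1
  | mul x y => x.time r ν + y.time r ν + 1
  | inv x => x.time r ν + 1
  | conj x => x.time r ν + 1
  | ifLE x y s t => x.time r ν + y.time r ν + s.time r ν + t.time r ν + 1
  | root _ off d k => off.time + d.time + k.time + (1 + Nat.log 2 (d.eval ν)) ^ r

/-- Number of operations used to evaluate a scalar expression. Root extraction in degree at most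
`d` counts for `(1 + d) ^ r` operations. -/
def work (r : ℕ) (ν : ℕ → ℕ) : SExpr → ℕ
  | nat e => e.time + 1
  | imag => 1
  | read _ e => e.time + 1
  | add x y => x.work r ν + y.work r ν + 1
  | sub x y => x.work r ν + y.work r ν + 1
  | mul x y => x.work r ν + y.work r ν + 1
  | inv x => x.work r ν + 1
  | conj x => x.work r ν + 1
  | ifLE x y s t => x.work r ν + y.work r ν + s.work r ν + t.work r ν + 1
  | root _ off d k => off.time + d.time + k.time + (1 + d.eval ν) ^ r

end SExpr

/-- Programs. `par x n arr off e`: for all processors `x < n` at once, compute `e` on the current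
memory and write its value to entry `off + x` of the array `arr`. `loop x n p`: run `p` with the
variable `x` equal to `0, 1, …, n - 1` in turn. -/
inductive Prog : Type
  | par (x : ℕ) (n : NExpr) (arr : ℕ) (off : NExpr) (e : SExpr)
  | seq (p q : Prog)
  | loop (x : ℕ) (n : NExpr) (p : Prog)

namespace Prog

/-- The memory after running a program. -/
noncomputable def run : Prog → (ℕ → ℕ) → Memory → Memory
  | par x n arr off e, ν, m => fun i j =>
      if i = arr ∧ off.eval ν ≤ j ∧ j < off.eval ν + n.eval ν then
        e.eval (Function.update ν x (j - off.eval ν)) m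
      else m i j
  | seq p q, ν, m => q.run ν (p.run ν m)
  | loop x n p, ν, m =>
      Nat.rec m (fun i m' => p.run (Function.update ν x i) m') (n.eval ν)

/-- Parallel running time. -/
def time (r : ℕ) : Prog → (ℕ → ℕ) → ℕ
  | par x n _ off e, ν => n.time + off.time + 1 +
      (Finset.range (n.eval ν)).sup fun i => e.time r (Function.update ν x i)
  | seq p q, ν => p.time r ν + q.time r ν
  | loop x n p, ν => n.time + 1 +
      ∑ i ∈ Finset.range (n.eval ν), (1 + p.time r (Function.update ν x i))

/-- Total number of operations performed by all processors. -/
def work (r : ℕ) : Prog → (ℕ → ℕ) → ℕ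
  | par x n _ off e, ν => n.time + off.time + 1 +
      ∑ i ∈ Finset.range (n.eval ν), (1 + e.work r (Function.update ν x i))
  | seq p q, ν => p.work r ν + q.work r ν
  | loop x n p, ν => n.time + 1 +
      ∑ i ∈ Finset.range (n.eval ν), (1 + p.work r (Function.update ν x i))

end Prog

/-! ### Input and output of the rounding algorithm -/

/-- Position of a basis element of `C ⊗ V` in `0, …, c * v - 1`. -/
def pos {c v : ℕ} (x : CV c v) : ℕ := (finProdFinEquiv x : ℕ)

/-- Entry `(x, y)` of the `i`-th matrix of a list (from `0`) of `c v × c v` matrices stored one after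
another, row by row. -/
def entry {c v : ℕ} (i : ℕ) (x y : CV c v) : ℕ := (i * (c * v) + pos x) * (c * v) + pos y

/-- Storing a vector in an array. -/
def storeVec {c v : ℕ} (f : CV c v → ℂ) : ℕ → ℂ :=
  fun j => ∑ x, if pos x = j then f x else 0

/-- Storing a list of matrices in an array. -/
def storeMats {c v n : ℕ} (M : Fin n → Op c v) : ℕ → ℂ :=
  fun j => ∑ i : Fin n, ∑ x : CV c v, ∑ y : CV c v, if entry i x y = j then M i x y else 0

/-- Reading a list of matrices from an array. -/
def loadMats {c v n : ℕ} (q : ℕ → ℂ) : Fin n → Op c v := fun i x y => q (entry i x y)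

/-- The size parameters `a, b, dim C, dim V`, in the variables `0, 1, 2, 3`. -/
def sizes (a b c v : ℕ) : ℕ → ℕ
  | 0 => a
  | 1 => b
  | 2 => c
  | 3 => v
  | _ => 0

/-- The initial memory: `|ψ⟩`, `V_1, …, V_{a+b}`, `Π` and `ρ_1, …, ρ_a` in the arrays `0, 1, 2, 3`,
and zeros elsewhere. -/
def inputMem {a b c v : ℕ} (R : Referee a b c v) (ρ : Fin a → Op c v) : Memory
  | 0 => storeVec R.psi
  | 1 => storeMats R.V
  | 2 => storeMats (fun _ : Fin 1 => R.Pi)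
  | 3 => storeMats ρ
  | _ => fun _ => 0

/-- The tuple of matrices in array `4` after running the program on input `R, ρ_1, …, ρ_a`. -/
noncomputable def Prog.output {a b c v : ℕ} (p : Prog) (R : Referee a b c v)
    (ρ : Fin a → Op c v) : Fin a → Op c v :=
  loadMats (p.run (sizes a b c v) (inputMem R ρ) 4)

end DQIP

/-! Consistent tuples are exactly the transcripts of Alice's strategies: a unitary on `C ⊗ A` leaves
the marginal on `V` unchanged, and two purifications with the same marginal on `V` differ by such a
unitary (`exists_consistent`, `exists_strategy`). The penalty vanishes on them. Hence `μ_ε ≤ λ`, and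
a response that is good for the relaxed game is good against every admissible state.

For the converse, a tuple `ρ` is repaired round by round. Given `ρ'_i`, let `s = Tr_C (V_i ρ'_i
V_i*)`, `τ = Tr_C ρ_{i+1}` and `T = s (τ s)^{-1/2}`. Then `T τ T* ≤ s`, and `Tr (T τ)` is the
fidelity of `s` and `τ` (`transport`). So `(1 ⊗ T) ρ_{i+1} (1 ⊗ T)*`, with the missing mass `s - T τ
T*` added next to `|0⟩⟨0|`, has marginal `s` and is as close to `ρ_{i+1}` as the marginals permit.
In the distance between purifications, each round adds at most `‖√σ - √τ‖₂`, where `σ = Tr_C (V_i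
ρ_i V_i*)` (`near_roundStep`). By Powers–Størmer its square is at most `2 D`, where `D = ⟨τ - σ, Q⟩`
for some measurement operator `Q`, and `√(2 D) ≤ (a/ε) D + ε/(2a)`. Winning probabilities move by at
most the distance (`Near.inn_le`). After `a` rounds the loss is therefore covered by the penalty
plus `ε/2` (`isRounding_spec`), and the spare `ε/2` makes the inequality strict.

The algorithm avoids eigenvectors: `(τ s)^{-1/2}` is a polynomial in `τ s`. Traces of powers give
the characteristic polynomial through Newton's identities, written as a power of one matrix. The
roots of `∏ (X² - d_i)`, with `d_i` the eigenvalues, provide both the interpolation nodes and their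
square roots (`invSqrtOn_invSqrtPoly`). Sums and products are computed along binary trees, so a
round takes polylogarithmic time and only the loop over the `a` rounds is long. -/

namespace DQIP

/-! ### Cost of programs -/

/-- The variables of an index expression satisfy `s`. -/
def NExpr.varsIn (s : ℕ → Bool) : NExpr → Bool
  | .const _ => true
  | .var i => s i
  | .add e f => e.varsIn s && f.varsIn s
  | .sub e f => e.varsIn s && f.varsIn s
  | .mul e f => e.varsIn s && f.varsIn s
  | .div e f => e.varsIn s && f.varsIn s
  | .mod e f => e.varsIn s && f.varsIn s
  | .log e => e.varsIn s

/-- The variables of a scalar expression satisfy `s`. -/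
def SExpr.varsIn (s : ℕ → Bool) : SExpr → Bool
  | .nat e => e.varsIn s
  | .imag => true
  | .read _ e => e.varsIn s
  | .add x y => x.varsIn s && y.varsIn s
  | .sub x y => x.varsIn s && y.varsIn s
  | .mul x y => x.varsIn s && y.varsIn s
  | .inv x => x.varsIn s
  | .conj x => x.varsIn s
  | .ifLE x y u t => (x.varsIn s && y.varsIn s) && (u.varsIn s && t.varsIn s)
  | .root _ off d k => (off.varsIn s && d.varsIn s) && k.varsIn s

/-- The variables of a program, the bound ones included, satisfy `s`. -/
def Prog.varsIn (s : ℕ → Bool) : Prog → Bool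
  | .par x n _ off e => s x && ((n.varsIn s && off.varsIn s) && e.varsIn s)
  | .seq p q => p.varsIn s && q.varsIn s
  | .loop x n p => s x && (n.varsIn s && p.varsIn s)

theorem NExpr.eval_congr {s : ℕ → Bool} {ν ν' : ℕ → ℕ} (h : ∀ i, s i = true → ν i = ν' i)
    (e : NExpr) (he : e.varsIn s = true) : e.eval ν = e.eval ν' := by
  induction e <;> simp_all [NExpr.varsIn, NExpr.eval]

/-- No operation grows faster than multiplication, so values stay polynomial. The base is at least 2
so that powers of it absorb constants (`n ≤ B ^ n`) and the factor 2 of a sum. -/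
theorem NExpr.exists_eval_le_pow (s : ℕ → Bool) (e : NExpr) (he : e.varsIn s = true) :
    ∃ k : ℕ, ∀ (ν : ℕ → ℕ) (B : ℕ), 2 ≤ B → (∀ i, s i = true → ν i ≤ B) → e.eval ν ≤ B ^ k := by
  induction e with
  | const n =>
    exact ⟨n, fun ν B hB _ => (Nat.lt_pow_self (by omega : 1 < B)).le⟩
  | var i => exact ⟨1, fun ν B hB h => by simpa [NExpr.eval] using h i he⟩
  | add e f ihe ihf =>
    simp only [NExpr.varsIn, Bool.and_eq_true] at he
    obtain ⟨k, hk⟩ := ihe he.1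
    obtain ⟨l, hl⟩ := ihf he.2
    refine ⟨k + l + 1, fun ν B hB h => ?_⟩
    have h1 := hk ν B hB h
    have h2 := hl ν B hB h
    have h3 : B ^ k ≤ B ^ (k + l) := Nat.pow_le_pow_right (by omega) (by omega)
    have h4 : B ^ l ≤ B ^ (k + l) := Nat.pow_le_pow_right (by omega) (by omega)
    simp only [NExpr.eval, pow_succ]
    nlinarith
  | mul e f ihe ihf =>
    simp only [NExpr.varsIn, Bool.and_eq_true] at he
    obtain ⟨k, hk⟩ := ihe he.1
    obtain ⟨l, hl⟩ := ihf he.2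
    exact ⟨k + l, fun ν B hB h => by
      simpa only [NExpr.eval, pow_add] using Nat.mul_le_mul (hk ν B hB h) (hl ν B hB h)⟩
  | sub e f ihe ihf =>
    simp only [NExpr.varsIn, Bool.and_eq_true] at he
    obtain ⟨k, hk⟩ := ihe he.1
    exact ⟨k, fun ν B hB h => (Nat.sub_le _ _).trans (hk ν B hB h)⟩
  | div e f ihe ihf =>
    simp only [NExpr.varsIn, Bool.and_eq_true] at he
    obtain ⟨k, hk⟩ := ihe he.1
    exact ⟨k, fun ν B hB h => (Nat.div_le_self _ _).trans (hk ν B hB h)⟩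
  | mod e f ihe ihf =>
    simp only [NExpr.varsIn, Bool.and_eq_true] at he
    obtain ⟨k, hk⟩ := ihe he.1
    exact ⟨k, fun ν B hB h => (Nat.mod_le _ _).trans (hk ν B hB h)⟩
  | log e ihe =>
    obtain ⟨k, hk⟩ := ihe he
    exact ⟨k, fun ν B hB h => (Nat.log_le_self _ _).trans (hk ν B hB h)⟩

/-- `f ν` is bounded by a power of any number `B ≥ 2` that bounds the variables in `s`. -/
def PolyBdd (s : ℕ → Bool) (f : (ℕ → ℕ) → ℕ) : Prop :=
  ∃ k : ℕ, ∀ (ν : ℕ → ℕ) (B : ℕ), 2 ≤ B → (∀ i, s i = true → ν i ≤ B) → f ν ≤ B ^ k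

namespace PolyBdd

variable {s : ℕ → Bool} {f g : (ℕ → ℕ) → ℕ}

theorem const (n : ℕ) : PolyBdd s fun _ => n :=
  ⟨n, fun _ B hB _ => (Nat.lt_pow_self (by omega : 1 < B)).le⟩

theorem add (hf : PolyBdd s f) (hg : PolyBdd s g) : PolyBdd s fun ν => f ν + g ν := by
  obtain ⟨k, hk⟩ := hf
  obtain ⟨l, hl⟩ := hg
  refine ⟨k + l + 1, fun ν B hB h => ?_⟩
  have h1 := hk ν B hB h
  have h2 := hl ν B hB h
  have h3 : B ^ k ≤ B ^ (k + l) := Nat.pow_le_pow_right (by omega) (by omega)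
  have h4 : B ^ l ≤ B ^ (k + l) := Nat.pow_le_pow_right (by omega) (by omega)
  simp only [pow_succ]
  nlinarith

theorem pow (hf : PolyBdd s f) (r : ℕ) : PolyBdd s fun ν => f ν ^ r := by
  obtain ⟨k, hk⟩ := hf
  exact ⟨k * r, fun ν B hB h => by
    simpa only [pow_mul] using Nat.pow_le_pow_left (hk ν B hB h) r⟩

theorem sum_range (hf : PolyBdd s f) (hg : PolyBdd s g) (x : ℕ) :
    PolyBdd s fun ν => ∑ i ∈ Finset.range (f ν), g (Function.update ν x i) := by
  obtain ⟨k, hk⟩ := hf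
  obtain ⟨l, hl⟩ := hg
  refine ⟨k + (k + 1) * l, fun ν B hB h => ?_⟩
  have h1 := hk ν B hB h
  -- The loop variable can exceed `B` but not `B ^ k`, so the bound for `g` is used with base `B ^
  -- (k + 1)`; the exponent `k + 1` keeps this base at least `B`.
  calc ∑ i ∈ Finset.range (f ν), g (Function.update ν x i)
      ≤ ∑ i ∈ Finset.range (f ν), (B ^ (k + 1)) ^ l := by
        refine Finset.sum_le_sum fun i hi => hl _ _ ?_ fun j hj => ?_
        · exact hB.trans (Nat.le_self_pow (by omega) B)
        · by_cases hjx : j = x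
          · subst hjx
            simp only [Function.update_self]
            have : B ^ k ≤ B ^ (k + 1) := Nat.pow_le_pow_right (by omega) (by omega)
            exact ((Finset.mem_range.1 hi).le.trans h1).trans this
          · simp only [Function.update_of_ne hjx]
            exact (h j hj).trans (Nat.le_self_pow (by omega) B)
    _ = f ν * B ^ ((k + 1) * l) := by simp [pow_mul]
    _ ≤ B ^ k * B ^ ((k + 1) * l) := Nat.mul_le_mul_right _ h1
    _ = _ := (pow_add _ _ _).symm

end PolyBdd

theorem SExpr.polyBdd_work (s : ℕ → Bool) (r : ℕ) (e : SExpr) (he : e.varsIn s = true) :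
    PolyBdd s fun ν => e.work r ν := by
  induction e with
  | nat e => exact .const _
  | imag => exact .const _
  | read arr e => exact .const _
  | add x y ihx ihy | sub x y ihx ihy | mul x y ihx ihy =>
    simp only [SExpr.varsIn, Bool.and_eq_true] at he
    exact ((ihx he.1).add (ihy he.2)).add (.const 1)
  | inv x ihx | conj x ihx => exact (ihx he).add (.const 1)
  | ifLE x y u t ihx ihy ihu iht =>
    simp only [SExpr.varsIn, Bool.and_eq_true] at he
    exact ((((ihx he.1.1).add (ihy he.1.2)).add (ihu he.2.1)).add (iht he.2.2)).add (.const 1)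
  | root arr off d k =>
    simp only [SExpr.varsIn, Bool.and_eq_true] at he
    have hd : PolyBdd s fun ν => d.eval ν := d.exists_eval_le_pow s he.1.2
    exact (PolyBdd.const _).add (((PolyBdd.const 1).add hd).pow r)

/-- The work of every program is polynomial in the values of its variables. -/
theorem Prog.polyBdd_work (s : ℕ → Bool) (r : ℕ) (p : Prog) (hp : p.varsIn s = true) :
    PolyBdd s fun ν => p.work r ν := by
  induction p with
  | par x n arr off e =>
    simp only [Prog.varsIn, Bool.and_eq_true] at hp
    have hn : PolyBdd s fun ν => n.eval ν := n.exists_eval_le_pow s hp.2.1.1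
    exact (PolyBdd.const _).add
      (hn.sum_range ((PolyBdd.const 1).add (e.polyBdd_work s r hp.2.2)) x)
  | seq p q ihp ihq =>
    simp only [Prog.varsIn, Bool.and_eq_true] at hp
    exact (ihp hp.1).add (ihq hp.2)
  | loop x n p ih =>
    simp only [Prog.varsIn, Bool.and_eq_true] at hp
    have hn : PolyBdd s fun ν => n.eval ν := n.exists_eval_le_pow s hp.2.1
    exact (PolyBdd.const _).add (hn.sum_range ((PolyBdd.const 1).add (ih hp.2.2)) x)

/-- Root extractions are in degrees given by the variables in `s`. -/
def SExpr.degreesIn (s : ℕ → Bool) : SExpr → Bool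
  | .nat _ => true
  | .imag => true
  | .read _ _ => true
  | .add x y => x.degreesIn s && y.degreesIn s
  | .sub x y => x.degreesIn s && y.degreesIn s
  | .mul x y => x.degreesIn s && y.degreesIn s
  | .inv x => x.degreesIn s
  | .conj x => x.degreesIn s
  | .ifLE x y u t => (x.degreesIn s && y.degreesIn s) && (u.degreesIn s && t.degreesIn s)
  | .root _ _ d _ => d.varsIn s

/-- All loops have logarithmic length in the variables in `s`, which they do not modify. -/
def Prog.shallow (s : ℕ → Bool) : Prog → Bool
  | .par x _ _ _ e => !s x && e.degreesIn s
  | .seq p q => p.shallow s && q.shallow s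
  | .loop x (.add (.log n) (.const _)) p => !s x && (n.varsIn s && p.shallow s)
  | .loop _ _ _ => false

/-- `f ν` is bounded by a power of `1 + log₂ B` for any number `B ≥ 2` that bounds the variables in
`s`. -/
def PolylogBdd (s : ℕ → Bool) (f : (ℕ → ℕ) → ℕ) : Prop :=
  ∃ k : ℕ, ∀ (ν : ℕ → ℕ) (B : ℕ), 2 ≤ B → (∀ i, s i = true → ν i ≤ B) →
    f ν ≤ (1 + Nat.log 2 B) ^ k

theorem two_le_one_add_log {B : ℕ} (hB : 2 ≤ B) : 2 ≤ 1 + Nat.log 2 B := by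
  have : 0 < Nat.log 2 B := Nat.log_pos (by norm_num) hB
  omega

namespace PolylogBdd

variable {s : ℕ → Bool} {f g : (ℕ → ℕ) → ℕ}

theorem mono (hf : PolylogBdd s f) (h : ∀ ν, g ν ≤ f ν) : PolylogBdd s g := by
  obtain ⟨k, hk⟩ := hf
  exact ⟨k, fun ν B hB hν => (h ν).trans (hk ν B hB hν)⟩

theorem const (n : ℕ) : PolylogBdd s fun _ => n :=
  ⟨n, fun _ _ hB _ => (Nat.lt_pow_self (by have := two_le_one_add_log hB; omega)).le⟩

theorem add (hf : PolylogBdd s f) (hg : PolylogBdd s g) : PolylogBdd s fun ν => f ν + g ν := by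
  obtain ⟨k, hk⟩ := hf
  obtain ⟨l, hl⟩ := hg
  refine ⟨k + l + 1, fun ν B hB h => ?_⟩
  have h0 := two_le_one_add_log hB
  have h1 := hk ν B hB h
  have h2 := hl ν B hB h
  have h3 : (1 + Nat.log 2 B) ^ k ≤ (1 + Nat.log 2 B) ^ (k + l) :=
    Nat.pow_le_pow_right (by omega) (by omega)
  have h4 : (1 + Nat.log 2 B) ^ l ≤ (1 + Nat.log 2 B) ^ (k + l) :=
    Nat.pow_le_pow_right (by omega) (by omega)
  rw [pow_succ]
  nlinarith

theorem mul (hf : PolylogBdd s f) (hg : PolylogBdd s g) : PolylogBdd s fun ν => f ν * g ν := by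
  obtain ⟨k, hk⟩ := hf
  obtain ⟨l, hl⟩ := hg
  exact ⟨k + l, fun ν B hB h => by
    simpa only [pow_add] using Nat.mul_le_mul (hk ν B hB h) (hl ν B hB h)⟩

theorem pow (hf : PolylogBdd s f) (r : ℕ) : PolylogBdd s fun ν => f ν ^ r := by
  obtain ⟨k, hk⟩ := hf
  exact ⟨k * r, fun ν B hB h => by
    simpa only [pow_mul] using Nat.pow_le_pow_left (hk ν B hB h) r⟩

/-- A value at most `B ^ k` has logarithm at most `k (1 + log₂ B)`, and the factor `k` is absorbed
because `1 + log₂ B ≥ 2`. -/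
theorem log (e : NExpr) (he : e.varsIn s = true) : PolylogBdd s fun ν => Nat.log 2 (e.eval ν) := by
  obtain ⟨k, hk⟩ := e.exists_eval_le_pow s he
  refine ⟨k + 2, fun ν B hB h => ?_⟩
  have h0 := two_le_one_add_log hB
  have h1 : e.eval ν ≤ 2 ^ ((1 + Nat.log 2 B) * k) := by
    refine (hk ν B hB h).trans ?_
    rw [pow_mul, add_comm]
    exact Nat.pow_le_pow_left (Nat.lt_pow_succ_log_self (by norm_num) B).le k
  have h2 : Nat.log 2 (e.eval ν) ≤ (1 + Nat.log 2 B) * k := by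
    calc Nat.log 2 (e.eval ν) ≤ Nat.log 2 (2 ^ ((1 + Nat.log 2 B) * k)) := Nat.log_mono_right h1
      _ = _ := Nat.log_pow (by norm_num) _
  have h3 : k ≤ (1 + Nat.log 2 B) ^ k := (Nat.lt_pow_self (by omega)).le
  calc _ ≤ (1 + Nat.log 2 B) * k := h2
    _ ≤ (1 + Nat.log 2 B) * (1 + Nat.log 2 B) ^ k := Nat.mul_le_mul_left _ h3
    _ = (1 + Nat.log 2 B) ^ (k + 1) := by ring
    _ ≤ _ := Nat.pow_le_pow_right (by omega) (by omega)

/-- Processor numbers and loop counters may be large. They do no harm because `x` lies outside `s`,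
so that changing it leaves the assumption on the variables intact. -/
theorem sup_range (hg : PolylogBdd s g) (n : (ℕ → ℕ) → ℕ) {x : ℕ} (hx : s x = false) :
    PolylogBdd s fun ν => (Finset.range (n ν)).sup fun i => g (Function.update ν x i) := by
  obtain ⟨l, hl⟩ := hg
  refine ⟨l, fun ν B hB h => Finset.sup_le fun i _ => hl _ _ hB fun j hj => ?_⟩
  rw [Function.update_of_ne (by rintro rfl; simp_all)]
  exact h j hj

theorem sum_range (hf : PolylogBdd s f) (hg : PolylogBdd s g) {x : ℕ} (hx : s x = false) :
    PolylogBdd s fun ν => ∑ i ∈ Finset.range (f ν), g (Function.update ν x i) := by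
  refine (hf.mul (hg.sup_range f hx)).mono fun ν => ?_
  calc _ ≤ ∑ i ∈ Finset.range (f ν),
        (Finset.range (f ν)).sup fun i => g (Function.update ν x i) :=
        Finset.sum_le_sum fun i hi =>
          Finset.le_sup (f := fun i => g (Function.update ν x i)) hi
    _ = _ := by simp

end PolylogBdd

theorem SExpr.polylogBdd_time (s : ℕ → Bool) (r : ℕ) (e : SExpr) (he : e.degreesIn s = true) :
    PolylogBdd s fun ν => e.time r ν := by
  induction e with
  | nat e => exact .const _
  | imag => exact .const _
  | read arr e => exact .const _
  | add x y ihx ihy | sub x y ihx ihy | mul x y ihx ihy =>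
    simp only [SExpr.degreesIn, Bool.and_eq_true] at he
    exact ((ihx he.1).add (ihy he.2)).add (.const 1)
  | inv x ihx | conj x ihx => exact (ihx he).add (.const 1)
  | ifLE x y u t ihx ihy ihu iht =>
    simp only [SExpr.degreesIn, Bool.and_eq_true] at he
    exact ((((ihx he.1.1).add (ihy he.1.2)).add (ihu he.2.1)).add (iht he.2.2)).add (.const 1)
  | root arr off d k =>
    exact (PolylogBdd.const _).add (((PolylogBdd.const 1).add (.log d he)).pow r)

/-- Shallow programs run in polylogarithmic time. -/
theorem Prog.polylogBdd_time (s : ℕ → Bool) (r : ℕ) (p : Prog) (hp : p.shallow s = true) :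
    PolylogBdd s fun ν => p.time r ν := by
  induction p with
  | par x n arr off e =>
    simp only [Prog.shallow, Bool.and_eq_true, Bool.not_eq_true'] at hp
    exact (PolylogBdd.const _).add ((e.polylogBdd_time s r hp.2).sup_range _ hp.1)
  | seq p q ihp ihq =>
    simp only [Prog.shallow, Bool.and_eq_true] at hp
    exact (ihp hp.1).add (ihq hp.2)
  | loop x n p ih =>
    unfold Prog.shallow at hp
    split at hp
    · simp_all
    · simp_all
    · rename_i x' n' k' p' heq
      cases heq
      simp only [Bool.and_eq_true, Bool.not_eq_true'] at hp
      have hn : PolylogBdd s fun ν => Nat.log 2 (n'.eval ν) + k' :=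
        (PolylogBdd.log n' hp.2.1).add (.const k')
      exact (PolylogBdd.const _).add
        (hn.sum_range ((PolylogBdd.const 1).add (ih hp.2.2)) hp.1)
    · simp at hp

/-! ### Parallel summation of tensors -/

/-- Substitution of index expressions for the index variables. -/
def NExpr.subst (s : ℕ → NExpr) : NExpr → NExpr
  | .const n => .const n
  | .var i => s i
  | .add e f => .add (e.subst s) (f.subst s)
  | .sub e f => .sub (e.subst s) (f.subst s)
  | .mul e f => .mul (e.subst s) (f.subst s)
  | .div e f => .div (e.subst s) (f.subst s)
  | .mod e f => .mod (e.subst s) (f.subst s)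
  | .log e => .log (e.subst s)

/-- Substitution of index expressions for the index variables. -/
def SExpr.subst (s : ℕ → NExpr) : SExpr → SExpr
  | .nat e => .nat (e.subst s)
  | .imag => .imag
  | .read arr e => .read arr (e.subst s)
  | .add x y => .add (x.subst s) (y.subst s)
  | .sub x y => .sub (x.subst s) (y.subst s)
  | .mul x y => .mul (x.subst s) (y.subst s)
  | .inv x => .inv (x.subst s)
  | .conj x => .conj (x.subst s)
  | .ifLE x y u t => .ifLE (x.subst s) (y.subst s) (u.subst s) (t.subst s)
  | .root arr off d k => .root arr (off.subst s) (d.subst s) (k.subst s)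

theorem NExpr.eval_subst (s : ℕ → NExpr) (ν : ℕ → ℕ) (e : NExpr) :
    (e.subst s).eval ν = e.eval fun i => (s i).eval ν := by
  induction e <;> simp_all [NExpr.subst, NExpr.eval]

theorem SExpr.eval_subst (s : ℕ → NExpr) (ν : ℕ → ℕ) (m : Memory) (e : SExpr) :
    (e.subst s).eval ν m = e.eval (fun i => (s i).eval ν) m := by
  induction e <;> simp_all [SExpr.subst, SExpr.eval, NExpr.eval_subst]

/-- The variables that hold `dim C` and `dim V`. -/
def isDim (i : ℕ) : Bool := i == 2 || i == 3

theorem NExpr.eval_dim {ν ν' : ℕ → ℕ} (h2 : ν 2 = ν' 2) (h3 : ν 3 = ν' 3) {e : NExpr}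
    (he : e.varsIn isDim = true) : e.eval ν = e.eval ν' := by
  refine e.eval_congr (fun i hi => ?_) he
  simp only [isDim, Bool.or_eq_true, beq_iff_eq] at hi
  rcases hi with rfl | rfl <;> assumption

/-- The index variables while an entry of a tensor is computed: `10, 11, 12` hold the position of
the entry, `13` the summation index. -/
def tensorEnv (ν : ℕ → ℕ) (b x y l : ℕ) : ℕ → ℕ
  | 10 => b
  | 11 => x
  | 12 => y
  | 13 => l
  | i => ν i

/-- Decoding of the processor number `10` into the variables of `tensorEnv`. -/
def decode (D₀ D₁ D₂ : NExpr) : ℕ → NExpr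
  | 10 => .div (.div (.mod (.var 10) (.mul (.mul D₀ D₁) D₂)) D₂) D₁
  | 11 => .mod (.div (.mod (.var 10) (.mul (.mul D₀ D₁) D₂)) D₂) D₁
  | 12 => .mod (.mod (.var 10) (.mul (.mul D₀ D₁) D₂)) D₂
  | 13 => .div (.var 10) (.mul (.mul D₀ D₁) D₂)
  | i => .var i

/-- The array used for intermediate results. -/
abbrev tmpArr : ℕ := 100

/-- Entry `(b, x, y)` of the tensor of shape `D₀ × D₁ × D₂` that starts at `off` in `arr` becomes
`∑ l < L, e`, for all `(b, x, y)` at once. -/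
def sumTensor (arr : ℕ) (off D₀ D₁ D₂ L : NExpr) (e : SExpr) : Prog :=
  let D := NExpr.mul (.mul D₀ D₁) D₂
  -- There are `2 L` slices of size `D`, of which the last `L` are zero: slice `i < L` is going to
  -- read the slices `2 i` and `2 i + 1`.
  .seq (.par 10 (.mul (.mul (.const 2) L) D) tmpArr (.const 0)
      (.ifLE (.nat (.add (.div (.var 10) D) (.const 1))) (.nat L)
        (e.subst (decode D₀ D₁ D₂)) (.nat (.const 0))))
    (.seq (.loop 14 (.add (.log L) (.const 1))
        (.par 10 (.mul L D) tmpArr (.const 0)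
          -- For processor `i * D + k` the two cells are `2 i * D + k` and `(2 i + 1) * D + k`. All
          -- processors read before any of them writes, so the tree is folded in place.
          (.add (.read tmpArr (.add (.var 10) (.mul (.div (.var 10) D) D)))
            (.read tmpArr (.add (.add (.var 10) (.mul (.div (.var 10) D) D)) D)))))
      (.par 10 D arr off (.read tmpArr (.var 10))))

/-- Processor numbers are mixed-radix numerals with leading digit `l` and lower digits `b, x, y`. -/
theorem decode_env {D₀ D₁ D₂ : NExpr} (h₀ : D₀.varsIn isDim = true) (h₁ : D₁.varsIn isDim = true)
    (h₂ : D₂.varsIn isDim = true) (ν : ℕ → ℕ) {b x y l : ℕ} (hb : b < D₀.eval ν)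
    (hx : x < D₁.eval ν) (hy : y < D₂.eval ν) :
    (fun i => (decode D₀ D₁ D₂ i).eval (Function.update ν 10
      (l * (D₀.eval ν * D₁.eval ν * D₂.eval ν) + ((b * D₁.eval ν + x) * D₂.eval ν + y))))
      = tensorEnv ν b x y l := by
  set z := l * (D₀.eval ν * D₁.eval ν * D₂.eval ν) + ((b * D₁.eval ν + x) * D₂.eval ν + y) with hz
  have e₀ : D₀.eval (Function.update ν 10 z) = D₀.eval ν := NExpr.eval_dim (by simp) (by simp) h₀
  have e₁ : D₁.eval (Function.update ν 10 z) = D₁.eval ν := NExpr.eval_dim (by simp) (by simp) h₁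
  have e₂ : D₂.eval (Function.update ν 10 z) = D₂.eval ν := NExpr.eval_dim (by simp) (by simp) h₂
  generalize D₀.eval ν = d₀ at *
  generalize D₁.eval ν = d₁ at *
  generalize D₂.eval ν = d₂ at *
  have hbx : b * d₁ + x < d₀ * d₁ := by nlinarith
  have hk : (b * d₁ + x) * d₂ + y < d₀ * d₁ * d₂ := by nlinarith
  have hmod : z % (d₀ * d₁ * d₂) = (b * d₁ + x) * d₂ + y := by
    rw [hz, mul_comm, Nat.mul_add_mod, Nat.mod_eq_of_lt hk]
  have hdiv : z / (d₀ * d₁ * d₂) = l := by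
    rw [hz, add_comm, Nat.add_mul_div_right _ _ (by omega), Nat.div_eq_of_lt hk, zero_add]
  have hdiv2 : ((b * d₁ + x) * d₂ + y) / d₂ = b * d₁ + x := by
    rw [add_comm, Nat.add_mul_div_right _ _ (by omega), Nat.div_eq_of_lt hy, zero_add]
  have hdiv1 : (b * d₁ + x) / d₁ = b := by
    rw [add_comm, Nat.add_mul_div_right _ _ (by omega), Nat.div_eq_of_lt hx, zero_add]
  have hmod2 : ((b * d₁ + x) * d₂ + y) % d₂ = y := by
    rw [mul_comm, Nat.mul_add_mod, Nat.mod_eq_of_lt hy]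
  have hmod1 : (b * d₁ + x) % d₁ = x := by
    rw [mul_comm, Nat.mul_add_mod, Nat.mod_eq_of_lt hx]
  funext i
  unfold decode tensorEnv
  split <;> simp_all [NExpr.eval]

theorem sum_range_two_mul_pow (g : ℕ → ℂ) (i t : ℕ) :
    ∑ j ∈ Finset.range (2 ^ t), g (2 * i * 2 ^ t + j)
      + ∑ j ∈ Finset.range (2 ^ t), g ((2 * i + 1) * 2 ^ t + j)
      = ∑ j ∈ Finset.range (2 ^ (t + 1)), g (i * 2 ^ (t + 1) + j) := by
  rw [pow_succ, mul_two, Finset.sum_range_add]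
  congr 1
  · exact Finset.sum_congr rfl fun j _ => by ring_nf
  · exact Finset.sum_congr rfl fun j _ => by ring_nf

/-- The effect of the loop in `sumTensor`. -/
theorem sumTree_spec {D L : ℕ} {F : ℕ → ℕ → ℂ} {g : ℕ → ℕ → ℂ}
    (hg : ∀ k i, L ≤ i → g k i = 0) (h0 : ∀ k < D, ∀ i < 2 * L, F 0 (i * D + k) = g k i)
    (hF : ∀ t z, F (t + 1) z = if z < L * D then F t (z + z / D * D) + F t (z + z / D * D + D)
      else F t z) (t : ℕ) :
    ∀ k < D, ∀ i < 2 * L, F t (i * D + k) = ∑ j ∈ Finset.range (2 ^ t), g k (i * 2 ^ t + j) := by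
  induction t with
  | zero => simpa using h0
  | succ t ih =>
    intro k hk i hi
    have hdiv : (i * D + k) / D = i := by
      rw [add_comm, Nat.add_mul_div_right _ _ (by omega), Nat.div_eq_of_lt hk, zero_add]
    rw [hF, hdiv]
    by_cases h : i < L
    · have hlt : i * D + k < L * D := by nlinarith
      rw [if_pos hlt, show i * D + k + i * D = 2 * i * D + k by ring,
        show 2 * i * D + k + D = (2 * i + 1) * D + k by ring, ih k hk _ (by omega),
        ih k hk _ (by omega), sum_range_two_mul_pow]
    -- Slices from `L` on are never rewritten; they represent sums of padding only, hence remain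
    -- zero.
    · have hlt : ¬ i * D + k < L * D := by
        have : L * D ≤ i * D := Nat.mul_le_mul_right _ (by omega)
        omega
      rw [if_neg hlt, ih k hk i hi]
      rw [Finset.sum_eq_zero, Finset.sum_eq_zero]
      · intro j _
        have : i ≤ i * 2 ^ (t + 1) := Nat.le_mul_of_pos_right _ (by positivity)
        exact hg _ _ (by omega)
      · intro j _
        have : i ≤ i * 2 ^ t := Nat.le_mul_of_pos_right _ (by positivity)
        exact hg _ _ (by omega)

/-- The shape depends on the dimensions only, so loop counters and processor numbers do not alter
it. All summands are evaluated on the initial memory before anything is written; `e` may therefore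
read `arr` itself, as `prodTree` does. The second half is the frame condition that lets programs be
chained. -/
theorem run_sumTensor (arr : ℕ) (off : NExpr) {D₀ D₁ D₂ L : NExpr} (e : SExpr)
    (h₀ : D₀.varsIn isDim = true) (h₁ : D₁.varsIn isDim = true) (h₂ : D₂.varsIn isDim = true)
    (hL : L.varsIn isDim = true) (ν : ℕ → ℕ) (m : Memory) (hpos : 0 < L.eval ν) :
    (∀ b < D₀.eval ν, ∀ x < D₁.eval ν, ∀ y < D₂.eval ν,
      (sumTensor arr off D₀ D₁ D₂ L e).run ν m arr
        (off.eval ν + ((b * D₁.eval ν + x) * D₂.eval ν + y))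
        = ∑ l ∈ Finset.range (L.eval ν), e.eval (tensorEnv ν b x y l) m) ∧
    ∀ i j, i ≠ tmpArr → (i = arr → j < off.eval ν ∨
      off.eval ν + D₀.eval ν * D₁.eval ν * D₂.eval ν ≤ j) →
      (sumTensor arr off D₀ D₁ D₂ L e).run ν m i j = m i j := by
  set D := D₀.eval ν * D₁.eval ν * D₂.eval ν with hD
  have hDe : ∀ ν' : ℕ → ℕ, ν' 2 = ν 2 → ν' 3 = ν 3 →
      (NExpr.mul (.mul D₀ D₁) D₂).eval ν' = D := fun ν' h2 h3 => by
    simp only [NExpr.eval, hD]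
    rw [NExpr.eval_dim h2 h3 h₀, NExpr.eval_dim h2 h3 h₁, NExpr.eval_dim h2 h3 h₂]
  have hLe : ∀ ν' : ℕ → ℕ, ν' 2 = ν 2 → ν' 3 = ν 3 → L.eval ν' = L.eval ν := fun ν' h2 h3 =>
    NExpr.eval_dim h2 h3 hL
  set E := NExpr.mul (.mul D₀ D₁) D₂ with hE
  let p1 : Prog := .par 10 (.mul (.mul (.const 2) L) E) tmpArr (.const 0)
      (.ifLE (.nat (.add (.div (.var 10) E) (.const 1))) (.nat L)
        (e.subst (decode D₀ D₁ D₂)) (.nat (.const 0)))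
  let body : Prog := .par 10 (.mul L E) tmpArr (.const 0)
          (.add (.read tmpArr (.add (.var 10) (.mul (.div (.var 10) E) E)))
            (.read tmpArr (.add (.add (.var 10) (.mul (.div (.var 10) E) E)) E)))
  let M : ℕ → Memory := fun t => Nat.rec (p1.run ν m)
    (fun i m' => body.run (Function.update ν 14 i) m') t
  have hrun : (sumTensor arr off D₀ D₁ D₂ L e).run ν m = fun i j =>
      if i = arr ∧ off.eval ν ≤ j ∧ j < off.eval ν + D then
        M (Nat.log 2 (L.eval ν) + 1) tmpArr (j - off.eval ν)
      else M (Nat.log 2 (L.eval ν) + 1) i j := by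
    funext i j
    simp only [sumTensor, Prog.run, SExpr.eval, NExpr.eval, M, p1, body, hE, hD]
    simp
  have hother : ∀ t i j, i ≠ tmpArr → M t i j = m i j := by
    intro t i j hi
    induction t with
    | zero => simp [M, p1, Prog.run, hi]
    | succ t ih => rw [← ih]; simp [M, body, Prog.run, hi]
  have hstep : ∀ t z, M (t + 1) tmpArr z = if z < L.eval ν * D then
      M t tmpArr (z + z / D * D) + M t tmpArr (z + z / D * D + D) else M t tmpArr z := by
    intro t z
    have h1 := hDe (Function.update ν 14 t) (by simp) (by simp)
    have h2 := hLe (Function.update ν 14 t) (by simp) (by simp)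
    have h3 := hDe (Function.update (Function.update ν 14 t) 10 z) (by simp) (by simp)
    simp only [M, body, Prog.run, NExpr.eval, SExpr.eval, h1, h2, h3, Nat.zero_le, true_and,
      zero_add, Nat.sub_zero, Function.update_self]
  let g : ℕ → ℕ → ℂ := fun k i => if i < L.eval ν then
    (e.subst (decode D₀ D₁ D₂)).eval (Function.update ν 10 (i * D + k)) m else 0
  have hinit : ∀ k < D, ∀ i < 2 * L.eval ν, M 0 tmpArr (i * D + k) = g k i := by
    intro k hk i hi
    have hdiv : (i * D + k) / D = i := by
      rw [add_comm, Nat.add_mul_div_right _ _ (by omega), Nat.div_eq_of_lt hk, zero_add]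
    have h1 := hDe ν rfl rfl
    have h2 := hDe (Function.update ν 10 (i * D + k)) (by simp) (by simp)
    have h3 := hLe (Function.update ν 10 (i * D + k)) (by simp) (by simp)
    have hlt : i * D + k < 2 * L.eval ν * D := by nlinarith
    change p1.run ν m tmpArr (i * D + k) = g k i
    simp only [p1, Prog.run, NExpr.eval, SExpr.eval, h1, h2, h3, Nat.zero_le, true_and,
      zero_add, Nat.sub_zero, Function.update_self, hlt, if_true, hdiv, g, Complex.natCast_re,
      Nat.cast_le, Nat.cast_zero]
    rfl
  have hfinal := sumTree_spec (F := fun t => M t tmpArr) (g := g)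
    (fun k i hi => by simp [g, Nat.not_lt.2 hi]) hinit hstep (Nat.log 2 (L.eval ν) + 1)
  constructor
  · intro b hb x hx y hy
    have hk : (b * D₁.eval ν + x) * D₂.eval ν + y < D := by
      have hbx : b * D₁.eval ν + x < D₀.eval ν * D₁.eval ν := by nlinarith
      rw [hD]
      nlinarith
    have := hfinal _ hk 0 (by omega)
    simp only [zero_mul, zero_add] at this
    rw [hrun]
    simp only [Nat.le_add_right, add_lt_add_iff_left, hk, and_self, if_true,
      Nat.add_sub_cancel_left]
    rw [this]
    -- After `log L + 1` rounds slice `0` covers more than `L` indices; the surplus terms vanish.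
    have hle : L.eval ν ≤ 2 ^ (Nat.log 2 (L.eval ν) + 1) :=
      (Nat.lt_pow_succ_log_self (by norm_num) _).le
    rw [← Finset.sum_subset (Finset.range_subset_range.2 hle)]
    · refine Finset.sum_congr rfl fun l hl => ?_
      simp only [g, Finset.mem_range.1 hl, if_true]
      rw [SExpr.eval_subst, decode_env h₀ h₁ h₂ ν hb hx hy]
    · intro l _ hl
      simp [g, Finset.mem_range.not.1 hl]
  · intro i j hi hj
    rw [hrun]
    simp only []
    refine (if_neg ?_).trans (hother (Nat.log 2 (L.eval ν) + 1) i j hi)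
    rintro ⟨h1, h2, h3⟩
    rcases hj h1 with h | h <;> omega

/-! ### Parallel products of matrices -/

/-- The `b`-th matrix of a list of `d × d` matrices. -/
def matAt (q : ℕ → ℂ) (d b : ℕ) : Matrix (Fin d) (Fin d) ℂ :=
  fun x y => q ((b * d + x) * d + y)

/-- Products of `K` lists of `L` matrices of size `d`; matrix `i` of list `k` is matrix `i * K + k`
of the array, and product `k` becomes matrix `k`. -/
def prodTree (arr : ℕ) (K L d : NExpr) : Prog :=
  .loop 15 (.add (.log L) (.const 1))
    (sumTensor arr (.const 0) (.mul L K) d d d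
      (.mul
        (.read arr (.add (.mul (.add (.mul (.add (.var 10) (.mul (.div (.var 10) K) K)) d)
          (.var 11)) d) (.var 13)))
        (.read arr (.add (.mul (.add (.mul (.add (.add (.var 10) (.mul (.div (.var 10) K) K)) K) d)
          (.var 13)) d) (.var 12)))))

theorem prod_range_two_mul_pow {M : Type} [Monoid M] (g : ℕ → M) (i t : ℕ) :
    ((List.range (2 ^ t)).map fun j => g (2 * i * 2 ^ t + j)).prod
      * ((List.range (2 ^ t)).map fun j => g ((2 * i + 1) * 2 ^ t + j)).prod
      = ((List.range (2 ^ (t + 1))).map fun j => g (i * 2 ^ (t + 1) + j)).prod := by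
  rw [pow_succ, mul_two, List.range_add, List.map_append, List.prod_append, List.map_map]
  congr 2
  · exact List.map_congr_left fun j _ => by ring_nf
  · exact List.map_congr_left fun j _ => by simp only [Function.comp]; ring_nf

/-- The halving of `sumTree_spec` with padding `1` instead of `0`. Neighbouring factors are
combined, so the order is preserved and no commutativity is needed. -/
theorem prodTree_aux {M : Type} [Monoid M] {K L : ℕ} {F : ℕ → ℕ → M} {g : ℕ → ℕ → M}
    (hg : ∀ k i, L ≤ i → g k i = 1) (h0 : ∀ k < K, ∀ i < 2 * L, F 0 (i * K + k) = g k i)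
    (hF : ∀ t, ∀ z < L * K, F (t + 1) z = F t (z + z / K * K) * F t (z + z / K * K + K))
    (hF' : ∀ t, ∀ z, L * K ≤ z → F (t + 1) z = F t z) (t : ℕ) :
    ∀ k < K, ∀ i < 2 * L,
      F t (i * K + k) = ((List.range (2 ^ t)).map fun j => g k (i * 2 ^ t + j)).prod := by
  induction t with
  | zero => simpa using h0
  | succ t ih =>
    intro k hk i hi
    have hdiv : (i * K + k) / K = i := by
      rw [add_comm, Nat.add_mul_div_right _ _ (by omega), Nat.div_eq_of_lt hk, zero_add]
    by_cases h : i < L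
    · have hlt : i * K + k < L * K := by nlinarith
      rw [hF _ _ hlt, hdiv, show i * K + k + i * K = 2 * i * K + k by ring,
        show 2 * i * K + k + K = (2 * i + 1) * K + k by ring, ih k hk _ (by omega),
        ih k hk _ (by omega), prod_range_two_mul_pow]
    · have hle : L * K ≤ i * K + k := by
        have : L * K ≤ i * K := Nat.mul_le_mul_right _ (by omega)
        omega
      rw [hF' _ _ hle, ih k hk i hi]
      have key : ∀ s : ℕ, ((List.range (2 ^ s)).map fun j => g k (i * 2 ^ s + j)).prod = 1 := by
        intro s
        refine List.prod_eq_one fun a ha => ?_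
        obtain ⟨j, _, rfl⟩ := List.mem_map.1 ha
        have : i ≤ i * 2 ^ s := Nat.le_mul_of_pos_right _ (by positivity)
        exact hg _ _ (by omega)
      rw [key, key]

/-- Each list has to be stored with `L` identity matrices behind its `L` factors, for the same
reason as the zeros in `sumTensor`. -/
theorem run_prodTree (arr : ℕ) (harr : arr ≠ tmpArr) {K L d : NExpr}
    (hK : K.varsIn isDim = true) (hL : L.varsIn isDim = true) (hd : d.varsIn isDim = true)
    (ν : ℕ → ℕ) (m : Memory) (hpos : 0 < L.eval ν) (hdpos : 0 < d.eval ν)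
    (g : ℕ → ℕ → Matrix (Fin (d.eval ν)) (Fin (d.eval ν)) ℂ)
    (hg : ∀ k < K.eval ν, ∀ i < 2 * L.eval ν, matAt (m arr) (d.eval ν) (i * K.eval ν + k)
      = if i < L.eval ν then g k i else 1) :
    (∀ k < K.eval ν, matAt ((prodTree arr K L d).run ν m arr) (d.eval ν) k
      = ((List.range (L.eval ν)).map (g k)).prod) ∧
    ∀ i, i ≠ tmpArr → i ≠ arr → (prodTree arr K L d).run ν m i = m i := by
  set e : SExpr := .mul
        (.read arr (.add (.mul (.add (.mul (.add (.var 10) (.mul (.div (.var 10) K) K)) d)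
          (.var 11)) d) (.var 13)))
        (.read arr (.add (.mul (.add (.mul (.add (.add (.var 10) (.mul (.div (.var 10) K) K)) K) d)
          (.var 13)) d) (.var 12))) with he
  let M : ℕ → Memory := fun t => Nat.rec m (fun i m' =>
    (sumTensor arr (.const 0) (.mul L K) d d d e).run (Function.update ν 15 i) m') t
  have hrun : (prodTree arr K L d).run ν m = M (Nat.log 2 (L.eval ν) + 1) := rfl
  have hspec : ∀ t, _ := fun t => run_sumTensor arr (.const 0) (D₀ := .mul L K) (D₁ := d) (D₂ := d)
    (L := d) e (by simp [NExpr.varsIn, hL, hK]) hd hd hd (Function.update ν 15 t) (M t)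
    (by rwa [NExpr.eval_dim (ν' := ν) (by simp) (by simp) hd])
  have hKe : ∀ ν' : ℕ → ℕ, ν' 2 = ν 2 → ν' 3 = ν 3 → K.eval ν' = K.eval ν := fun ν' h2 h3 =>
    NExpr.eval_dim h2 h3 hK
  have hLe : ∀ ν' : ℕ → ℕ, ν' 2 = ν 2 → ν' 3 = ν 3 → L.eval ν' = L.eval ν := fun ν' h2 h3 =>
    NExpr.eval_dim h2 h3 hL
  have hde : ∀ ν' : ℕ → ℕ, ν' 2 = ν 2 → ν' 3 = ν 3 → d.eval ν' = d.eval ν := fun ν' h2 h3 =>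
    NExpr.eval_dim h2 h3 hd
  have hother : ∀ t i, i ≠ tmpArr → i ≠ arr → M t i = m i := by
    intro t i hi hi'
    induction t with
    | zero => rfl
    | succ t ih =>
      rw [← ih]
      funext j
      exact (hspec t).2 i j hi fun h => absurd h hi'
  refine ⟨fun k hk => ?_, fun i hi hi' => hother (Nat.log 2 (L.eval ν) + 1) i hi hi'⟩
  have hmul : ∀ t, ∀ z < L.eval ν * K.eval ν, matAt (M (t + 1) arr) (d.eval ν) z
      = matAt (M t arr) (d.eval ν) (z + z / K.eval ν * K.eval ν)
        * matAt (M t arr) (d.eval ν) (z + z / K.eval ν * K.eval ν + K.eval ν) := by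
    intro t z hz
    ext x y
    have h := (hspec t).1 z (by
        simpa only [NExpr.eval, hLe (Function.update ν 15 t) (by simp) (by simp),
          hKe (Function.update ν 15 t) (by simp) (by simp)] using hz)
      x (lt_of_lt_of_eq x.2 (hde _ (by simp) (by simp)).symm)
      y (lt_of_lt_of_eq y.2 (hde _ (by simp) (by simp)).symm)
    rw [hde (Function.update ν 15 t) (by simp) (by simp)] at h
    simp only [NExpr.eval, zero_add] at h
    rw [Matrix.mul_apply, ← Fin.sum_univ_eq_sum_range (fun l => e.eval _ (M t))] at *
    refine h.trans (Finset.sum_congr rfl fun l _ => ?_)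
    have h1 := hKe (tensorEnv (Function.update ν 15 t) z x y l)
      (by simp [tensorEnv]) (by simp [tensorEnv])
    have h2 := hde (tensorEnv (Function.update ν 15 t) z x y l)
      (by simp [tensorEnv]) (by simp [tensorEnv])
    simp only [he, SExpr.eval, NExpr.eval, h1, h2, matAt, tensorEnv]
  have hkeep : ∀ t, ∀ z, L.eval ν * K.eval ν ≤ z → matAt (M (t + 1) arr) (d.eval ν) z
      = matAt (M t arr) (d.eval ν) z := by
    intro t z hz
    ext x y
    refine (hspec t).2 arr _ harr fun _ => Or.inr ?_
    simp only [NExpr.eval, hLe (Function.update ν 15 t) (by simp) (by simp),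
      hKe (Function.update ν 15 t) (by simp) (by simp),
      hde (Function.update ν 15 t) (by simp) (by simp), zero_add]
    calc L.eval ν * K.eval ν * d.eval ν * d.eval ν
        ≤ z * d.eval ν * d.eval ν := by gcongr
      _ ≤ (z * d.eval ν + x) * d.eval ν := by gcongr; omega
      _ ≤ _ := Nat.le_add_right _ _
  have hfinal := prodTree_aux (F := fun t => matAt (M t arr) (d.eval ν))
    (g := fun k i => if i < L.eval ν then g k i else 1)
    (fun k i hi => by simp [Nat.not_lt.2 hi]) hg hmul hkeep (Nat.log 2 (L.eval ν) + 1) k hk 0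
    (by omega)
  simp only [zero_mul, zero_add] at hfinal
  rw [hrun, hfinal]
  have hle : L.eval ν ≤ 2 ^ (Nat.log 2 (L.eval ν) + 1) :=
      (Nat.lt_pow_succ_log_self (by norm_num) _).le
  obtain ⟨r, hr⟩ := Nat.exists_eq_add_of_le hle
  rw [hr, List.range_add, List.map_append, List.prod_append, List.map_map]
  rw [List.prod_eq_one (l := List.map _ (List.range r)), mul_one]
  · congr 1
    exact List.map_congr_left fun i hi => by simp [List.mem_range.1 hi]
  · intro a ha
    obtain ⟨j, _, rfl⟩ := List.mem_map.1 ha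
    simp

/-! ### The Hilbert–Schmidt inner product -/

section HilbertSchmidt

variable {m n k : Type} [Fintype m] [Fintype n] [Fintype k]

/-- The real part of the Hilbert–Schmidt inner product of rectangular matrices. -/
def rin (X Y : Matrix m n ℂ) : ℝ := (Xᴴ * Y).trace.re

/-- A rectangular matrix as a vector of a Hilbert space. -/
noncomputable def toVec (X : Matrix m n ℂ) : EuclideanSpace ℂ (m × n) :=
  WithLp.toLp 2 fun p => X p.1 p.2

/-- The Hilbert–Schmidt norm. -/
noncomputable def fro (X : Matrix m n ℂ) : ℝ := ‖toVec X‖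

theorem toVec_add (X Y : Matrix m n ℂ) : toVec (X + Y) = toVec X + toVec Y := rfl

theorem toVec_sub (X Y : Matrix m n ℂ) : toVec (X - Y) = toVec X - toVec Y := rfl

theorem rin_eq_inner (X Y : Matrix m n ℂ) : rin X Y = (inner ℂ (toVec X) (toVec Y)).re := by
  simp only [rin, toVec, Matrix.trace, Matrix.diag, Matrix.mul_apply, Matrix.conjTranspose_apply,
    PiLp.inner_apply, RCLike.inner_apply, Fintype.sum_prod_type]
  rw [Finset.sum_comm]
  simp only [mul_comm]
  rfl

theorem rin_self (X : Matrix m n ℂ) : rin X X = fro X ^ 2 := by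
  rw [rin_eq_inner, fro, inner_self_eq_norm_sq_to_K]
  norm_cast

theorem fro_nonneg (X : Matrix m n ℂ) : 0 ≤ fro X := norm_nonneg _

theorem fro_add_le (X Y : Matrix m n ℂ) : fro (X + Y) ≤ fro X + fro Y := by
  rw [fro, toVec_add]
  exact norm_add_le _ _

theorem rin_add_right (X Y Z : Matrix m n ℂ) : rin X (Y + Z) = rin X Y + rin X Z := by
  simp [rin, Matrix.mul_add]

theorem rin_sub_right (X Y Z : Matrix m n ℂ) : rin X (Y - Z) = rin X Y - rin X Z := by
  simp [rin, Matrix.mul_sub]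

theorem rin_comm (X Y : Matrix m n ℂ) : rin X Y = rin Y X := by
  rw [rin, rin, ← Complex.conj_re, ← Matrix.conjTranspose_conjTranspose (Xᴴ * Y),
    Matrix.trace_conjTranspose]
  simp

theorem rin_le (X Y : Matrix m n ℂ) : rin X Y ≤ fro X * fro Y := by
  rw [rin_eq_inner]
  exact (Complex.re_le_norm _).trans (norm_inner_le_norm _ _)

theorem fro_sub_sq (X Y : Matrix m n ℂ) :
    fro (X - Y) ^ 2 = fro X ^ 2 + fro Y ^ 2 - 2 * rin X Y := by
  have h : rin (X - Y) (X - Y) = rin X X + rin Y Y - 2 * rin X Y := by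
    rw [rin_sub_right, rin_comm _ X, rin_comm _ Y, rin_sub_right, rin_sub_right, rin_comm Y X]
    ring
  simpa only [rin_self] using h

theorem fro_sub_comm (X Y : Matrix m n ℂ) : fro (X - Y) = fro (Y - X) := by
  rw [fro, fro, toVec_sub, toVec_sub, norm_sub_rev]

theorem fro_sq (X : Matrix m n ℂ) : fro X ^ 2 = (X * Xᴴ).trace.re := by
  rw [← rin_self, rin, Matrix.trace_mul_comm]

theorem fro_mul_left [DecidableEq m] (U : Matrix k m ℂ) (hU : Uᴴ * U = 1) (X : Matrix m n ℂ) :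
    fro (U * X) = fro X := by
  rw [← sq_eq_sq₀ (fro_nonneg _) (fro_nonneg _), ← rin_self, ← rin_self, rin, rin,
    Matrix.conjTranspose_mul, Matrix.mul_assoc, ← Matrix.mul_assoc _ U, hU, Matrix.one_mul]

theorem fro_mul_right [DecidableEq n] (W : Matrix n k ℂ) (hW : W * Wᴴ = 1) (X : Matrix m n ℂ) :
    fro (X * W) = fro X := by
  rw [← sq_eq_sq₀ (fro_nonneg _) (fro_nonneg _), fro_sq, fro_sq, Matrix.conjTranspose_mul,
    Matrix.mul_assoc, ← Matrix.mul_assoc W, hW, Matrix.one_mul]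

end HilbertSchmidt

/-! ### Unitary freedom -/

section Unitary

variable {m n : Type} [Fintype m] [Fintype n] [DecidableEq m] [DecidableEq n]

/-- Equal norms force `ker f ≤ ker g`, so `f x ↦ g x` is a well-defined isometry on the range of
`f`. It extends to all of `V` because domain and codomain have the same finite dimension. -/
theorem exists_linearIsometry {V W : Type*} [NormedAddCommGroup V] [InnerProductSpace ℂ V]
    [FiniteDimensional ℂ V] [AddCommGroup W] [Module ℂ W] (f g : W →ₗ[ℂ] V)
    (h : ∀ x, ‖f x‖ = ‖g x‖) : ∃ L : V →ₗᵢ[ℂ] V, ∀ x, L (f x) = g x := by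
  have hker : LinearMap.ker f ≤ LinearMap.ker g := fun x hx => by
    have := h x
    rw [LinearMap.mem_ker.1 hx, norm_zero] at this
    exact LinearMap.mem_ker.2 (norm_eq_zero.1 this.symm)
  let φ : LinearMap.range f →ₗ[ℂ] V :=
    ((LinearMap.ker f).liftQ g hker).comp f.quotKerEquivRange.symm.toLinearMap
  have hφ : ∀ x, φ ⟨f x, LinearMap.mem_range_self f x⟩ = g x := by
    intro x
    have hx : f.quotKerEquivRange.symm ⟨f x, LinearMap.mem_range_self f x⟩
        = (LinearMap.ker f).mkQ x := by
      rw [LinearEquiv.symm_apply_eq]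
      rfl
    simp only [φ, LinearMap.comp_apply, LinearEquiv.coe_coe, hx]
    simp
  let ψ : LinearMap.range f →ₗᵢ[ℂ] V := ⟨φ, by
    rintro ⟨_, x, rfl⟩
    rw [hφ]
    exact (h x).symm⟩
  exact ⟨ψ.extend, fun x =>
    (ψ.extend_apply ⟨f x, LinearMap.mem_range_self f x⟩).trans (hφ x)⟩

theorem norm_toEuclideanLin_sq (A : Matrix m n ℂ) (x : EuclideanSpace ℂ n) :
    ((‖Matrix.toEuclideanLin A x‖ ^ 2 : ℝ) : ℂ)
      = star (WithLp.ofLp x) ⬝ᵥ ((Aᴴ * A) *ᵥ WithLp.ofLp x) := by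
  have := inner_self_eq_norm_sq_to_K (𝕜 := ℂ) (Matrix.toEuclideanLin A x)
  rw [EuclideanSpace.inner_eq_star_dotProduct] at this
  push_cast
  rw [dotProduct_comm] at this
  refine (this.symm.trans ?_)
  simp only [Matrix.toLpLin_apply]
  rw [← Matrix.mulVec_mulVec, Matrix.dotProduct_mulVec _ Aᴴ, Matrix.star_mulVec]

/-- Two factorizations of the same matrix differ by a unitary. -/
theorem exists_unitary_mul_eq {A B : Matrix m n ℂ} (h : Aᴴ * A = Bᴴ * B) :
    ∃ U ∈ Matrix.unitaryGroup m ℂ, U * A = B := by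
  obtain ⟨L, hL⟩ := exists_linearIsometry (Matrix.toEuclideanLin A) (Matrix.toEuclideanLin B)
    fun x => by
      rw [← sq_eq_sq₀ (norm_nonneg _) (norm_nonneg _)]
      have h1 := norm_toEuclideanLin_sq A x
      rw [h, ← norm_toEuclideanLin_sq B x] at h1
      exact_mod_cast h1
  obtain ⟨U, hU⟩ := (Matrix.toEuclideanLin (𝕜 := ℂ) (m := m) (n := m)).surjective L.toLinearMap
  refine ⟨U, ?_, ?_⟩
  · rw [Matrix.mem_unitaryGroup_iff', Matrix.star_eq_conjTranspose]
    apply (Matrix.toEuclideanLin (𝕜 := ℂ) (m := m) (n := m)).injective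
    refine LinearMap.ext fun x => ext_inner_left ℂ fun y => ?_
    have h1 : Matrix.toEuclideanLin (Uᴴ * U) x
        = Matrix.toEuclideanLin Uᴴ (Matrix.toEuclideanLin U x) := by
      simp
    have h2 : Matrix.toEuclideanLin (1 : Matrix m m ℂ) x = x := by
      simp
    rw [h1, h2, Matrix.toEuclideanLin_conjTranspose_eq_adjoint, LinearMap.adjoint_inner_right, hU]
    exact L.inner_map_map y x
  · apply (Matrix.toEuclideanLin (𝕜 := ℂ) (m := m) (n := n)).injective
    refine LinearMap.ext fun x => ?_
    rw [← hL, ← L.coe_toLinearMap, ← hU]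
    simp

/-- Polar decomposition of wide matrices with respect to a given factor. -/
theorem exists_coisometry {X : Matrix m n ℂ} {S : Matrix m m ℂ}
    (hcard : Fintype.card m ≤ Fintype.card n) (h : X * Xᴴ = S * Sᴴ) :
    ∃ W : Matrix m n ℂ, W * Wᴴ = 1 ∧ X = S * W := by
  obtain ⟨f⟩ := Function.Embedding.nonempty_of_card_le hcard
  -- The isometry `J` pads `Sᴴ` to the shape of `Xᴴ`. Both then have the same Gram matrix, and the
  -- unitary relating them restricts to the coisometry.
  let J : Matrix n m ℂ := fun i x => if i = f x then 1 else 0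
  have hJ : Jᴴ * J = 1 := by
    ext x y
    simp only [Matrix.mul_apply, Matrix.conjTranspose_apply]
    simp [J, Matrix.one_apply, eq_comm]
  obtain ⟨U, hU, hUX⟩ := exists_unitary_mul_eq (A := J * Sᴴ) (B := Xᴴ) (by
    rw [Matrix.conjTranspose_mul, Matrix.mul_assoc, ← Matrix.mul_assoc Jᴴ, hJ]
    simp [h])
  refine ⟨Jᴴ * Uᴴ, ?_, ?_⟩
  · rw [Matrix.conjTranspose_mul, Matrix.mul_assoc, ← Matrix.mul_assoc Uᴴ]
    have : Uᴴ * U = 1 := Matrix.mem_unitaryGroup_iff'.1 hU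
    simp [this, hJ]
  · have := congrArg Matrix.conjTranspose hUX
    simpa [Matrix.mul_assoc] using this.symm

end Unitary

/-! ### Positive semidefinite matrices -/

section PosSemidef

variable {n : Type} [Fintype n] [DecidableEq n]

open scoped MatrixOrder in
theorem exists_posSemidef_sqrt {A : Matrix n n ℂ} (hA : A.PosSemidef) :
    ∃ S : Matrix n n ℂ, S.PosSemidef ∧ S * S = A :=
  ⟨CFC.sqrt A, Matrix.nonneg_iff_posSemidef.1 (CFC.sqrt_nonneg A),
    CFC.sqrt_mul_sqrt_self A hA.nonneg⟩

/-- The eigenvalues are also recorded as roots of the characteristic polynomial, since that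
polynomial is common to `t * s` and its Hermitian counterpart in `transport`. -/
theorem exists_diagonalization {A : Matrix n n ℂ} (hA : A.IsHermitian) :
    ∃ (U : Matrix n n ℂ) (d : n → ℝ), Uᴴ * U = 1 ∧ U * Uᴴ = 1 ∧
      A = U * Matrix.diagonal (fun i => (d i : ℂ)) * Uᴴ ∧ (∀ i, A.charpoly.IsRoot (d i)) ∧
      (A.PosSemidef → ∀ i, 0 ≤ d i) := by
  refine ⟨hA.eigenvectorUnitary, hA.eigenvalues,
    Matrix.mem_unitaryGroup_iff'.1 hA.eigenvectorUnitary.2,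
    Matrix.mem_unitaryGroup_iff.1 hA.eigenvectorUnitary.2, ?_, fun i => ?_,
    fun h i => h.eigenvalues_nonneg i⟩
  · conv_lhs => rw [hA.spectral_theorem]
    rw [Unitary.conjStarAlgAut_apply]
    rfl
  · rw [hA.charpoly_eq, Polynomial.IsRoot, Polynomial.eval_prod]
    exact Finset.prod_eq_zero (Finset.mem_univ i) (by simp)

theorem posSemidef_conj_diagonal (U : Matrix n n ℂ) {d : n → ℝ} (hd : ∀ i, 0 ≤ d i) :
    (U * Matrix.diagonal (fun i => (d i : ℂ)) * Uᴴ).PosSemidef :=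
  (Matrix.PosSemidef.diagonal fun i => Complex.zero_le_real.2 (hd i)).mul_mul_conjTranspose_same U

theorem diag_re_nonneg {A : Matrix n n ℂ} (hA : A.PosSemidef) (i : n) : 0 ≤ (A i i).re :=
  (Complex.le_def.1 hA.diag_nonneg).1

/-- The Powers–Størmer inequality. -/
theorem exists_measurement_fro_sub_sq_le {A B : Matrix n n ℂ} (hA : A.PosSemidef)
    (hB : B.PosSemidef) (hAt : (A * A).trace = 1) (hBt : (B * B).trace = 1) :
    ∃ Q : Matrix n n ℂ, IsMeasurement Q ∧ fro (A - B) ^ 2 ≤ 2 * inn (B * B - A * A) Q := by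
  -- The eigenbasis of `B - A`, not of `B² - A²`, is used. In it the diagonal entries of `B² - A²`
  -- are `d i (A_ii + B_ii)`.
  obtain ⟨U, d, hU, hU', hD, -, -⟩ := exists_diagonalization (hB.1.sub hA.1)
  set A' := Uᴴ * A * U with hA'
  set B' := Uᴴ * B * U with hB'
  have hA'p : A'.PosSemidef := hA.conjTranspose_mul_mul_same U
  have hB'p : B'.PosSemidef := hB.conjTranspose_mul_mul_same U
  have hdiff : B' - A' = Matrix.diagonal fun i => (d i : ℂ) := by
    rw [hA', hB', ← Matrix.sub_mul, ← Matrix.mul_sub, hD]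
    rw [show Uᴴ * (U * (Matrix.diagonal fun i => (d i : ℂ)) * Uᴴ) * U
      = (Uᴴ * U) * (Matrix.diagonal fun i => (d i : ℂ)) * (Uᴴ * U) by simp only [Matrix.mul_assoc],
      hU, Matrix.one_mul, Matrix.mul_one]
  have hB'eq : B' = A' + Matrix.diagonal fun i => (d i : ℂ) := by rw [← hdiff]; abel
  have hsq : Uᴴ * (B * B - A * A) * U = B' * B' - A' * A' := by
    rw [hA', hB', show Uᴴ * B * U * (Uᴴ * B * U) = Uᴴ * B * (U * Uᴴ) * B * U by
      simp only [Matrix.mul_assoc], show Uᴴ * A * U * (Uᴴ * A * U) = Uᴴ * A * (U * Uᴴ) * A * U by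
      simp only [Matrix.mul_assoc], hU']
    simp only [Matrix.mul_sub, Matrix.sub_mul, Matrix.mul_assoc, Matrix.one_mul]
  have hdiag : ∀ i, ((B' * B' - A' * A') i i).re = d i * ((A' i i).re + (B' i i).re) := by
    intro i
    rw [hB'eq]
    simp only [Matrix.add_mul, Matrix.mul_add, Matrix.sub_apply, Matrix.add_apply,
      Matrix.mul_diagonal, Matrix.diagonal_mul, Matrix.diagonal_apply_eq,
      Matrix.diagonal_mul_diagonal]
    simp
    ring
  have hBA : ∀ i, (B' i i).re = (A' i i).re + d i := fun i => by
    rw [hB'eq]; simp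
  have htr0 : ∑ i, d i * ((A' i i).re + (B' i i).re) = 0 := by
    have : (Uᴴ * (B * B - A * A) * U).trace.re = 0 := by
      rw [Matrix.mul_assoc, Matrix.trace_mul_comm, Matrix.mul_assoc, hU', Matrix.mul_one,
        Matrix.trace_sub, hAt, hBt]
      simp
    rw [hsq] at this
    simpa only [Matrix.trace, Matrix.diag, Complex.re_sum, hdiag] using this
  -- `Q` is the projection onto the positive eigenspaces of `B - A`.
  let e : n → ℝ := fun i => if 0 < d i then 1 else 0
  let Q := U * Matrix.diagonal (fun i => (e i : ℂ)) * Uᴴ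
  have hfro : fro (A - B) ^ 2 = ∑ i, d i ^ 2 := by
    have hh : (B - A)ᴴ = B - A := (hB.1.sub hA.1)
    rw [fro_sub_comm, ← rin_self, rin, hh, hD,
      show U * (Matrix.diagonal fun i => (d i : ℂ)) * Uᴴ
        * (U * (Matrix.diagonal fun i => (d i : ℂ)) * Uᴴ)
      = U * (Matrix.diagonal fun i => (d i : ℂ)) * (Uᴴ * U)
        * ((Matrix.diagonal fun i => (d i : ℂ)) * Uᴴ) by simp only [Matrix.mul_assoc],
      hU, Matrix.mul_one, Matrix.trace_mul_comm]
    rw [Matrix.mul_assoc, ← Matrix.mul_assoc Uᴴ, hU, Matrix.one_mul,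
      Matrix.diagonal_mul_diagonal, Matrix.trace_diagonal, Complex.re_sum]
    exact Finset.sum_congr rfl fun i _ => by simp [sq]
  have hinn : inn (B * B - A * A) Q = ∑ i, e i * (d i * ((A' i i).re + (B' i i).re)) := by
    have hh : (B * B - A * A)ᴴ = B * B - A * A := by
      have h1 : Bᴴ = B := hB.1
      have h2 : Aᴴ = A := hA.1
      rw [Matrix.conjTranspose_sub, Matrix.conjTranspose_mul, Matrix.conjTranspose_mul, h1, h2]
    rw [inn, hh]
    simp only [Q]
    rw [← Matrix.mul_assoc, Matrix.trace_mul_comm, ← Matrix.mul_assoc, ← Matrix.mul_assoc, hsq,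
      Matrix.trace, Complex.re_sum]
    refine Finset.sum_congr rfl fun i _ => ?_
    rw [Matrix.diag_apply, Matrix.mul_diagonal, ← hdiag, Complex.re_mul_ofReal, mul_comm]
  refine ⟨Q, ⟨posSemidef_conj_diagonal U fun i => ?_, ?_⟩, ?_⟩
  · simp only [e]; split <;> norm_num
  · have : 1 - Q = U * Matrix.diagonal (fun i => ((1 - e i : ℝ) : ℂ)) * Uᴴ := by
      simp only [Complex.ofReal_sub, Complex.ofReal_one, ← Matrix.diagonal_sub, Matrix.mul_sub,
        Matrix.sub_mul, Q]
      rw [show (Matrix.diagonal fun _ : n => (1 : ℂ)) = 1 from rfl, Matrix.mul_one, hU']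
    rw [this]
    exact posSemidef_conj_diagonal U fun i => by simp only [e]; split <;> norm_num
  · rw [hfro, hinn]
    -- Since `d i = B_ii - A_ii` with nonnegative diagonals, `d i ^ 2 ≤ |d i| (A_ii + B_ii)`.
    -- Writing `|d i| = 2 e i d i - d i` leaves a last term that sums to zero because the traces
    -- agree.
    have key : ∀ i, d i ^ 2 ≤ 2 * (e i * (d i * ((A' i i).re + (B' i i).re)))
        - d i * ((A' i i).re + (B' i i).re) := by
      intro i
      have h1 := diag_re_nonneg hA'p i
      have h2 := diag_re_nonneg hB'p i
      have h3 := hBA i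
      simp only [e]
      split
      · nlinarith
      · nlinarith
    calc ∑ i, d i ^ 2 ≤ ∑ i, (2 * (e i * (d i * ((A' i i).re + (B' i i).re)))
        - d i * ((A' i i).re + (B' i i).re)) := Finset.sum_le_sum fun i _ => key i
      _ = _ := by rw [Finset.sum_sub_distrib, htr0, sub_zero, Finset.mul_sum]

end PosSemidef

/-! ### The transport operator -/

section Transport

variable {n : Type} [Fintype n] [DecidableEq n]

/-- This carries a polynomial of the non-Hermitian `t * s` over to the positive semidefinite `S * s
* S`, where `S` is the root of `t`; the intertwiner is `S`. -/
theorem aeval_mul_eq_mul_aeval {A B S : Matrix n n ℂ} (h : A * S = S * B)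
    (q : Polynomial ℂ) : Polynomial.aeval A q * S = S * Polynomial.aeval B q := by
  induction q using Polynomial.induction_on' with
  | add p q hp hq => rw [map_add, map_add, Matrix.add_mul, hp, hq, Matrix.mul_add]
  | monomial k a =>
    rw [Polynomial.aeval_monomial, Polynomial.aeval_monomial]
    have : A ^ k * S = S * B ^ k := by
      induction k with
      | zero => simp
      | succ k ih =>
        rw [pow_succ, Matrix.mul_assoc, h, ← Matrix.mul_assoc, ih, Matrix.mul_assoc, ← pow_succ]
    rw [Matrix.mul_assoc, this, ← Matrix.mul_assoc, Algebra.commutes, Matrix.mul_assoc]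

theorem aeval_diagonal (d : n → ℂ) (q : Polynomial ℂ) :
    Polynomial.aeval (Matrix.diagonal d) q = Matrix.diagonal fun i => q.eval (d i) := by
  have h := Polynomial.aeval_algHom_apply (Matrix.diagonalAlgHom ℂ) d q
  rw [Matrix.diagonalAlgHom_apply] at h
  rw [h, Matrix.diagonalAlgHom_apply]
  congr 1
  funext i
  have h2 := Polynomial.aeval_algHom_apply (Pi.evalAlgHom ℂ (fun _ : n => ℂ) i) d q
  simp [Polynomial.aeval_def, Polynomial.eval₂_eq_eval_map]

/-- `q` is the function `x ↦ x ^ (-1/2)` (and `0` at `0`) on the nonnegative eigenvalues of `N`. -/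
def InvSqrtOn (q : Polynomial ℂ) (N : Matrix n n ℂ) : Prop :=
  ∀ μ : ℝ, 0 ≤ μ → N.charpoly.IsRoot (μ : ℂ) → q.eval (μ : ℂ) = (((√μ)⁻¹ : ℝ) : ℂ)

/-- The operator `T = s q(t s)` moves `t` below `s`, and attains the fidelity of `s` and `t`. -/
theorem transport {s t : Matrix n n ℂ} (hs : s.PosSemidef) (ht : t.PosSemidef)
    {q : Polynomial ℂ} (hq : InvSqrtOn q (t * s)) {T : Matrix n n ℂ}
    (hT : T = s * Polynomial.aeval (t * s) q) :
    (s - T * t * Tᴴ).PosSemidef ∧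
    ∀ (k : Type) [Fintype k] [DecidableEq k] (Z Y : Matrix n k ℂ),
      Fintype.card n ≤ Fintype.card k → Z * Zᴴ = t → Y * Yᴴ = s → rin Z Y ≤ (T * t).trace.re := by
  obtain ⟨S, hS, hSS⟩ := exists_posSemidef_sqrt ht
  obtain ⟨R, hR, hRR⟩ := exists_posSemidef_sqrt hs
  have hSh : Sᴴ = S := hS.1
  have hRh : Rᴴ = R := hR.1
  have hH : (S * s * S).PosSemidef := by
    simpa only [hSh] using hs.mul_mul_conjTranspose_same S
  -- With `S = √t` and `R = √s`, the matrix `H = S s S = (R S)ᴴ (R S)` has the characteristic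
  -- polynomial of `t s`, so `q` acts on it as the inverse square root.
  obtain ⟨U, d, hU, hU', hHd, hroot, hd⟩ := exists_diagonalization hH.1
  replace hd := hd hH
  have hchar : (S * s * S).charpoly = (t * s).charpoly := by
    rw [Matrix.charpoly_mul_comm, ← Matrix.mul_assoc, hSS]
  let fn : (n → ℝ) → Matrix n n ℂ := fun φ => U * Matrix.diagonal (fun i => (φ i : ℂ)) * Uᴴ
  have fn_mul : ∀ φ ψ, fn φ * fn ψ = fn fun i => φ i * ψ i := by
    intro φ ψ
    simp only [fn]
    rw [show U * (Matrix.diagonal fun i => (φ i : ℂ)) * Uᴴ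
        * (U * (Matrix.diagonal fun i => (ψ i : ℂ)) * Uᴴ)
      = U * ((Matrix.diagonal fun i => (φ i : ℂ)) * (Uᴴ * U)
        * (Matrix.diagonal fun i => (ψ i : ℂ))) * Uᴴ by simp only [Matrix.mul_assoc],
      hU, Matrix.mul_one, Matrix.diagonal_mul_diagonal]
    simp
  have fn_herm : ∀ φ, (fn φ)ᴴ = fn φ := by
    intro φ
    simp only [fn, Matrix.conjTranspose_mul, Matrix.conjTranspose_conjTranspose,
      Matrix.diagonal_conjTranspose, Matrix.mul_assoc]
    congr 3
    funext i
    simp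
  have hHfn : S * s * S = fn d := hHd
  set G := Polynomial.aeval (S * s * S) q with hG
  have hGfn : G = fn fun i => (√(d i))⁻¹ := by
    have h1 : (S * s * S) * U = U * Matrix.diagonal fun i => (d i : ℂ) := by
      rw [hHfn]
      simp only [fn]
      rw [Matrix.mul_assoc, hU, Matrix.mul_one]
    have h2 := aeval_mul_eq_mul_aeval h1 q
    rw [aeval_diagonal, ← hG] at h2
    have h3 : G = G * U * Uᴴ := by rw [Matrix.mul_assoc, hU', Matrix.mul_one]
    rw [h3, h2]
    simp only [fn]
    congr 3
    funext i
    exact hq (d i) (hd i) (hchar ▸ hroot i)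
  have hTS : T * S = s * S * G := by
    have h1 : (t * s) * S = S * (S * s * S) := by rw [← hSS]; simp only [Matrix.mul_assoc]
    rw [hT, Matrix.mul_assoc, aeval_mul_eq_mul_aeval h1, ← Matrix.mul_assoc]
  have hsqrt : ∀ i, d i * (√(d i))⁻¹ = √(d i) := fun i => by
    rw [← div_eq_mul_inv, Real.div_sqrt]
  have hGh : Gᴴ = G := by rw [hGfn, fn_herm]
  -- `M` is `H^{1/2} = |R S|`; its trace is the fidelity of `s` and `t`.
  set M := fn fun i => √(d i) with hM
  have hHG : S * s * S * G = M := by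
    rw [hHfn, hGfn, fn_mul]
    simp only [hsqrt, hM]
  have htrace : (T * t).trace = M.trace := by
    rw [← hSS, ← Matrix.mul_assoc, hTS, Matrix.trace_mul_comm, ← hHG]
    simp only [Matrix.mul_assoc]
  constructor
  -- `L = R S H^{-1/2}` is the partial isometry in the polar decomposition of `R S`. As `T S = R L`,
  -- it follows that `T t Tᴴ = R (L Lᴴ) R ≤ R R = s`.
  · set L := R * S * G with hL
    have hLL : Lᴴ * L = fn fun i => (√(d i))⁻¹ * √(d i) := by
      have : Lᴴ * L = G * (S * s * S * G) := by
        rw [hL, ← hRR]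
        simp only [Matrix.conjTranspose_mul, hGh, hSh, hRh, Matrix.mul_assoc]
      rw [this, hHG, hGfn, hM, fn_mul]
    have hLP : L * (Lᴴ * L) = L := by
      rw [hLL, hL, Matrix.mul_assoc, hGfn, fn_mul]
      congr 2
      funext i
      -- On the kernel of `H` the convention `0⁻¹ = 0` makes `G` vanish, which is why `L` is only a
      -- partial isometry.
      by_cases h : √(d i) = 0
      · simp [h]
      · field_simp
    have hK : (L * Lᴴ) * (L * Lᴴ) = L * Lᴴ := by
      rw [← Matrix.mul_assoc, Matrix.mul_assoc L, hLP]
    have hKh : (L * Lᴴ)ᴴ = L * Lᴴ := by simp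
    have h1K : (1 - L * Lᴴ).PosSemidef := by
      have : 1 - L * Lᴴ = (1 - L * Lᴴ)ᴴ * (1 - L * Lᴴ) := by
        rw [Matrix.conjTranspose_sub, hKh, Matrix.conjTranspose_one]
        simp only [Matrix.sub_mul, Matrix.mul_sub, hK, Matrix.one_mul, Matrix.mul_one]
        abel
      rw [this]
      exact Matrix.posSemidef_conjTranspose_mul_self _
    have hfinal : s - T * t * Tᴴ = R * (1 - L * Lᴴ) * Rᴴ := by
      have h1 : T * t * Tᴴ = (T * S) * (T * S)ᴴ := by
        rw [← hSS, Matrix.conjTranspose_mul, hSh]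
        simp only [Matrix.mul_assoc]
      have h2 : T * S = R * L := by
        rw [hTS, hL, ← hRR]
        simp only [Matrix.mul_assoc]
      rw [h1, h2, Matrix.conjTranspose_mul, hRh, Matrix.mul_sub, Matrix.sub_mul, Matrix.mul_one,
        hRR]
      simp only [Matrix.mul_assoc]
    rw [hfinal]
    exact h1K.mul_mul_conjTranspose_same R
  · intro k _ _ Z Y hcard hZ hY
    obtain ⟨W₁, hW₁, rfl⟩ := exists_coisometry (S := S) hcard (by rw [hZ, hSh, hSS])
    obtain ⟨W₂, hW₂, rfl⟩ := exists_coisometry (S := R) hcard (by rw [hY, hRh, hRR])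
    have hMM : M * Mᴴ = fn d := by
      rw [hM, fn_herm, fn_mul]
      congr 1
      funext i
      exact Real.mul_self_sqrt (hd i)
    -- Polar decomposition `S R = M V`. With `K = √M` the overlap of any two purifications becomes
    -- `⟨K W₁, K V W₂⟩`, and Cauchy–Schwarz bounds it by `‖K‖² = Tr M`.
    obtain ⟨V, hV, hSR⟩ := exists_coisometry (X := S * R) (S := M) le_rfl (by
      rw [hMM, ← hHfn, Matrix.conjTranspose_mul, hSh, hRh, ← hRR]
      simp only [Matrix.mul_assoc])
    set K := fn fun i => √(√(d i)) with hK
    have hKK : K * K = M := by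
      rw [hK, hM, fn_mul]
      congr 1
      funext i
      exact Real.mul_self_sqrt (Real.sqrt_nonneg _)
    have hKh : Kᴴ = K := fn_herm _
    have hrin : rin (S * W₁) (R * W₂) = rin (K * W₁) (K * (V * W₂)) := by
      simp only [rin, Matrix.conjTranspose_mul, hSh, hKh]
      congr 2
      calc W₁ᴴ * S * (R * W₂) = W₁ᴴ * (S * R) * W₂ := by simp only [Matrix.mul_assoc]
        _ = _ := by rw [hSR, ← hKK]; simp only [Matrix.mul_assoc]
    have hKfro : fro K ^ 2 = M.trace.re := by rw [fro_sq, hKh, hKK]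
    have hVW : (V * W₂) * (V * W₂)ᴴ = 1 := by
      rw [Matrix.conjTranspose_mul, Matrix.mul_assoc, ← Matrix.mul_assoc W₂, hW₂, Matrix.one_mul,
        hV]
    rw [hrin, htrace, ← hKfro, sq]
    refine (rin_le _ _).trans (le_of_eq ?_)
    rw [fro_mul_right _ hW₁, fro_mul_right _ hVW]

end Transport

/-! ### Purifications and partial traces -/

section Reshape

variable {c v : ℕ} {P : Type} [Fintype P]

/-- A purification, viewed as an operator into the register `V`. -/
def reshape (X : Matrix (CV c v) P ℂ) : Matrix (Fin v) (Fin c × P) ℂ :=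
  fun i p => X (p.1, i) p.2

theorem reshape_mul_conjTranspose (X Y : Matrix (CV c v) P ℂ) :
    reshape X * (reshape Y)ᴴ = trC (X * Yᴴ) := by
  ext i j
  simp only [reshape, trC, Matrix.mul_apply, Matrix.conjTranspose_apply, Fintype.sum_prod_type]

theorem reshape_sub (X Y : Matrix (CV c v) P ℂ) : reshape (X - Y) = reshape X - reshape Y := rfl

theorem trace_trC (M : Op c v) : (trC M).trace = M.trace := by
  simp only [trC, Matrix.trace, Matrix.diag, Fintype.sum_prod_type]
  exact Finset.sum_comm

theorem rin_reshape (X Y : Matrix (CV c v) P ℂ) : rin (reshape X) (reshape Y) = rin X Y := by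
  rw [rin, rin, Matrix.trace_mul_comm, Matrix.trace_mul_comm Xᴴ, reshape_mul_conjTranspose,
    trace_trC]

theorem fro_reshape (X : Matrix (CV c v) P ℂ) : fro (reshape X) = fro X := by
  rw [← sq_eq_sq₀ (fro_nonneg _) (fro_nonneg _), ← rin_self, ← rin_self, rin_reshape]

/-- An operator on `V`, tensored with the identity of `C`. -/
def onV (T : Matrix (Fin v) (Fin v) ℂ) : Op c v := (1 : Matrix (Fin c) (Fin c) ℂ) ⊗ₖ T

theorem reshape_onV_mul (T : Matrix (Fin v) (Fin v) ℂ) (X : Matrix (CV c v) P ℂ) :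
    reshape (onV T * X) = T * reshape X := by
  ext i p
  change ((onV T : Op c v) * X : Matrix (CV c v) P ℂ) (p.1, i) p.2 = _
  rw [Matrix.mul_apply, Matrix.mul_apply, Fintype.sum_prod_type]
  simp [onV, reshape, Matrix.one_apply]

theorem reshape_onV_mul_op (T : Matrix (Fin v) (Fin v) ℂ) (X : Op c v) :
    reshape (onV T * X) = T * reshape X :=
  reshape_onV_mul T X

/-- An operator on `V`, tensored with the projection `|0⟩⟨0|` on `C`. -/
def corner (M : Matrix (Fin v) (Fin v) ℂ) : Op c v :=
  (Matrix.diagonal fun k : Fin c => if (k : ℕ) = 0 then (1 : ℂ) else 0) ⊗ₖ M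

theorem posSemidef_corner {M : Matrix (Fin v) (Fin v) ℂ} (hM : M.PosSemidef) :
    (corner M : Op c v).PosSemidef := by
  refine Matrix.PosSemidef.kronecker (Matrix.PosSemidef.diagonal fun k => ?_) hM
  dsimp only [Pi.zero_apply]
  split <;> simp

theorem trC_corner (hc : 0 < c) (M : Matrix (Fin v) (Fin v) ℂ) :
    trC (corner M : Op c v) = M := by
  ext i j
  simp only [trC, corner, Matrix.kronecker_apply, Matrix.diagonal_apply_eq, ite_mul, one_mul,
    zero_mul]
  rw [Finset.sum_eq_single (⟨0, hc⟩ : Fin c)]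
  · simp
  · intro k _ hk
    have : (k : ℕ) ≠ 0 := fun h => hk (Fin.ext h)
    simp [this]
  · simp

theorem trC_add (M N : Op c v) : trC (M + N) = trC M + trC N := by
  ext i j
  simp [trC, Finset.sum_add_distrib]

/-- For a factorization `ρ = S Sᴴ` the marginal is `reshape S * (reshape S)ᴴ`, and `1 ⊗ T`
multiplies `reshape S` by `T` from the left. -/
theorem trC_conj_onV {ρ : Op c v} (hρ : ρ.PosSemidef) (T : Matrix (Fin v) (Fin v) ℂ) :
    trC (onV T * ρ * (onV T)ᴴ) = T * trC ρ * Tᴴ := by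
  obtain ⟨S, hS, rfl⟩ := exists_posSemidef_sqrt hρ
  have hSh : Sᴴ = S := hS.1
  have h1 : onV T * (S * S) * (onV T)ᴴ = (onV T * S) * (onV T * S)ᴴ := by
    rw [Matrix.conjTranspose_mul, hSh]
    simp only [Matrix.mul_assoc]
  have h2 : trC (S * S) = reshape S * (reshape S)ᴴ := by
    rw [reshape_mul_conjTranspose, hSh]
  rw [h1, h2, ← reshape_mul_conjTranspose, reshape_onV_mul_op, Matrix.conjTranspose_mul]
  simp only [Matrix.mul_assoc]

theorem posSemidef_trC {ρ : Op c v} (hρ : ρ.PosSemidef) : (trC ρ).PosSemidef := by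
  obtain ⟨S, hS, rfl⟩ := exists_posSemidef_sqrt hρ
  have hSh : Sᴴ = S := hS.1
  have h2 : trC (S * S) = reshape S * (reshape S)ᴴ := by
    rw [reshape_mul_conjTranspose, hSh]
  rw [h2]
  exact Matrix.posSemidef_self_mul_conjTranspose _

theorem IsDensity.trC {ρ : Op c v} (hρ : IsDensity ρ) : IsDensity (trC ρ) :=
  ⟨posSemidef_trC hρ.1, by rw [trace_trC, hρ.2]⟩

theorem IsDensity.conj {ρ : Op c v} (hρ : IsDensity ρ) {V : Op c v}
    (hV : V ∈ Matrix.unitaryGroup (CV c v) ℂ) : IsDensity (V * ρ * Vᴴ) := by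
  refine ⟨hρ.1.mul_mul_conjTranspose_same V, ?_⟩
  have h : Vᴴ * V = 1 := Matrix.mem_unitaryGroup_iff'.1 hV
  rw [Matrix.trace_mul_comm, ← Matrix.mul_assoc, h, Matrix.one_mul, hρ.2]

end Reshape

/-! ### One step of the rounding procedure -/

section RoundStep

variable {c v : ℕ}

/-- The state `(1 ⊗ T) ρ (1 ⊗ T)*`, corrected so that its marginal becomes `s`. -/
def roundStep (s T : Matrix (Fin v) (Fin v) ℂ) (ρ : Op c v) : Op c v :=
  onV T * ρ * (onV T)ᴴ + corner (s - T * trC ρ * Tᴴ)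

theorem trC_roundStep (hc : 0 < c) (s T : Matrix (Fin v) (Fin v) ℂ) {ρ : Op c v}
    (hρ : ρ.PosSemidef) : trC (roundStep s T ρ) = s := by
  rw [roundStep, trC_add, trC_conj_onV hρ, trC_corner hc]
  abel

theorem isDensity_roundStep (hc : 0 < c) {s T : Matrix (Fin v) (Fin v) ℂ} {ρ : Op c v}
    (hρ : ρ.PosSemidef) (hs : s.trace = 1) (hT : (s - T * trC ρ * Tᴴ).PosSemidef) :
    IsDensity (roundStep s T ρ) :=
  ⟨(hρ.mul_mul_conjTranspose_same _).add (posSemidef_corner hT), by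
    rw [← trace_trC, trC_roundStep hc s T hρ, hs]⟩

/-- `ρ` and `ρ'` have purifications at distance at most `e`. -/
def Near (e : ℝ) (ρ ρ' : Op c v) : Prop :=
  ∃ (P : Type) (_ : Fintype P) (_ : DecidableEq P) (X Y : Matrix (CV c v) P ℂ),
    -- The size condition leaves room for the coisometries of `exists_coisometry`.
    v ≤ Fintype.card P ∧ X * Xᴴ = ρ ∧ Y * Yᴴ = ρ' ∧ fro (X - Y) ≤ e

theorem near_self (hc : 0 < c) {ρ : Op c v} (hρ : ρ.PosSemidef) : Near 0 ρ ρ := by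
  obtain ⟨S, hS, hSS⟩ := exists_posSemidef_sqrt hρ
  have hSh : Sᴴ = S := hS.1
  refine ⟨CV c v, inferInstance, inferInstance, S, S, ?_, by rw [hSh, hSS], by rw [hSh, hSS], ?_⟩
  · simpa using Nat.le_mul_of_pos_left v hc
  · rw [fro, toVec_sub, sub_self, norm_zero]

theorem fro_sq_of_mul_conjTranspose {n k : Type} [Fintype n] [Fintype k] {X : Matrix n k ℂ}
    {ρ : Matrix n n ℂ} (hρ : IsDensity ρ) (hX : X * Xᴴ = ρ) : fro X ^ 2 = 1 := by
  rw [fro_sq, hX, hρ.2, Complex.one_re]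

/-- The triangle inequality for the distance between purifications. The marginals `σ` and `s`
inherit the distance `e`, while `τ` and `σ` are at distance at most `fro (A - B)` because `A` and
`B` are their square roots. By `transport` the rounded state realizes the best overlap of `τ` and
`s`. -/
theorem near_roundStep (hc : 0 < c) {e : ℝ} {ρ ρ' ρ₁ V : Op c v} (h : Near e ρ ρ')
    (hρ : IsDensity ρ) (hρ' : IsDensity ρ') (hρ₁ : IsDensity ρ₁)
    (hV : V ∈ Matrix.unitaryGroup (CV c v) ℂ) {s T : Matrix (Fin v) (Fin v) ℂ}
    (hs : s = trC (V * ρ' * Vᴴ)) {q : Polynomial ℂ} (hq : InvSqrtOn q (trC ρ₁ * s))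
    (hT : T = s * Polynomial.aeval (trC ρ₁ * s) q) {A B : Matrix (Fin v) (Fin v) ℂ}
    (hA : A.PosSemidef) (hB : B.PosSemidef) (hAA : A * A = trC (V * ρ * Vᴴ))
    (hBB : B * B = trC ρ₁) :
    IsDensity (roundStep s T ρ₁) ∧ Near (e + fro (A - B)) ρ₁ (roundStep s T ρ₁) := by
  have hsd : IsDensity s := hs ▸ (hρ'.conj hV).trC
  obtain ⟨hpos, hmax⟩ := transport hsd.1 hρ₁.trC.1 hq hT
  refine ⟨isDensity_roundStep hc hρ₁.1 hsd.2 hpos, ?_⟩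
  obtain ⟨P, _, _, X, Y, hcard, hX, hY, hXY⟩ := h
  have hVV : Vᴴ * V = 1 := Matrix.mem_unitaryGroup_iff'.1 hV
  set σ := trC (V * ρ * Vᴴ) with hσ
  set τ := trC ρ₁ with hτ
  have hσd : IsDensity σ := (hρ.conj hV).trC
  have hτd : IsDensity τ := hρ₁.trC
  have hX' : reshape (V * X) * (reshape (V * X))ᴴ = σ := by
    rw [reshape_mul_conjTranspose, hσ, ← hX, Matrix.conjTranspose_mul]
    simp only [Matrix.mul_assoc]
  have hY' : reshape (V * Y) * (reshape (V * Y))ᴴ = s := by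
    rw [reshape_mul_conjTranspose, hs, ← hY, Matrix.conjTranspose_mul]
    simp only [Matrix.mul_assoc]
  have hXY' : fro (reshape (V * X) - reshape (V * Y)) ≤ e := by
    rw [← reshape_sub, fro_reshape, ← Matrix.mul_sub, fro_mul_left V hVV]
    exact hXY
  have hcard' : Fintype.card (Fin v) ≤ Fintype.card (Fin c × P) := by
    simp only [Fintype.card_fin, Fintype.card_prod]
    exact hcard.trans (Nat.le_mul_of_pos_left _ hc)
  have hAh : Aᴴ = A := hA.1
  have hBh : Bᴴ = B := hB.1
  -- The given purification of `σ` is `A * W`. Replacing `A` by `B` yields a purification of `τ` at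
  -- distance `fro (A - B)`.
  obtain ⟨W, hW, hXW⟩ := exists_coisometry (S := A) hcard' (by rw [hX', hAh, hAA])
  set d := e + fro (A - B) with hd
  have hd0 : 0 ≤ d := add_nonneg ((fro_nonneg _).trans hXY) (fro_nonneg _)
  have hZ : (B * W) * (B * W)ᴴ = τ := by
    rw [Matrix.conjTranspose_mul, Matrix.mul_assoc, ← Matrix.mul_assoc W, hW, Matrix.one_mul, hBh,
      hBB]
  have hZY : fro (B * W - reshape (V * Y)) ≤ d := by
    have : B * W - reshape (V * Y) = (B - A) * W + (reshape (V * X) - reshape (V * Y)) := by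
      rw [hXW, Matrix.sub_mul]
      abel
    rw [this]
    refine (fro_add_le _ _).trans ?_
    rw [fro_mul_right W hW, fro_sub_comm, hd, add_comm]
    exact add_le_add_left hXY' _
  have hF := hmax _ _ _ hcard' hZ hY'
  have hF' : 2 - 2 * (T * τ).trace.re ≤ d ^ 2 := by
    have h1 : fro (B * W - reshape (V * Y)) ^ 2 ≤ d ^ 2 :=
      pow_le_pow_left₀ (fro_nonneg _) hZY 2
    rw [fro_sub_sq, fro_sq_of_mul_conjTranspose hτd hZ, fro_sq_of_mul_conjTranspose hsd hY'] at h1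
    linarith
  obtain ⟨S, hS, hSS⟩ := exists_posSemidef_sqrt hρ₁.1
  obtain ⟨R, hR, hRR⟩ := exists_posSemidef_sqrt (posSemidef_corner (c := c) hpos)
  have hSh : Sᴴ = S := hS.1
  have hRh : Rᴴ = R := hR.1
  -- The correction term is purified in a separate block of columns, where the purification of `ρ₁`
  -- is zero. The overlap is thus `Tr (T τ)`, unaffected by the correction.
  have hX₁ : Matrix.fromCols S (0 : Op c v) * (Matrix.fromCols S (0 : Op c v))ᴴ = ρ₁ := by
    rw [Matrix.conjTranspose_fromCols_eq_fromRows_conjTranspose, Matrix.fromCols_mul_fromRows,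
      hSh, hSS]
    simp
  have hY₁ : Matrix.fromCols (onV T * S) R * (Matrix.fromCols (onV T * S) R)ᴴ
      = roundStep s T ρ₁ := by
    rw [Matrix.conjTranspose_fromCols_eq_fromRows_conjTranspose, Matrix.fromCols_mul_fromRows,
      hRh, hRR, Matrix.conjTranspose_mul, hSh, roundStep, ← hSS]
    simp only [Matrix.mul_assoc]
    rw [hSS]
  have hrin : rin (Matrix.fromCols S (0 : Op c v)) (Matrix.fromCols (onV T * S) R)
      = (T * τ).trace.re := by
    rw [rin, Matrix.trace_mul_comm, Matrix.conjTranspose_fromCols_eq_fromRows_conjTranspose,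
      Matrix.fromCols_mul_fromRows]
    simp only [Matrix.conjTranspose_zero, Matrix.mul_zero, add_zero]
    rw [← trace_trC, ← reshape_mul_conjTranspose, reshape_onV_mul_op, Matrix.mul_assoc,
      reshape_mul_conjTranspose, hSh, hSS]
  refine ⟨CV c v ⊕ CV c v, inferInstance, inferInstance, Matrix.fromCols S (0 : Op c v),
    Matrix.fromCols (onV T * S) R, ?_, hX₁, hY₁, ?_⟩
  · simp only [Fintype.card_sum, Fintype.card_prod, Fintype.card_fin]
    exact (Nat.le_mul_of_pos_left v hc).trans (Nat.le_add_right _ _)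
  · refine le_of_sq_le_sq ?_ hd0
    rw [fro_sub_sq, fro_sq_of_mul_conjTranspose hρ₁ hX₁,
      fro_sq_of_mul_conjTranspose (isDensity_roundStep hc hρ₁.1 hsd.2 hpos) hY₁, hrin]
    linarith

theorem inn_eq_rin {n k : Type} [Fintype n] [Fintype k] {X : Matrix n k ℂ} {ρ : Matrix n n ℂ}
    (hX : X * Xᴴ = ρ) (M : Matrix n n ℂ) : inn ρ M = rin X (M * X) := by
  rw [inn, rin, ← hX, Matrix.conjTranspose_mul, Matrix.conjTranspose_conjTranspose,
    Matrix.mul_assoc, Matrix.trace_mul_comm, Matrix.mul_assoc]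

/-- `2 M - 1` is a contraction: `‖(2 M - 1) Z‖² = ‖Z‖² - 4 (⟨M Z, Z⟩ - ‖M Z‖²)`, and the bracket is
nonnegative because `M - M² = K (1 - M) K ≥ 0` for `K = √M`. -/
theorem fro_two_mul_sub_le {n k : Type} [Fintype n] [DecidableEq n] [Fintype k]
    {M : Matrix n n ℂ} (hM : IsMeasurement M) (Z : Matrix n k ℂ) :
    fro (M * Z + M * Z - Z) ≤ fro Z := by
  obtain ⟨K, hK, hKK⟩ := exists_posSemidef_sqrt hM.1
  have hKh : Kᴴ = K := hK.1
  have hMh : Mᴴ = M := hM.1.1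
  refine le_of_sq_le_sq ?_ (fro_nonneg _)
  have hp : 0 ≤ (((K * Z)ᴴ * (1 - M) * (K * Z)).trace).re :=
    (Complex.le_def.1 (hM.2.conjTranspose_mul_mul_same (K * Z)).trace_nonneg).1
  have h1 : (K * Z)ᴴ * (1 - M) * (K * Z) = (M * Z)ᴴ * Z - (M * Z)ᴴ * (M * Z) := by
    have h2 : K * (1 - M) * K = M - M * M := by
      rw [← hKK, Matrix.mul_sub, Matrix.sub_mul]
      simp only [Matrix.mul_one, Matrix.mul_assoc]
    rw [Matrix.conjTranspose_mul, hKh, show Zᴴ * K * (1 - M) * (K * Z)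
      = Zᴴ * (K * (1 - M) * K) * Z by simp only [Matrix.mul_assoc], h2, Matrix.conjTranspose_mul,
      hMh]
    simp only [Matrix.mul_sub, Matrix.sub_mul, Matrix.mul_assoc]
  rw [h1, Matrix.trace_sub, Complex.sub_re] at hp
  change 0 ≤ rin (M * Z) Z - rin (M * Z) (M * Z) at hp
  rw [fro_sub_sq, ← rin_self (M * Z + M * Z), rin_add_right, rin_comm (M * Z + M * Z) (M * Z),
    rin_add_right, rin_comm (M * Z + M * Z) Z, rin_add_right, rin_comm Z]
  linarith

/-- Twice the difference of the probabilities equals `Re ⟨Y - X, (2 M - 1)(X + Y)⟩`, as `X` and `Y`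
are unit vectors. Using `2 M - 1` in place of `M` gives the constant `1` instead of `2`, and the
final `ε/2` relies on this. -/
theorem Near.inn_le {e : ℝ} {ρ ρ' M : Op c v} (h : Near e ρ ρ') (hρ : IsDensity ρ)
    (hρ' : IsDensity ρ') (hM : IsMeasurement M) : inn ρ' M ≤ inn ρ M + e := by
  obtain ⟨P, _, _, X, Y, -, hX, hY, hXY⟩ := h
  have hMh : Mᴴ = M := hM.1.1
  have hX1 := fro_sq_of_mul_conjTranspose hρ hX
  have hY1 := fro_sq_of_mul_conjTranspose hρ' hY
  have hfX : fro X = 1 := by nlinarith [fro_nonneg X]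
  have hfY : fro Y = 1 := by nlinarith [fro_nonneg Y]
  rw [inn_eq_rin hX, inn_eq_rin hY]
  have hsymm : rin X (M * Y) = rin Y (M * X) := by
    rw [rin_comm X, rin, rin, Matrix.conjTranspose_mul, hMh, Matrix.mul_assoc]
  have h1 := rin_le (Y - X) (M * (X + Y) + M * (X + Y) - (X + Y))
  have h2 := fro_two_mul_sub_le hM (X + Y)
  have h3 : fro (X + Y) ≤ 2 := (fro_add_le X Y).trans (by rw [hfX, hfY]; norm_num)
  have h4 : fro (Y - X) ≤ e := by rwa [fro_sub_comm]
  have h5 : fro (Y - X) * fro (M * (X + Y) + M * (X + Y) - (X + Y)) ≤ e * 2 :=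
    mul_le_mul h4 (h2.trans h3) (fro_nonneg _) ((fro_nonneg _).trans h4)
  have h6 : rin (Y - X) (M * (X + Y) + M * (X + Y) - (X + Y))
      = 2 * rin Y (M * Y) - 2 * rin X (M * X) := by
    rw [Matrix.mul_add, rin_comm]
    simp only [rin_sub_right]
    rw [rin_comm _ Y, rin_comm _ X]
    simp only [rin_sub_right, rin_add_right]
    rw [rin_self, rin_self, hX1, hY1, hsymm, rin_comm X Y]
    ring
  linarith

end RoundStep

/-! ### States and measurements arising from strategies -/

section Vectors

variable {c v : ℕ} {P : Type} [Fintype P] [DecidableEq P]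

/-- A vector of `C ⊗ V ⊗ P` as a matrix. -/
def vecMat (f : CV c v × P → ℂ) : Matrix (CV c v) P ℂ := fun x q => f (x, q)

/-- The reduced state on `C ⊗ V` of a vector of `C ⊗ V ⊗ P`. -/
def stateOf (f : CV c v × P → ℂ) : Op c v := vecMat f * (vecMat f)ᴴ

theorem vecMat_onCV (M : Op c v) (f : CV c v × P → ℂ) :
    vecMat (onCV M *ᵥ f) = M * vecMat f := by
  ext x q
  change (onCV M *ᵥ f) (x, q) = _
  rw [Matrix.mul_apply, Matrix.mulVec, dotProduct, Fintype.sum_prod_type]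
  simp [onCV, vecMat, Matrix.one_apply]

/-- For a vector read as an operator into `V`, the player acts by right multiplication. This is why
no action of a player changes the marginal on `V`. -/
theorem reshape_vecMat_onCP (U : Matrix (Fin c × P) (Fin c × P) ℂ) (f : CV c v × P → ℂ) :
    reshape (vecMat (onCP U *ᵥ f)) = reshape (vecMat f) * Uᵀ := by
  ext i p
  change (onCP U *ᵥ f) ((p.1, i), p.2) = _
  rw [Matrix.mul_apply, Matrix.mulVec, dotProduct]
  simp only [Fintype.sum_prod_type, onCP, reshape, vecMat, Matrix.transpose_apply, ite_mul,
    zero_mul]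
  refine Finset.sum_congr rfl fun k _ => ?_
  rw [Finset.sum_comm]
  refine Finset.sum_congr rfl fun q _ => ?_
  simp [mul_comm]

theorem stateOf_onCV (M : Op c v) (f : CV c v × P → ℂ) :
    stateOf (onCV M *ᵥ f) = M * stateOf f * Mᴴ := by
  rw [stateOf, vecMat_onCV, Matrix.conjTranspose_mul, stateOf]
  simp only [Matrix.mul_assoc]

theorem trC_stateOf_onCP {U : Matrix (Fin c × P) (Fin c × P) ℂ}
    (hU : U ∈ Matrix.unitaryGroup (Fin c × P) ℂ) (f : CV c v × P → ℂ) :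
    trC (stateOf (onCP U *ᵥ f)) = trC (stateOf f) := by
  have h : Uᵀ * (Uᵀ)ᴴ = 1 := by
    have h1 : Uᴴ * U = 1 := Matrix.mem_unitaryGroup_iff'.1 hU
    have h2 := congrArg Matrix.transpose h1
    rwa [Matrix.transpose_mul, Matrix.transpose_one] at h2
  rw [stateOf, ← reshape_mul_conjTranspose, reshape_vecMat_onCP, Matrix.conjTranspose_mul,
    Matrix.mul_assoc, ← Matrix.mul_assoc Uᵀ, h, Matrix.one_mul, reshape_mul_conjTranspose, stateOf]

theorem onCP_mul (U V : Matrix (Fin c × P) (Fin c × P) ℂ) :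
    (onCP (U * V) : Matrix (CV c v × P) (CV c v × P) ℂ) = onCP U * onCP V := by
  ext x y
  rw [Matrix.mul_apply]
  simp only [onCP, Matrix.mul_apply, Fintype.sum_prod_type, ite_mul, zero_mul, mul_ite, mul_zero]
  split
  · rename_i h
    refine Finset.sum_congr rfl fun k _ => ?_
    rw [Finset.sum_comm]
    refine Finset.sum_congr rfl fun q _ => ?_
    simp [h]
  · rename_i h
    refine (Finset.sum_eq_zero fun k _ => Finset.sum_eq_zero fun i _ =>
      Finset.sum_eq_zero fun q _ => ?_).symm
    split
    · rename_i h1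
      rw [if_neg (h1 ▸ h)]
    · rfl

theorem onCP_one : (onCP 1 : Matrix (CV c v × P) (CV c v × P) ℂ) = 1 := by
  ext ⟨⟨k, i⟩, p⟩ ⟨⟨l, j⟩, q⟩
  simp only [onCP, Matrix.one_apply, Prod.mk.injEq]
  split_ifs <;> simp_all

theorem onCP_conjTranspose (U : Matrix (Fin c × P) (Fin c × P) ℂ) :
    (onCP U : Matrix (CV c v × P) (CV c v × P) ℂ)ᴴ = onCP Uᴴ := by
  ext x y
  simp only [Matrix.conjTranspose_apply, onCP, eq_comm (a := y.1.2)]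
  split <;> simp

theorem onCP_unitary {U : Matrix (Fin c × P) (Fin c × P) ℂ}
    (hU : U ∈ Matrix.unitaryGroup (Fin c × P) ℂ) :
    (onCP U : Matrix (CV c v × P) (CV c v × P) ℂ)ᴴ * onCP U = 1 := by
  have h1 : Uᴴ * U = 1 := Matrix.mem_unitaryGroup_iff'.1 hU
  rw [onCP_conjTranspose, ← onCP_mul, h1, onCP_one]

theorem onCV_mul (M N : Op c v) :
    (onCV (M * N) : Matrix (CV c v × P) (CV c v × P) ℂ) = onCV M * onCV N := by
  rw [onCV, onCV, onCV, ← Matrix.mul_kronecker_mul, Matrix.one_mul]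

theorem onCV_one : (onCV 1 : Matrix (CV c v × P) (CV c v × P) ℂ) = 1 := by
  rw [onCV, Matrix.one_kronecker_one]

theorem onCV_sub (M N : Op c v) :
    (onCV (M - N) : Matrix (CV c v × P) (CV c v × P) ℂ) = onCV M - onCV N := by
  ext x y
  simp [onCV, sub_mul]

theorem onCV_conjTranspose (M : Op c v) :
    (onCV M : Matrix (CV c v × P) (CV c v × P) ℂ)ᴴ = onCV Mᴴ := by
  rw [onCV, Matrix.conjTranspose_kronecker, Matrix.conjTranspose_one, onCV]

theorem onCV_unitary {M : Op c v} (hM : M ∈ Matrix.unitaryGroup (CV c v) ℂ) :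
    (onCV M : Matrix (CV c v × P) (CV c v × P) ℂ)ᴴ * onCV M = 1 := by
  have h1 : Mᴴ * M = 1 := Matrix.mem_unitaryGroup_iff'.1 hM
  rw [onCV_conjTranspose, ← onCV_mul, h1, onCV_one]

end Vectors

theorem Strategy.op_unitary {c n : ℕ} (S : Strategy c n) (i : ℕ) :
    S.op i ∈ Matrix.unitaryGroup (Fin c × Fin (S.mem + 1)) ℂ := by
  rw [Strategy.op]
  split
  · exact S.U_unitary _
  · exact one_mem _

instance {c n : ℕ} : Nonempty (Strategy c n) :=
  ⟨⟨0, fun _ => 1, fun _ => one_mem _⟩⟩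

/-! ### Admissible operators of Alice and Bob -/

namespace Referee

variable {a b c v : ℕ} (R : Referee a b c v)

theorem pos_c (R : Referee a b c v) : 0 < c := by
  rcases Nat.eq_zero_or_pos c with h | h
  · subst h
    have := R.psi_unit
    simp at this
  · exact h

theorem pos_v (R : Referee a b c v) : 0 < v := by
  rcases Nat.eq_zero_or_pos v with h | h
  · subst h
    have := R.psi_unit
    simp at this
  · exact h

theorem W_unitary (i : ℕ) : R.W i ∈ Matrix.unitaryGroup (CV c v) ℂ := by
  cases i with
  | zero => exact one_mem _
  | succ i =>
    rw [W]
    split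
    · exact R.V_unitary _
    · exact one_mem _

theorem isDensity_psi : IsDensity (Matrix.vecMulVec R.psi (star R.psi)) := by
  refine ⟨Matrix.posSemidef_vecMulVec_self_star _, ?_⟩
  have h := R.psi_unit
  rw [Matrix.trace_vecMulVec, dotProduct]
  have : ∀ x, R.psi x * star R.psi x = ((‖R.psi x‖ ^ 2 : ℝ) : ℂ) := fun x => by
    rw [Pi.star_apply, Complex.star_def, Complex.mul_conj, Complex.normSq_eq_norm_sq]
  simp only [this]
  rw [← Complex.ofReal_sum, h, Complex.ofReal_one]

theorem stateOf_aliceVec_zero {P : Type} [Fintype P] [DecidableEq P] (p : P)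
    (A : ℕ → Matrix (Fin c × P) (Fin c × P) ℂ) :
    stateOf (R.aliceVec p A 0) = Matrix.vecMulVec R.psi (star R.psi) := by
  ext x y
  simp only [stateOf, vecMat, aliceVec, Matrix.mul_apply, Matrix.conjTranspose_apply,
    Matrix.vecMulVec_apply, Pi.star_apply]
  rw [Finset.sum_eq_single p] <;> simp +contextual

theorem trC_stateOf_aliceVec_succ {P : Type} [Fintype P] [DecidableEq P] (p : P)
    {A : ℕ → Matrix (Fin c × P) (Fin c × P) ℂ} {k : ℕ}
    (hA : A k ∈ Matrix.unitaryGroup (Fin c × P) ℂ) :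
    trC (stateOf (R.aliceVec p A (k + 1)))
      = trC (R.W k * stateOf (R.aliceVec p A k) * (R.W k)ᴴ) := by
  rw [aliceVec, trC_stateOf_onCP hA, stateOf_onCV]

theorem isDensity_stateOf_aliceVec {P : Type} [Fintype P] [DecidableEq P] (p : P)
    {A : ℕ → Matrix (Fin c × P) (Fin c × P) ℂ}
    (hA : ∀ k, A k ∈ Matrix.unitaryGroup (Fin c × P) ℂ) (k : ℕ) :
    IsDensity (stateOf (R.aliceVec p A k)) := by
  induction k with
  | zero => rw [stateOf_aliceVec_zero]; exact R.isDensity_psi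
  | succ k ih =>
    refine ⟨Matrix.posSemidef_self_mul_conjTranspose _, ?_⟩
    rw [← trace_trC, trC_stateOf_aliceVec_succ _ _ (hA k), trace_trC]
    exact (ih.conj (R.W_unitary k)).2

theorem aliceState_eq (SA : Strategy c a) :
    R.aliceState SA = stateOf (R.aliceVec 0 SA.op a) := by
  ext x y
  simp only [aliceState, stateOf, vecMat, Matrix.mul_apply, Matrix.conjTranspose_apply]

theorem isDensity_aliceState (SA : Strategy c a) : IsDensity (R.aliceState SA) := by
  rw [aliceState_eq]
  exact R.isDensity_stateOf_aliceVec 0 (fun k => SA.op_unitary k) a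

theorem isDensity_tr {ρ : Fin a → Op c v} (hρ : ∀ i, IsDensity (ρ i)) {i : ℕ} (hi : i ≤ a) :
    IsDensity (R.tr ρ i) := by
  cases i with
  | zero => exact R.isDensity_psi
  | succ i =>
    rw [tr, dif_pos (by omega)]
    exact hρ _

/-- Alice's strategies produce consistent transcripts. -/
theorem exists_consistent (SA : Strategy c a) :
    ∃ ρ : Fin a → Op c v, R.Consistent ρ ∧ R.tr ρ a = R.aliceState SA := by
  let ρ : Fin a → Op c v := fun i => stateOf (R.aliceVec 0 SA.op (i + 1))
  have htr : ∀ k ≤ a, R.tr ρ k = stateOf (R.aliceVec 0 SA.op k) := by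
    intro k hk
    cases k with
    | zero => rw [stateOf_aliceVec_zero]; rfl
    | succ k => rw [tr, dif_pos (by omega)]
  refine ⟨ρ, ⟨fun i => R.isDensity_stateOf_aliceVec 0 (fun k => SA.op_unitary k) _,
    fun i hi => ?_⟩, by rw [htr a le_rfl, aliceState_eq]⟩
  rw [htr _ hi, htr _ hi.le, trC_stateOf_aliceVec_succ _ _ (SA.op_unitary i)]

theorem exists_purification {n P : Type} [Fintype n] [DecidableEq n] [Fintype P] [DecidableEq P]
    (e : P ≃ n) {ρ : Matrix n n ℂ} (hρ : ρ.PosSemidef) : ∃ X : Matrix n P ℂ, X * Xᴴ = ρ := by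
  obtain ⟨S, hS, hSS⟩ := exists_posSemidef_sqrt hρ
  have hSh : Sᴴ = S := hS.1
  refine ⟨S.submatrix id e, ?_⟩
  rw [Matrix.conjTranspose_submatrix, Matrix.submatrix_mul_equiv, hSh, hSS, Matrix.submatrix_id_id]

/-- Every consistent transcript comes from a strategy of Alice. -/
theorem exists_strategy {ρ : Fin a → Op c v} (hρ : R.Consistent ρ) :
    ∃ SA : Strategy c a, R.aliceState SA = R.tr ρ a := by
  -- A private register of dimension `dim (C ⊗ V)` can purify every state on `C ⊗ V`.
  obtain ⟨mem, hmem⟩ : ∃ mem, mem + 1 = c * v :=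
    ⟨c * v - 1, Nat.sub_add_cancel (Nat.mul_pos R.pos_c R.pos_v)⟩
  let e : Fin (mem + 1) ≃ CV c v := (finCongr hmem).trans finProdFinEquiv.symm
  have hpur : ∀ k : ℕ, ∃ X : Matrix (CV c v) (Fin (mem + 1)) ℂ,
      k < a → X * Xᴴ = R.tr ρ (k + 1) := by
    intro k
    by_cases hk : k < a
    · obtain ⟨X, hX⟩ := exists_purification e (R.isDensity_tr hρ.1 (Nat.succ_le_of_lt hk)).1
      exact ⟨X, fun _ => hX⟩
    · exact ⟨0, fun h => absurd h hk⟩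
  choose X hX using hpur
  -- Later purifications are arbitrary, but the initial one has to be the vector from which the game
  -- starts.
  let Y : ℕ → Matrix (CV c v) (Fin (mem + 1)) ℂ
    | 0 => vecMat (R.aliceVec 0 (fun _ => 1) 0)
    | k + 1 => X k
  have hY : ∀ k ≤ a, Y k * (Y k)ᴴ = R.tr ρ k := by
    intro k hk
    cases k with
    | zero => exact R.stateOf_aliceVec_zero 0 _
    | succ k => exact hX k (by omega)
  -- Consistency says that the purifications before and after Alice's move have the same marginal on
  -- `V`, so unitary freedom supplies the move. The transposes appear because she acts on the column
  -- index of `reshape`.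
  have hU : ∀ k : Fin a, ∃ U ∈ Matrix.unitaryGroup (Fin c × Fin (mem + 1)) ℂ,
      U * (reshape (R.W k * Y k))ᵀ = (reshape (Y (k + 1)))ᵀ := by
    intro k
    refine exists_unitary_mul_eq ?_
    have h1 : reshape (R.W k * Y k) * (reshape (R.W k * Y k))ᴴ
        = reshape (Y (k + 1)) * (reshape (Y (k + 1)))ᴴ := by
      rw [reshape_mul_conjTranspose, reshape_mul_conjTranspose, hY _ k.2, hρ.2 k k.2,
        ← hY _ k.2.le, Matrix.conjTranspose_mul]
      simp only [Matrix.mul_assoc]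
    have h2 := congrArg Matrix.transpose h1
    rwa [Matrix.transpose_mul, Matrix.transpose_mul] at h2
  choose U hUu hUY using hU
  let SA : Strategy c a := ⟨mem, U, hUu⟩
  refine ⟨SA, ?_⟩
  have hvec : ∀ k ≤ a, vecMat (R.aliceVec 0 SA.op k) = Y k := by
    intro k hk
    induction k with
    | zero => rfl
    | succ k ih =>
      have hop : SA.op k = U ⟨k, hk⟩ := dif_pos hk
      have h1 : reshape (vecMat (R.aliceVec 0 SA.op (k + 1))) = reshape (Y (k + 1)) := by
        rw [aliceVec, reshape_vecMat_onCP, vecMat_onCV, ih (by omega), hop]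
        have := congrArg Matrix.transpose (hUY ⟨k, hk⟩)
        rwa [Matrix.transpose_mul, Matrix.transpose_transpose, Matrix.transpose_transpose] at this
      ext x q
      exact congrFun (congrFun h1 x.2) (x.1, q)
  rw [aliceState_eq, stateOf, hvec a le_rfl, hY a le_rfl]

/-- Bob's register stays in its initial state during Alice's rounds. Together with `bobOp_onCB` this
splits the three-party experiment into a state and a measurement. -/
theorem aliceVec_onCA (A B : Type) [Fintype A] [Fintype B] [DecidableEq A] [DecidableEq B]
    (p : A) (r : B) (U : ℕ → Matrix (Fin c × A) (Fin c × A) ℂ) (k : ℕ) (x : CV c v) (q : A)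
    (s : B) :
    R.aliceVec (p, r) (fun i => onCA (U i)) k (x, (q, s))
      = if s = r then R.aliceVec p U k (x, q) else 0 := by
  induction k generalizing x q s with
  | zero => simp only [aliceVec, Prod.mk.injEq]; split_ifs <;> simp_all
  | succ k ih =>
    have h1 : ∀ (x : CV c v) (q : A) (s : B),
        (onCV (R.W k) *ᵥ R.aliceVec (p, r) (fun i => onCA (U i)) k) (x, (q, s))
        = if s = r then (onCV (R.W k) *ᵥ R.aliceVec p U k) (x, q) else 0 := by
      intro x q s
      have e1 := congrFun (congrFun
        (vecMat_onCV (R.W k) (R.aliceVec (p, r) (fun i => onCA (U i)) k)) x) (q, s)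
      have e2 := congrFun (congrFun (vecMat_onCV (R.W k) (R.aliceVec p U k)) x) q
      simp only [vecMat, Matrix.mul_apply] at e1 e2
      rw [e1, e2]
      simp only [ih]
      split <;> simp
    have e1 := congrFun (congrFun (reshape_vecMat_onCP (onCA (U k))
      (onCV (R.W k) *ᵥ R.aliceVec (p, r) (fun i => onCA (U i)) k)) x.2) (x.1, (q, s))
    have e2 := congrFun (congrFun (reshape_vecMat_onCP (U k)
      (onCV (R.W k) *ᵥ R.aliceVec p U k)) x.2) (x.1, q)
    simp only [vecMat, reshape, Matrix.mul_apply, Matrix.transpose_apply] at e1 e2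
    rw [aliceVec, aliceVec, e1, e2]
    simp only [Fintype.sum_prod_type, h1, onCA, mul_ite, mul_zero, ite_mul, zero_mul]
    split
    · rename_i h
      subst h
      simp
    · rename_i h
      refine Finset.sum_eq_zero fun k _ => Finset.sum_eq_zero fun i _ =>
        Finset.sum_eq_zero fun t _ => ?_
      split_ifs <;> simp_all

theorem bobOp_onCB (A B : Type) [Fintype A] [Fintype B] [DecidableEq A] [DecidableEq B]
    (U : ℕ → Matrix (Fin c × B) (Fin c × B) ℂ) (k : ℕ) (x y : CV c v) (q q' : A) (s s' : B) :
    R.bobOp (fun i => onCB (U i)) k (x, (q, s)) (y, (q', s'))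
      = if q = q' then R.bobOp U k (x, s) (y, s') else 0 := by
  induction k generalizing x y q q' s s' with
  | zero =>
    simp only [bobOp, onCV, Matrix.kronecker_apply, Matrix.one_apply, Prod.mk.injEq]
    split_ifs <;> simp_all
  | succ k ih =>
    have h1 : ∀ (x y : CV c v) (q q' : A) (s s' : B),
        ((onCP (onCB (U k)) : Matrix (CV c v × (A × B)) (CV c v × (A × B)) ℂ)
          * R.bobOp (fun i => onCB (U i)) k : Matrix (CV c v × (A × B)) (CV c v × (A × B)) ℂ)
            (x, (q, s)) (y, (q', s'))
        = if q = q' then ((onCP (U k) : Matrix (CV c v × B) (CV c v × B) ℂ) * R.bobOp U k :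
            Matrix (CV c v × B) (CV c v × B) ℂ) (x, s) (y, s') else 0 := by
      intro x y q q' s s'
      simp only [Matrix.mul_apply, Fintype.sum_prod_type, ih, onCP, onCB, mul_ite, mul_zero,
        ite_mul, zero_mul]
      split
      · rename_i h
        subst h
        refine Finset.sum_congr rfl fun k _ => Finset.sum_congr rfl fun i _ => ?_
        rw [Finset.sum_eq_single q]
        · simp
        · intro t _ ht
          refine Finset.sum_eq_zero fun r _ => ?_
          rw [if_neg ht]
        · simp
      · rename_i h
        refine Finset.sum_eq_zero fun k _ => Finset.sum_eq_zero fun i _ =>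
          Finset.sum_eq_zero fun t _ => Finset.sum_eq_zero fun r _ => ?_
        split_ifs <;> simp_all
    rw [bobOp, bobOp, Matrix.mul_apply, Matrix.mul_apply]
    simp only [Fintype.sum_prod_type, h1, onCV, Matrix.kronecker_apply, Matrix.one_apply,
      Prod.mk.injEq, mul_ite, mul_zero, mul_one, ite_mul, zero_mul]
    split
    · rename_i h
      subst h
      refine Finset.sum_congr rfl fun k _ => Finset.sum_congr rfl fun i _ => ?_
      rw [Finset.sum_eq_single q]
      · simp
      · intro t _ ht
        refine Finset.sum_eq_zero fun r _ => ?_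
        rw [if_neg ht]
      · simp
    · rename_i h
      refine Finset.sum_eq_zero fun k _ => Finset.sum_eq_zero fun i _ =>
        Finset.sum_eq_zero fun t _ => Finset.sum_eq_zero fun r _ => ?_
      split_ifs <;> simp_all

theorem bobOp_unitary {P : Type} [Fintype P] [DecidableEq P]
    {B : ℕ → Matrix (Fin c × P) (Fin c × P) ℂ}
    (hB : ∀ k, B k ∈ Matrix.unitaryGroup (Fin c × P) ℂ) (k : ℕ) :
    (R.bobOp B k)ᴴ * R.bobOp B k = 1 := by
  induction k with
  | zero => exact onCV_unitary (R.W_unitary a)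
  | succ k ih =>
    rw [bobOp, Matrix.conjTranspose_mul, Matrix.mul_assoc, ← Matrix.mul_assoc (onCV _)ᴴ,
      onCV_unitary (R.W_unitary _), Matrix.one_mul, Matrix.conjTranspose_mul, Matrix.mul_assoc,
      ← Matrix.mul_assoc (onCP _)ᴴ, onCP_unitary (hB k), Matrix.one_mul, ih]

theorem Pi_mul_self : R.Pi * R.Pi = R.Pi := R.Pi_proj.isIdempotentElem

theorem Pi_conjTranspose : R.Piᴴ = R.Pi := R.Pi_proj.isSelfAdjoint

/-- `bobMeas` and its complement are compressions of the projections `Uᴴ Π U` and `Uᴴ (1 - Π) U`. -/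
theorem isMeasurement_bobMeas (SB : Strategy c b) : IsMeasurement (R.bobMeas SB) := by
  set U : Matrix (CV c v × Fin (SB.mem + 1)) (CV c v × Fin (SB.mem + 1)) ℂ := R.bobOp SB.op b
    with hU
  have hUU : Uᴴ * U = 1 := R.bobOp_unitary (fun k => SB.op_unitary k) b
  let f : CV c v → CV c v × Fin (SB.mem + 1) := fun x => (x, 0)
  have hproj : ∀ {M : Op c v}, M * M = M → Mᴴ = M →
      ((Uᴴ * onCV M * U).submatrix f f).PosSemidef := by
    intro M h1 h2
    refine Matrix.PosSemidef.submatrix ?_ f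
    refine Matrix.PosSemidef.conjTranspose_mul_mul_same ?_ U
    have : (onCV M : Matrix (CV c v × Fin (SB.mem + 1)) (CV c v × Fin (SB.mem + 1)) ℂ)
        = (onCV M)ᴴ * onCV M := by
      rw [onCV_conjTranspose, h2, ← onCV_mul, h1]
    rw [this]
    exact Matrix.posSemidef_conjTranspose_mul_self _
  have h1 : R.bobMeas SB = (Uᴴ * onCV R.Pi * U).submatrix f f := rfl
  have h2 : 1 - R.bobMeas SB = (Uᴴ * onCV (1 - R.Pi) * U).submatrix f f := by
    rw [onCV_sub, onCV_one, Matrix.mul_sub, Matrix.sub_mul, Matrix.mul_one, hUU, h1,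
      Matrix.submatrix_sub]
    congr 1
    ext x y
    simp [f, Matrix.one_apply]
  refine ⟨h1 ▸ hproj R.Pi_mul_self R.Pi_conjTranspose, h2 ▸ hproj ?_ ?_⟩
  · simp only [Matrix.mul_sub, Matrix.sub_mul, R.Pi_mul_self, Matrix.one_mul, Matrix.mul_one]
    abel
  · rw [Matrix.conjTranspose_sub, Matrix.conjTranspose_one, R.Pi_conjTranspose]

theorem fro_sq_eq_sum {m n : Type} [Fintype m] [Fintype n] (X : Matrix m n ℂ) :
    fro X ^ 2 = ∑ i, ∑ j, ‖X i j‖ ^ 2 := by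
  rw [fro, EuclideanSpace.norm_sq_eq, Fintype.sum_prod_type]
  rfl

/-- Bob's winning probability in terms of the players' admissible operators. -/
theorem winProb_eq (SA : Strategy c a) (SB : Strategy c b) :
    R.winProb SA SB = inn (R.aliceState SA) (R.bobMeas SB) := by
  set X := vecMat (R.aliceVec 0 SA.op a) with hX
  set U : Matrix (CV c v × Fin (SB.mem + 1)) (CV c v × Fin (SB.mem + 1)) ℂ := R.bobOp SB.op b
    with hU
  let f : CV c v → CV c v × Fin (SB.mem + 1) := fun x => (x, 0)
  -- `L = Π U (I ⊗ |0⟩)`, so Bob's measurement operator is `Lᴴ L`. The final vector of the game is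
  -- the matrix `L X`, with Bob's register in the rows and Alice's in the columns.
  set L : Matrix (CV c v × Fin (SB.mem + 1)) (CV c v) ℂ := (onCV R.Pi * U).submatrix id f with hL
  have hM : R.bobMeas SB = Lᴴ * L := by
    have h1 : R.bobMeas SB = (Uᴴ * onCV R.Pi * U).submatrix f f := rfl
    have h2 : Uᴴ * onCV R.Pi * U = (onCV R.Pi * U)ᴴ * (onCV R.Pi * U) := by
      rw [Matrix.conjTranspose_mul, onCV_conjTranspose, R.Pi_conjTranspose,
        Matrix.mul_assoc Uᴴ, Matrix.mul_assoc Uᴴ, ← Matrix.mul_assoc (onCV R.Pi), ← onCV_mul,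
        R.Pi_mul_self]
    rw [h1, h2, hL, Matrix.conjTranspose_submatrix,
      ← Matrix.submatrix_mul _ _ f id f Function.bijective_id]
  have hentry : ∀ (x : CV c v) (q : Fin (SA.mem + 1)) (s : Fin (SB.mem + 1)),
      (onCV R.Pi *ᵥ (R.bobOp (fun i => onCB (SB.op i)) b *ᵥ
        R.aliceVec (0, 0) (fun i => onCA (SA.op i)) a)) (x, (q, s)) = (L * X) (x, s) q := by
    intro x q s
    have h1 : ∀ (x : CV c v) (q : Fin (SA.mem + 1)) (s : Fin (SB.mem + 1)),
        (R.bobOp (fun i => onCB (SB.op i)) b *ᵥ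
        R.aliceVec (0, 0) (fun i => onCA (SA.op i)) a) (x, (q, s))
        = ∑ y, U (x, s) (y, 0) * X y q := by
      intro x q s
      rw [Matrix.mulVec, dotProduct, Fintype.sum_prod_type]
      refine Finset.sum_congr rfl fun y _ => ?_
      rw [Fintype.sum_prod_type]
      simp only [aliceVec_onCA, bobOp_onCB, hX, vecMat, mul_ite, mul_zero, ite_mul, zero_mul]
      simp [hU]
    have e1 := congrFun (congrFun (vecMat_onCV R.Pi (R.bobOp (fun i => onCB (SB.op i)) b *ᵥ
        R.aliceVec (0, 0) (fun i => onCA (SA.op i)) a)) x) (q, s)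
    simp only [vecMat, Matrix.mul_apply] at e1
    rw [e1, Matrix.mul_apply]
    simp only [h1, hL, Matrix.submatrix_apply, id, Matrix.mul_apply, Finset.mul_sum,
      Finset.sum_mul, f]
    rw [Finset.sum_comm]
    refine Finset.sum_congr rfl fun y _ => ?_
    refine Eq.trans ?_ (Fintype.sum_prod_type _).symm
    refine Finset.sum_congr rfl fun z _ => ?_
    simp [onCV, Matrix.one_apply, mul_assoc]
  have hwin : R.winProb SA SB = fro (L * X) ^ 2 := by
    rw [fro_sq_eq_sum, winProb]
    refine (Fintype.sum_prod_type _).trans (Eq.trans ?_ (Fintype.sum_prod_type _).symm)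
    refine Finset.sum_congr rfl fun x _ => ?_
    rw [Fintype.sum_prod_type, Finset.sum_comm]
    simp only [hentry]
  rw [hwin, aliceState_eq, inn_eq_rin (X := X) (ρ := stateOf _) rfl, hM, ← rin_self, rin, rin,
    Matrix.conjTranspose_mul]
  simp only [Matrix.mul_assoc]

end Referee

/-! ### Analysis of the rounding procedure -/

section Inn

variable {n : Type} [Fintype n] [DecidableEq n]

theorem inn_nonneg {A B : Matrix n n ℂ} (hA : A.PosSemidef) (hB : B.PosSemidef) :
    0 ≤ inn A B := by
  obtain ⟨S, hS, hSS⟩ := exists_posSemidef_sqrt hA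
  have hSh : Sᴴ = S := hS.1
  rw [inn_eq_rin (X := S) (by rw [hSh, hSS]), rin, ← Matrix.mul_assoc]
  exact (Complex.le_def.1 (hB.conjTranspose_mul_mul_same S).trace_nonneg).1

theorem inn_le_one {ρ M : Matrix n n ℂ} (hρ : IsDensity ρ) (hM : IsMeasurement M) :
    inn ρ M ≤ 1 := by
  have h := inn_nonneg hρ.1 hM.2
  have h1 : ρᴴ = ρ := hρ.1.1
  rw [inn, Matrix.mul_sub, Matrix.mul_one, Matrix.trace_sub, h1, hρ.2, Complex.sub_re,
    Complex.one_re] at h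
  rw [inn, h1]
  linarith

theorem inn_sub_left (A B M : Matrix n n ℂ) : inn (A - B) M = inn A M - inn B M := by
  simp [inn, Matrix.sub_mul]

theorem isMeasurement_zero : IsMeasurement (0 : Matrix n n ℂ) :=
  ⟨Matrix.PosSemidef.zero, by rw [sub_zero]; exact Matrix.PosSemidef.one⟩

end Inn

/-- The inequality of arithmetic and geometric means. With `t = a / ε` it turns a defect into its
penalty term plus `ε / (2 a)`, and `a` such remainders make `ε / 2`. -/
theorem sqrt_two_mul_le {t D : ℝ} (ht : 0 < t) (hD : 0 ≤ D) : √(2 * D) ≤ t * D + 1 / (2 * t) := by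
  refine Real.sqrt_le_iff.2 ⟨by positivity, ?_⟩
  have h : (t * D + 1 / (2 * t)) ^ 2 - 2 * D = (t * D - 1 / (2 * t)) ^ 2 := by
    field_simp
    ring
  nlinarith [sq_nonneg (t * D - 1 / (2 * t))]

namespace Referee

variable {a b c v : ℕ} (R : Referee a b c v)

/-- `ρ'` results from `ρ` by the successive correction of marginals. -/
def IsRounding (ρ ρ' : Fin a → Op c v) : Prop :=
  ∀ i < a, ∃ q : Polynomial ℂ,
    InvSqrtOn q (trC (R.tr ρ (i + 1)) * trC (R.W i * R.tr ρ' i * (R.W i)ᴴ)) ∧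
    R.tr ρ' (i + 1) = roundStep (trC (R.W i * R.tr ρ' i * (R.W i)ᴴ))
      (trC (R.W i * R.tr ρ' i * (R.W i)ᴴ) *
        Polynomial.aeval (trC (R.tr ρ (i + 1)) * trC (R.W i * R.tr ρ' i * (R.W i)ᴴ)) q)
      (R.tr ρ (i + 1))

/-- The operators `Q` come from Powers–Størmer and depend only on `ρ`, not on `M`. Hence `(M, Q)` is
a single response whose penalized payoff bounds what `M` achieves against the rounded state. -/
theorem isRounding_spec {ρ ρ' : Fin a → Op c v} (h : R.IsRounding ρ ρ')
    (hρ : ∀ i, IsDensity (ρ i)) {ε : ℝ} (hε : 0 < ε) :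
    R.Consistent ρ' ∧ ∃ Q : Fin a → Matrix (Fin v) (Fin v) ℂ, (∀ i, IsMeasurement (Q i)) ∧
      ∀ M, IsMeasurement M → inn (R.tr ρ' a) M ≤ inn (R.tr ρ a) M
        + (a / ε) * ∑ i : Fin a, inn (R.defect ρ i) (Q i) + ε / 2 := by
  have hσ : ∀ k, k < a → IsDensity (trC (R.W k * R.tr ρ k * (R.W k)ᴴ)) := fun k hk =>
    ((R.isDensity_tr hρ hk.le).conj (R.W_unitary k)).trC
  have hτ : ∀ k, k < a → IsDensity (trC (R.tr ρ (k + 1))) := fun k hk =>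
    (R.isDensity_tr hρ hk).trC
  have hAB : ∀ k : ℕ, ∃ A B Q : Matrix (Fin v) (Fin v) ℂ, k < a → A.PosSemidef ∧ B.PosSemidef ∧
      A * A = trC (R.W k * R.tr ρ k * (R.W k)ᴴ) ∧ B * B = trC (R.tr ρ (k + 1)) ∧
      IsMeasurement Q ∧ fro (A - B) ^ 2 ≤ 2 * inn (R.defect ρ k) Q := by
    intro k
    by_cases hk : k < a
    · obtain ⟨A, hA, hAA⟩ := exists_posSemidef_sqrt (hσ k hk).1
      obtain ⟨B, hB, hBB⟩ := exists_posSemidef_sqrt (hτ k hk).1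
      obtain ⟨Q, hQ, hle⟩ := exists_measurement_fro_sub_sq_le hA hB (by rw [hAA, (hσ k hk).2])
        (by rw [hBB, (hτ k hk).2])
      exact ⟨A, B, Q, fun _ => ⟨hA, hB, hAA, hBB, hQ, by rwa [hAA, hBB] at hle⟩⟩
    · exact ⟨0, 0, 0, fun h => absurd h hk⟩
  choose A B Q hAB using hAB
  -- The initial states agree, and round `i` adds `fro (A i - B i)` to the distance.
  have hnear : ∀ k ≤ a, IsDensity (R.tr ρ' k) ∧
      Near (∑ i ∈ Finset.range k, fro (A i - B i)) (R.tr ρ k) (R.tr ρ' k) := by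
    intro k hk
    induction k with
    | zero => exact ⟨R.isDensity_psi, near_self R.pos_c R.isDensity_psi.1⟩
    | succ k ih =>
      obtain ⟨hd, hn⟩ := ih (by omega)
      obtain ⟨q, hq, hqr⟩ := h k hk
      obtain ⟨hA, hB, hAA, hBB, -, -⟩ := hAB k hk
      rw [hqr, Finset.sum_range_succ]
      exact near_roundStep R.pos_c hn (R.isDensity_tr hρ (by omega)) hd (R.isDensity_tr hρ hk)
        (R.W_unitary k) rfl hq rfl hA hB hAA hBB
  refine ⟨⟨fun i => ?_, fun i hi => ?_⟩, fun i => Q i, fun i => (hAB i i.2).2.2.2.2.1,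
    fun M hM => ?_⟩
  · have := (hnear (i + 1) i.2).1
    rwa [tr, dif_pos i.2] at this
  · obtain ⟨q, hq, hqr⟩ := h i hi
    rw [hqr, trC_roundStep R.pos_c _ _ (R.isDensity_tr hρ hi).1]
  · obtain ⟨hd, hn⟩ := hnear a le_rfl
    refine (hn.inn_le (R.isDensity_tr hρ le_rfl) hd hM).trans ?_
    rw [add_assoc]
    refine add_le_add_right ?_ _
    rw [Fin.sum_univ_eq_sum_range (fun i => inn (R.defect ρ i) (Q i)) a]
    rcases Nat.eq_zero_or_pos a with ha | ha
    · subst ha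
      simp only [Finset.range_zero, Finset.sum_empty, mul_zero, zero_add]
      positivity
    · have ha' : (0 : ℝ) < a := by exact_mod_cast ha
      calc ∑ i ∈ Finset.range a, fro (A i - B i)
          ≤ ∑ i ∈ Finset.range a, (a / ε * inn (R.defect ρ i) (Q i) + 1 / (2 * (a / ε))) := by
            refine Finset.sum_le_sum fun i hi => ?_
            obtain ⟨-, -, -, -, -, hle⟩ := hAB i (Finset.mem_range.1 hi)
            exact (Real.le_sqrt_of_sq_le hle).trans (sqrt_two_mul_le (by positivity)
              (by nlinarith [sq_nonneg (fro (A i - B i))]))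
        _ = _ := by
            rw [Finset.sum_add_distrib, ← Finset.mul_sum]
            simp only [Finset.sum_const, Finset.card_range, nsmul_eq_mul]
            field_simp

/-! ### The relaxed value and the value of the game -/

/-- The best payoff of Bob against the state `ρ`. -/
noncomputable def best (ρ : Op c v) : ℝ := ⨆ SB : Strategy c b, inn ρ (R.bobMeas SB)

variable {R}

theorem bddAbove_best {ρ : Op c v} (hρ : IsDensity ρ) :
    BddAbove (Set.range fun SB : Strategy c b => inn ρ (R.bobMeas SB)) := by
  refine ⟨1, ?_⟩
  rintro _ ⟨SB, rfl⟩
  exact inn_le_one hρ (R.isMeasurement_bobMeas SB)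

theorem best_nonneg {ρ : Op c v} (hρ : IsDensity ρ) : 0 ≤ R.best ρ :=
  Real.iSup_nonneg fun SB => inn_nonneg hρ.1 (R.isMeasurement_bobMeas SB).1

theorem lam_eq : R.lam = ⨅ SA : Strategy c a, R.best (R.aliceState SA) := by
  simp only [lam, best, winProb_eq]

theorem lam_le (SA : Strategy c a) : R.lam ≤ R.best (R.aliceState SA) := by
  rw [lam_eq]
  refine ciInf_le ⟨0, ?_⟩ SA
  rintro _ ⟨SA, rfl⟩
  exact best_nonneg (R.isDensity_aliceState SA)

theorem iSup_payoff (ρ : {ρ : Op c v // ρ ∈ R.admA}) : ⨆ P, R.payoff ρ P = R.best ρ.1 :=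
  (Set.rangeFactorization_surjective (f := R.bobMeas)).iSup_comp (g := R.payoff ρ) |>.symm

theorem isMeasurement_admP {P : Op c v} (hP : P ∈ R.admP) : IsMeasurement P := by
  obtain ⟨SB, rfl⟩ := hP
  exact R.isMeasurement_bobMeas SB

instance : Nonempty {P : Op c v // P ∈ R.admP} := (Set.range_nonempty R.bobMeas).to_subtype

instance : Nonempty {ρ : Op c v // ρ ∈ R.admA} := (Set.range_nonempty R.aliceState).to_subtype

instance : Nonempty
    {Q : Fin a → Matrix (Fin v) (Fin v) ℂ // ∀ i, IsMeasurement (Q i)} :=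
  ⟨⟨fun _ => 0, fun _ => isMeasurement_zero⟩⟩

instance : Nonempty R.Tuple := ⟨⟨fun _ => _, fun _ => R.isDensity_psi⟩⟩

theorem abs_inn_defect_le {ρ : Fin a → Op c v} (hρ : ∀ i, IsDensity (ρ i)) (i : Fin a)
    {Q : Matrix (Fin v) (Fin v) ℂ} (hQ : IsMeasurement Q) : |inn (R.defect ρ i) Q| ≤ 1 := by
  have h1 : IsDensity (trC (R.W i * R.tr ρ i * (R.W i)ᴴ)) :=
    ((R.isDensity_tr hρ i.2.le).conj (R.W_unitary i)).trC
  have h2 : IsDensity (trC (R.tr ρ (i + 1))) := (R.isDensity_tr hρ i.2).trC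
  rw [defect, inn_sub_left, abs_le]
  constructor <;> linarith [inn_nonneg h1.1 hQ.1, inn_nonneg h2.1 hQ.1, inn_le_one h1 hQ,
    inn_le_one h2 hQ]

/-- Boundedness makes the real suprema and infima genuine, rather than the default value `0` of
unbounded families. -/
theorem abs_penalized_le {ε : ℝ} (hε : 0 < ε) (ρ : R.Tuple) (X : R.Response) :
    |R.penalized ε ρ X| ≤ 1 + a / ε * a := by
  have h1 : |inn (R.tr ρ.1 a) X.1.1| ≤ 1 := by
    have hd := R.isDensity_tr ρ.2 le_rfl
    have hm := isMeasurement_admP X.1.2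
    rw [abs_le]
    constructor <;> linarith [inn_nonneg hd.1 hm.1, inn_le_one hd hm]
  have h2 : |∑ i : Fin a, inn (R.defect ρ.1 i) (X.2.1 i)| ≤ a := by
    refine (Finset.abs_sum_le_sum_abs _ _).trans ?_
    refine (Finset.sum_le_sum fun i _ => abs_inn_defect_le ρ.2 i (X.2.2 i)).trans ?_
    simp
  rw [penalized]
  refine (abs_add_le _ _).trans (add_le_add h1 ?_)
  rw [abs_mul, abs_of_nonneg (by positivity : 0 ≤ (a : ℝ) / ε)]
  exact mul_le_mul_of_nonneg_left h2 (by positivity)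

theorem penalized_le_iSup {ε : ℝ} (hε : 0 < ε) (ρ : R.Tuple) (X : R.Response) :
    R.penalized ε ρ X ≤ ⨆ X, R.penalized ε ρ X := by
  refine le_ciSup (f := R.penalized ε ρ) ⟨1 + a / ε * a, ?_⟩ X
  rintro _ ⟨X, rfl⟩
  exact (le_abs_self _).trans (abs_penalized_le hε ρ X)

theorem penalized_of_consistent (ε : ℝ) {ρ : R.Tuple} (hρ : R.Consistent ρ.1) (X : R.Response) :
    R.penalized ε ρ X = inn (R.tr ρ.1 a) X.1.1 := by
  have : ∀ i : Fin a, inn (R.defect ρ.1 i) (X.2.1 i) = 0 := fun i => by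
    rw [defect, hρ.2 i i.2, sub_self, inn]
    simp
  rw [penalized, Finset.sum_eq_zero fun i _ => this i, mul_zero, add_zero]

theorem bddBelow_iSup_penalized {ε : ℝ} (hε : 0 < ε) :
    BddBelow (Set.range fun ρ : R.Tuple => ⨆ X, R.penalized ε ρ X) := by
  refine ⟨-(1 + a / ε * a), ?_⟩
  rintro _ ⟨ρ, rfl⟩
  obtain ⟨X⟩ : Nonempty R.Response := inferInstance
  exact (neg_le_of_abs_le (abs_penalized_le hε ρ X)).trans (penalized_le_iSup hε ρ X)

/-- The transcript of an honest strategy is a competitor in the relaxed problem that pays no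
penalty. -/
theorem mu_le_lam {ε : ℝ} (hε : 0 < ε) : R.mu ε ≤ R.lam := by
  rw [lam_eq]
  refine le_ciInf fun SA => ?_
  obtain ⟨ρ, hρ, hρa⟩ := R.exists_consistent SA
  refine (ciInf_le (bddBelow_iSup_penalized hε) (⟨ρ, hρ.1⟩ : R.Tuple)).trans ?_
  refine ciSup_le fun X => ?_
  rw [penalized_of_consistent ε hρ, hρa]
  obtain ⟨SB, hSB⟩ := X.1.2
  rw [← hSB]
  exact le_ciSup (bddAbove_best (R.isDensity_aliceState SA)) SB

/-- Rounding turns a tuple of states into an action of Alice that is almost as good. -/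
theorem best_le_of_isRounding {ρ : R.Tuple} {ρ' : Fin a → Op c v} (h : R.IsRounding ρ.1 ρ')
    {ε : ℝ} (hε : 0 < ε) :
    R.best (R.tr ρ' a) ≤ (⨆ X, R.penalized ε ρ X) + ε / 2 := by
  obtain ⟨hcons, Q, hQ, hle⟩ := R.isRounding_spec h ρ.2 hε
  refine ciSup_le fun SB => (hle _ (R.isMeasurement_bobMeas SB)).trans ?_
  exact add_le_add_left (penalized_le_iSup hε ρ (⟨_, SB, rfl⟩, ⟨Q, hQ⟩)) _

/-- The loss is in fact at most `ε / 2`, whence the strict inequality. -/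
theorem lam_sub_lt_mu {ε : ℝ} (hε : 0 < ε)
    (hround : ∀ ρ : R.Tuple, ∃ ρ', R.IsRounding ρ.1 ρ') : R.lam - ε < R.mu ε := by
  have : R.lam - ε / 2 ≤ R.mu ε := by
    refine le_ciInf fun ρ => ?_
    obtain ⟨ρ', h⟩ := hround ρ
    obtain ⟨SA, hSA⟩ := R.exists_strategy (R.isRounding_spec h ρ.2 hε).1
    have h1 := lam_le (R := R) SA
    have h2 := best_le_of_isRounding h hε
    rw [hSA] at h1
    linarith
  linarith

/-- On the transcript behind an admissible state the penalty is zero, so `P` alone earns at least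
`μ_ε - δ`, which exceeds `λ - ε - δ`. -/
theorem maxOptimal_of_maxOptimal {ε δ : ℝ} (hε : 0 < ε) (hlt : R.lam - ε < R.mu ε)
    {X : R.Response} (hX : MaxOptimal (R.penalized ε) (R.mu ε) δ X) :
    MaxOptimal R.payoff R.lam (δ + ε) X.1 := by
  refine le_ciInf fun ρ => ?_
  obtain ⟨ρ, SA, rfl⟩ := ρ
  obtain ⟨τ, hτ, hτa⟩ := R.exists_consistent SA
  have h1 : R.mu ε - δ ≤ R.penalized ε (⟨τ, hτ.1⟩ : R.Tuple) X := by
    refine le_trans hX (ciInf_le ⟨-(1 + a / ε * a), ?_⟩ _)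
    rintro _ ⟨ρ, rfl⟩
    exact neg_le_of_abs_le (abs_penalized_le hε ρ X)
  rw [penalized_of_consistent ε hτ, hτa] at h1
  rw [payoff]
  linarith

theorem minOptimal_of_isRounding {ε δ : ℝ} (hε : 0 < ε) {ρ : R.Tuple}
    (hρ : MinOptimal (R.penalized ε) (R.mu ε) δ ρ) {ρ' : Fin a → Op c v}
    (h : R.IsRounding ρ.1 ρ') :
    R.Consistent ρ' ∧ ∃ h : R.tr ρ' a ∈ R.admA,
      MinOptimal R.payoff R.lam (δ + ε) ⟨R.tr ρ' a, h⟩ := by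
  obtain ⟨hcons, -⟩ := R.isRounding_spec h ρ.2 hε
  obtain ⟨SA, hSA⟩ := R.exists_strategy hcons
  refine ⟨hcons, ⟨SA, hSA⟩, ?_⟩
  rw [MinOptimal, iSup_payoff]
  have h1 := best_le_of_isRounding h hε
  have h2 := mu_le_lam (R := R) hε
  rw [MinOptimal] at hρ
  linarith

end Referee

/-! ### Characteristic polynomials from traces of powers -/

section Newton

open Polynomial

variable {v : ℕ}

/-- The signed elementary symmetric functions, i.e. the coefficients of `∏ i, (1 - x i * T)`. -/
noncomputable def signedEsymm (x : Fin v → ℂ) (k : ℕ) : ℂ :=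
  (-1) ^ k * MvPolynomial.aeval x (MvPolynomial.esymm (Fin v) ℂ k)

theorem signedEsymm_zero (x : Fin v → ℂ) : signedEsymm x 0 = 1 := by
  simp [signedEsymm]

/-- Newton's identities. -/
theorem mul_signedEsymm (x : Fin v → ℂ) (k : ℕ) :
    k * signedEsymm x k
      = ∑ j ∈ Finset.range k, (0 - ∑ i, x i ^ (k - j)) * signedEsymm x j := by
  have h := congrArg (MvPolynomial.aeval x) (MvPolynomial.mul_esymm_eq_sum (Fin v) ℂ k)
  simp only [map_mul, map_sum, map_pow, map_neg, map_one, map_natCast] at h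
  rw [signedEsymm, mul_left_comm, h, ← mul_assoc, ← pow_add, Finset.sum_filter,
    Finset.Nat.sum_antidiagonal_eq_sum_range_succ_mk, Finset.sum_range_succ, if_neg (lt_irrefl k),
    add_zero, Finset.mul_sum]
  refine Finset.sum_congr rfl fun j hj => ?_
  have hs : ((-1 : ℂ)) ^ (k + (k + 1)) = -1 := by
    rw [← add_assoc, ← two_mul, pow_succ, pow_mul]
    simp
  rw [if_pos (Finset.mem_range.1 hj), hs, signedEsymm]
  simp only [MvPolynomial.psum, map_sum, map_pow, MvPolynomial.aeval_X]
  ring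

theorem prod_X_sub_C_eq_sum (x : Fin v → ℂ) :
    ∏ i, (X - C (x i)) = ∑ j ∈ Finset.range (v + 1), C (signedEsymm x j) * X ^ (v - j) := by
  have h := Multiset.prod_X_sub_X_eq_sum_esymm (Finset.univ.val.map x)
  rw [Multiset.map_map, Multiset.card_map, Finset.card_val, Finset.card_univ, Fintype.card_fin] at h
  refine h.trans (Finset.sum_congr rfl fun j _ => ?_)
  rw [signedEsymm, MvPolynomial.aeval_esymm_eq_multiset_esymm]
  simp [mul_assoc]

theorem sum_range_even (d : ℕ → ℂ) (n : ℕ) :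
    ∑ z ∈ Finset.range (2 * n + 1), C (if z % 2 = 0 then d (z / 2) else 0) * X ^ z
      = ∑ w ∈ Finset.range (n + 1), C (d w) * X ^ (2 * w) := by
  induction n with
  | zero => simp
  | succ n ih =>
    rw [show 2 * (n + 1) + 1 = 2 * n + 1 + 1 + 1 by ring, Finset.sum_range_succ,
      Finset.sum_range_succ, ih, Finset.sum_range_succ _ (n + 1)]
    have h1 : (2 * n + 1) % 2 = 1 := by omega
    have h2 : (2 * n + 1 + 1) % 2 = 0 := by omega
    have h3 : (2 * n + 1 + 1) / 2 = n + 1 := by omega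
    rw [h1, h2, h3]
    simp [mul_add]

/-- The coefficients of `∏ i, (X ^ 2 - x i)`. -/
theorem sum_signedEsymm_eq_prod (x : Fin v → ℂ) :
    ∑ z ∈ Finset.range (2 * v + 1),
        C (if z % 2 = 0 then signedEsymm x (v - z / 2) else 0) * X ^ z
      = ∏ i, (X ^ 2 - C (x i)) := by
  have h := congrArg (fun p : ℂ[X] => p.comp (X ^ 2)) (prod_X_sub_C_eq_sum x)
  simp only [← Polynomial.coe_compRingHom_apply, map_prod, map_sum, map_mul, map_pow, map_sub] at h
  simp only [Polynomial.coe_compRingHom_apply, Polynomial.X_comp, Polynomial.C_comp] at h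
  rw [h, sum_range_even fun w => signedEsymm x (v - w), ← Finset.sum_range_reflect]
  refine Finset.sum_congr rfl fun j hj => ?_
  have hj' := Finset.mem_range.1 hj
  rw [show v + 1 - 1 - j = v - j by omega, show v - (v - j) = j by omega, ← pow_mul]

/-- The matrix of the recursion that Newton's identities give for the signed elementary symmetric
functions, where `p j` is the power sum of exponent `j + 1`. -/
noncomputable def newtonMat (v : ℕ) (p : ℕ → ℂ) : Matrix (Fin (v + 1)) (Fin (v + 1)) ℂ :=
  fun x y => if (x : ℕ) = 0 then (if (y : ℕ) = 0 then 1 else 0)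
    else if (y : ℕ) < x then (0 - p (x - y - 1)) * ((x : ℕ) : ℂ)⁻¹ else 0

/-- The coefficient vector is fixed by the triangular recursion, and each application makes one more
entry correct. The sequential recursion thereby becomes a matrix power, which has logarithmic depth.
-/
theorem newtonMat_pow (x : Fin v → ℂ) {p : ℕ → ℂ} (hp : ∀ j < v, p j = ∑ i, x i ^ (j + 1)) (t : ℕ)
    (k : Fin (v + 1)) (hk : (k : ℕ) ≤ t) : (newtonMat v p ^ t) k 0 = signedEsymm x k := by
  induction t generalizing k with
  | zero =>
    have : k = 0 := Fin.ext (by simpa using hk)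
    subst this
    simp [signedEsymm_zero]
  | succ t ih =>
    rw [pow_succ', Matrix.mul_apply]
    by_cases h0 : (k : ℕ) = 0
    · rw [Finset.sum_eq_single 0]
      · rw [ih 0 (by simp)]
        simp [newtonMat, h0, signedEsymm_zero]
      · intro j _ hj
        have : (j : ℕ) ≠ 0 := fun h => hj (Fin.ext h)
        simp [newtonMat, h0, this]
      · simp
    · have hk0 : ((k : ℕ) : ℂ) ≠ 0 := by exact_mod_cast h0
      have h1 : ∀ j : Fin (v + 1), newtonMat v p k j * (newtonMat v p ^ t) j 0
          = if (j : ℕ) < k then (0 - ∑ i, x i ^ ((k : ℕ) - j)) * ((k : ℕ) : ℂ)⁻¹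
            * signedEsymm x j else 0 := by
        intro j
        simp only [newtonMat, h0, if_false]
        split
        · rename_i hjk
          rw [hp _ (by omega), ih j (by omega), show (k : ℕ) - j - 1 + 1 = k - j by omega]
        · simp
      rw [Finset.sum_congr rfl fun j _ => h1 j,
        Fin.sum_univ_eq_sum_range (fun j => if j < (k : ℕ) then (0 - ∑ i, x i ^ ((k : ℕ) - j))
          * ((k : ℕ) : ℂ)⁻¹ * signedEsymm x j else 0), ← Finset.sum_filter]
      have h2 : (Finset.range (v + 1)).filter (fun j => j < (k : ℕ)) = Finset.range k := by
        ext j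
        simp only [Finset.mem_filter, Finset.mem_range]
        omega
      rw [h2]
      apply mul_left_cancel₀ hk0
      rw [mul_signedEsymm, Finset.mul_sum]
      refine Finset.sum_congr rfl fun j _ => ?_
      field_simp

end Newton

/-! ### Products of two positive semidefinite matrices -/

/-- By cyclicity `t * s` shares its characteristic polynomial and the traces of its positive powers
with `S * s * S`, where `S = √t`. So its spectrum is nonnegative although it need not be Hermitian.
-/
theorem exists_eigenvalues_mul {v : ℕ} {s t : Matrix (Fin v) (Fin v) ℂ} (hs : s.PosSemidef)
    (ht : t.PosSemidef) : ∃ d : Fin v → ℝ, (∀ i, 0 ≤ d i) ∧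
      (t * s).charpoly = ∏ i, (Polynomial.X - Polynomial.C (d i : ℂ)) ∧
      ∀ j, ((t * s) ^ (j + 1)).trace = ∑ i, (d i : ℂ) ^ (j + 1) := by
  obtain ⟨S, hS, hSS⟩ := exists_posSemidef_sqrt ht
  have hSh : Sᴴ = S := hS.1
  have hH : (S * s * S).PosSemidef := by
    simpa only [hSh] using hs.mul_mul_conjTranspose_same S
  obtain ⟨U, d, hU, hU', hHd, -, hd⟩ := exists_diagonalization hH.1
  refine ⟨d, hd hH, ?_, fun j => ?_⟩
  · have h1 : (t * s).charpoly = (S * s * S).charpoly := by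
      rw [Matrix.charpoly_mul_comm (S * s), ← Matrix.mul_assoc, hSS]
    rw [h1, hHd, Matrix.charpoly_mul_comm, ← Matrix.mul_assoc, hU, Matrix.one_mul,
      Matrix.charpoly_diagonal]
  · have h1 : ∀ j : ℕ, (t * s) ^ (j + 1) = S * (S * s * S) ^ j * (S * s) := by
      intro j
      induction j with
      | zero => rw [zero_add, pow_one, pow_zero, Matrix.mul_one, ← hSS, Matrix.mul_assoc]
      | succ j ih =>
        rw [pow_succ, ih, pow_succ (S * s * S), ← hSS]
        simp only [Matrix.mul_assoc]
    have h2 : ∀ j : ℕ, (S * s * S) ^ j * U = U * Matrix.diagonal fun i => (d i : ℂ) ^ j := by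
      intro j
      induction j with
      | zero => simp
      | succ j ih =>
        have h3 : S * s * S * U = U * Matrix.diagonal fun i => (d i : ℂ) := by
          rw [hHd, Matrix.mul_assoc, hU, Matrix.mul_one]
        rw [pow_succ, Matrix.mul_assoc, h3, ← Matrix.mul_assoc, ih, Matrix.mul_assoc,
          Matrix.diagonal_mul_diagonal]
        simp only [pow_succ]
    have h4 : (S * s * S) ^ (j + 1) = U * (Matrix.diagonal fun i => (d i : ℂ) ^ (j + 1)) * Uᴴ := by
      rw [← h2, Matrix.mul_assoc _ U, hU', Matrix.mul_one]
    rw [h1, Matrix.trace_mul_comm, ← Matrix.mul_assoc, ← pow_succ', h4, Matrix.trace_mul_comm,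
      ← Matrix.mul_assoc, hU, Matrix.one_mul, Matrix.trace_diagonal]

/-! ### Listing of roots -/

section Roots

open Polynomial

theorem kthRoot_mem_roots (q : ℕ → ℂ) (d k : ℕ)
    (hk : k < (∑ j ∈ Finset.range (d + 1), C (q j) * X ^ j).roots.card) :
    kthRoot q d k ∈ (∑ j ∈ Finset.range (d + 1), C (q j) * X ^ j).roots := by
  set p := ∑ j ∈ Finset.range (d + 1), C (q j) * X ^ j with hp
  set l := (p.roots.map fun z => (toLex (z.re, z.im) : ℝ ×ₗ ℝ)).sort (· ≤ ·) with hl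
  have hlen : k < l.length := by rw [hl, Multiset.length_sort, Multiset.card_map]; exact hk
  have hmem : l[k] ∈ l := List.getElem_mem hlen
  obtain ⟨z, hz, hzk⟩ := Multiset.mem_map.1 ((Multiset.mem_sort (r := (· ≤ ·))).1 hmem)
  have : kthRoot q d k = z := by
    have h1 : kthRoot q d k = ⟨(ofLex (l.getD k (toLex (0, 0)))).1,
      (ofLex (l.getD k (toLex (0, 0)))).2⟩ := rfl
    rw [h1, List.getD_eq_getElem _ _ hlen, ← hzk]
    rfl
  rwa [this]

theorem exists_kthRoot_eq (q : ℕ → ℂ) (d : ℕ) {z : ℂ}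
    (hz : z ∈ (∑ j ∈ Finset.range (d + 1), C (q j) * X ^ j).roots) :
    ∃ k < (∑ j ∈ Finset.range (d + 1), C (q j) * X ^ j).roots.card, kthRoot q d k = z := by
  set p := ∑ j ∈ Finset.range (d + 1), C (q j) * X ^ j with hp
  set l := (p.roots.map fun z => (toLex (z.re, z.im) : ℝ ×ₗ ℝ)).sort (· ≤ ·) with hl
  have hmem : (toLex (z.re, z.im) : ℝ ×ₗ ℝ) ∈ l := by
    rw [hl, Multiset.mem_sort, Multiset.mem_map]
    exact ⟨z, hz, rfl⟩
  obtain ⟨k, hk, hkz⟩ := List.getElem_of_mem hmem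
  refine ⟨k, by rwa [hl, Multiset.length_sort, Multiset.card_map] at hk, ?_⟩
  have h1 : kthRoot q d k = ⟨(ofLex (l.getD k (toLex (0, 0)))).1,
      (ofLex (l.getD k (toLex (0, 0)))).2⟩ := rfl
  rw [h1, List.getD_eq_getElem _ _ hk, hkz]
  rfl

/-- The roots of `∏ i, (X ^ 2 - d i)` are real, and their squares run through all `d i`. -/
theorem kthRoot_spec {v : ℕ} {d : Fin v → ℝ} (hd : ∀ i, 0 ≤ d i) {q : ℕ → ℂ}
    (hq : ∑ j ∈ Finset.range (2 * v + 1), C (q j) * X ^ j = ∏ i, (X ^ 2 - C (d i : ℂ))) :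
    (∀ k < 2 * v, (kthRoot q (2 * v) k).im = 0) ∧
    ∀ i, ∃ k < 2 * v, kthRoot q (2 * v) k * kthRoot q (2 * v) k = d i := by
  have hmonic : ∀ i ∈ Finset.univ, (X ^ 2 - C (d i : ℂ)).Monic := fun i _ =>
    monic_X_pow_sub_C _ two_ne_zero
  have hne : ∏ i, (X ^ 2 - C (d i : ℂ)) ≠ 0 := (monic_prod_of_monic _ _ hmonic).ne_zero
  -- Over `ℂ` there are exactly `2 v` roots with multiplicity, so no index `k < 2 v` falls on the
  -- default value of `kthRoot`.
  have hcard : (∏ i, (X ^ 2 - C (d i : ℂ))).roots.card = 2 * v := by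
    rw [splits_iff_card_roots.1 (IsAlgClosed.splits _), natDegree_prod_of_monic _ _ hmonic]
    simp only [natDegree_X_pow_sub_C, Finset.sum_const, Finset.card_univ, Fintype.card_fin,
      smul_eq_mul]
    ring
  have hroot : ∀ z : ℂ, z ∈ (∏ i, (X ^ 2 - C (d i : ℂ))).roots ↔ ∃ i, z ^ 2 = d i := by
    intro z
    rw [mem_roots hne, IsRoot, eval_prod, Finset.prod_eq_zero_iff]
    simp [sub_eq_zero]
  constructor
  · intro k hk
    have h1 := kthRoot_mem_roots q (2 * v) k (by rw [hq, hcard]; exact hk)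
    rw [hq, hroot] at h1
    obtain ⟨i, hi⟩ := h1
    have h2 : (((√(d i) : ℝ) : ℂ)) ^ 2 = d i := by
      rw [← Complex.ofReal_pow, Real.sq_sqrt (hd i)]
    rw [← h2] at hi
    rcases sq_eq_sq_iff_eq_or_eq_neg.1 hi with h | h <;> simp [h]
  · intro i
    have h2 : (((√(d i) : ℝ) : ℂ)) ^ 2 = d i := by
      rw [← Complex.ofReal_pow, Real.sq_sqrt (hd i)]
    obtain ⟨k, hk, hkz⟩ := exists_kthRoot_eq q (2 * v) (z := ((√(d i) : ℝ) : ℂ)) (by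
      rw [hq, hroot]
      exact ⟨i, h2⟩)
    rw [hq, hcard] at hk
    exact ⟨k, hk, by rw [hkz, ← sq, h2]⟩

end Roots

/-! ### Interpolation of the inverse square root -/

section Interpolation

open Polynomial

/-- The factor of a Lagrange basis polynomial with nodes `r j ^ 2`, for node `k` and the possibly
equal node `i`. -/
noncomputable def lagrangeFactor (r : ℕ → ℂ) (k i : ℕ) : ℂ[X] :=
  if (r i * r i).re = (r k * r k).re then 1
  else (X - C (r i * r i)) * C ((r k * r k - r i * r i)⁻¹)

open Classical in
/-- The value at node `k`, divided by the multiplicity of the node among the first `m`. -/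
noncomputable def nodeWeight (r : ℕ → ℂ) (m k : ℕ) : ℂ :=
  (if 0 ≤ (r k).re then r k else 0 - r k)⁻¹ *
    (∑ l ∈ Finset.range m, if (r l * r l).re = (r k * r k).re then (1 : ℂ) else 0)⁻¹

/-- The interpolation polynomial of `x ↦ x ^ (-1/2)` at the nodes `r j ^ 2`, `j < m`. -/
noncomputable def invSqrtPoly (r : ℕ → ℂ) (m : ℕ) : ℂ[X] :=
  ∑ k ∈ Finset.range m,
    C (nodeWeight r m k) * ((List.range m).map (lagrangeFactor r k)).prod

/-- Nodes repeat, since both signs of a root and equal eigenvalues give the same square. At `μ`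
precisely the nodes equal to `μ` contribute, each with the same value divided by their number. The
nodes are real, so comparing real parts decides equality. -/
theorem eval_invSqrtPoly {r : ℕ → ℂ} {m : ℕ} (hr : ∀ k < m, (r k).im = 0) {μ : ℝ}
    (h : ∃ k < m, r k * r k = μ) : (invSqrtPoly r m).eval (μ : ℂ) = (((√μ)⁻¹ : ℝ) : ℂ) := by
  have hreal : ∀ k < m, r k * r k = (((r k * r k).re : ℝ) : ℂ) := fun k hk => by
    apply Complex.ext <;> simp [hr k hk]
  obtain ⟨j, hj, hjμ⟩ := h
  have hjμ' : (r j * r j).re = μ := by rw [hjμ, Complex.ofReal_re]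
  have hbasis : ∀ k < m, ((List.range m).map (lagrangeFactor r k)).prod.eval (μ : ℂ)
      = if (r k * r k).re = μ then 1 else 0 := by
    intro k hk
    rw [← coe_evalRingHom, map_list_prod, List.map_map]
    split
    · rename_i hkμ
      refine List.prod_eq_one fun z hz => ?_
      obtain ⟨i, hi, rfl⟩ := List.mem_map.1 hz
      have hi' := List.mem_range.1 hi
      simp only [Function.comp, coe_evalRingHom, lagrangeFactor]
      split
      · simp
      · rename_i hne
        have hk2 : r k * r k = μ := by rw [hreal k hk, hkμ]
        have : (μ : ℂ) - r i * r i ≠ 0 := by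
          rw [hreal i hi', sub_ne_zero]
          intro h
          exact hne (by rw [hkμ]; exact_mod_cast h.symm)
        rw [hk2]
        simp [this]
    · rename_i hkμ
      refine List.prod_eq_zero (List.mem_map.2 ⟨j, List.mem_range.2 hj, ?_⟩)
      simp only [Function.comp, coe_evalRingHom, lagrangeFactor]
      rw [if_neg (by rw [hjμ']; exact fun h => hkμ h.symm), hjμ]
      simp
  have hweight : ∀ k < m, (r k * r k).re = μ → nodeWeight r m k
      = (((√μ)⁻¹ : ℝ) : ℂ) *
        (∑ l ∈ Finset.range m, if (r l * r l).re = μ then (1 : ℂ) else 0)⁻¹ := by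
    intro k hk hkμ
    rw [nodeWeight, hkμ]
    congr 1
    have h1 : r k = (((r k).re : ℝ) : ℂ) := by apply Complex.ext <;> simp [hr k hk]
    have h2 : (r k).re * (r k).re = μ := by rw [← hkμ]; simp [hr k hk]
    -- The root may have either sign; the weight inverts its absolute value `√μ`. For `μ = 0` both
    -- sides are `0⁻¹ = 0`.
    rw [h1, Complex.ofReal_re, ← h2, Real.sqrt_mul_self_eq_abs]
    split
    · rename_i h3
      rw [abs_of_nonneg h3, Complex.ofReal_inv]
    · rename_i h3
      rw [abs_of_neg (not_le.1 h3), Complex.ofReal_inv, Complex.ofReal_neg, zero_sub]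
  rw [invSqrtPoly, eval_finsetSum]
  have hterm : ∀ k ∈ Finset.range m,
      (C (nodeWeight r m k) * ((List.range m).map (lagrangeFactor r k)).prod).eval (μ : ℂ)
      = (((√μ)⁻¹ : ℝ) : ℂ) *
        (∑ l ∈ Finset.range m, if (r l * r l).re = μ then (1 : ℂ) else 0)⁻¹
        * (if (r k * r k).re = μ then 1 else 0) := by
    intro k hk
    rw [eval_mul, eval_C, hbasis k (Finset.mem_range.1 hk)]
    split
    · rename_i hkμ
      rw [hweight k (Finset.mem_range.1 hk) hkμ]
    · simp
  rw [Finset.sum_congr rfl hterm, ← Finset.mul_sum, mul_assoc, inv_mul_cancel₀, mul_one]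
  rw [← Finset.sum_filter, Finset.sum_const, nsmul_eq_mul, mul_one, Nat.cast_ne_zero,
    Finset.card_ne_zero]
  exact ⟨j, Finset.mem_filter.2 ⟨Finset.mem_range.2 hj, hjμ'⟩⟩

/-- The interpolation polynomial computed from the traces of the powers of `t * s`. -/
theorem invSqrtOn_invSqrtPoly {v : ℕ} {s t : Matrix (Fin v) (Fin v) ℂ} (hs : s.PosSemidef)
    (ht : t.PosSemidef) {p coef r : ℕ → ℂ} (hp : ∀ j < v, p j = ((t * s) ^ (j + 1)).trace)
    (hcoef : ∀ z < 2 * v + 1, coef z = if z % 2 = 0 then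
      (newtonMat v p ^ v) (Fin.ofNat (v + 1) (v - z / 2)) 0 else 0)
    (hr : ∀ k < 2 * v, r k = kthRoot coef (2 * v) k) :
    InvSqrtOn (invSqrtPoly r (2 * v)) (t * s) := by
  obtain ⟨d, hd, hchar, htr⟩ := exists_eigenvalues_mul hs ht
  have hq : ∑ j ∈ Finset.range (2 * v + 1), C (coef j) * X ^ j = ∏ i, (X ^ 2 - C (d i : ℂ)) := by
    rw [← sum_signedEsymm_eq_prod]
    refine Finset.sum_congr rfl fun z hz => ?_
    rw [hcoef z (Finset.mem_range.1 hz)]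
    -- The coefficient of `X ^ z`, for even `z`, is the signed symmetric function of index `v - z /
    -- 2`. This is at most `v`, so `Fin.ofNat` does not wrap around.
    congr 3
    have hlt : v - z / 2 < v + 1 := by omega
    rw [newtonMat_pow (fun i => (d i : ℂ)) (fun j hj => by rw [hp j hj, htr]) v _
      (by simp [Nat.mod_eq_of_lt hlt])]
    simp [Nat.mod_eq_of_lt hlt]
  obtain ⟨h1, h2⟩ := kthRoot_spec hd hq
  intro μ _ hroot
  refine eval_invSqrtPoly (fun k hk => by rw [hr k hk]; exact h1 k hk) ?_
  rw [hchar, IsRoot, eval_prod, Finset.prod_eq_zero_iff] at hroot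
  obtain ⟨i, -, hi⟩ := hroot
  simp only [eval_sub, eval_X, eval_C, sub_eq_zero] at hi
  obtain ⟨k, hk, hki⟩ := h2 i
  exact ⟨k, hk, by rw [hr k hk, hki, hi]⟩

end Interpolation

/-! ### Building blocks of the rounding program -/

/-- The arrays that a program does not write to. -/
def Prog.keeps (i : ℕ) : Prog → Bool
  | .par _ _ arr _ _ => i != arr
  | .seq p q => p.keeps i && q.keeps i
  | .loop _ _ p => p.keeps i

theorem Prog.run_of_keeps {i : ℕ} (p : Prog) (hp : p.keeps i = true) (ν : ℕ → ℕ) (m : Memory) :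
    p.run ν m i = m i := by
  induction p generalizing ν m with
  | par x n arr off e =>
    funext j
    have : i ≠ arr := by simpa [keeps] using hp
    simp [run, this]
  | seq p q ihp ihq =>
    simp only [keeps, Bool.and_eq_true] at hp
    rw [run, ihq hp.2, ihp hp.1]
  | loop x n p ih =>
    have h : ∀ t : ℕ, (Nat.rec m (fun i m' => p.run (Function.update ν x i) m') t : Memory) i
        = m i := by
      intro t
      induction t with
      | zero => rfl
      | succ t iht => exact (ih hp _ _).trans iht
    exact h (n.eval ν)

/-- The `i`-th operator on `C ⊗ V` in an array. -/
def opAt {c v : ℕ} (q : ℕ → ℂ) (i : ℕ) : Op c v := fun x y => q (entry i x y)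

theorem opAt_eq_submatrix {c v : ℕ} (q : ℕ → ℂ) (i : ℕ) :
    (opAt q i : Op c v) = (matAt q (c * v) i).submatrix finProdFinEquiv finProdFinEquiv := rfl

theorem matAt_run_sumTensor (arr : ℕ) {D d L : NExpr} (e : SExpr) (hD : D.varsIn isDim = true)
    (hd : d.varsIn isDim = true) (hL : L.varsIn isDim = true) (ν : ℕ → ℕ) (m : Memory) {k w : ℕ}
    (hdk : d.eval ν = k) (hLw : L.eval ν = w) (hw : 0 < w) {i : ℕ} (hi : i < D.eval ν) :
    matAt ((sumTensor arr (.const 0) D d d L e).run ν m arr) k i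
      = fun x y : Fin k => ∑ l : Fin w, e.eval (tensorEnv ν i x y l) m := by
  subst hdk hLw
  funext x y
  have := (run_sumTensor arr (.const 0) e hD hd hd hL ν m hw).1 i hi x x.2 y y.2
  rw [← Fin.sum_univ_eq_sum_range (fun l => e.eval _ m)] at this
  rw [← this, matAt, NExpr.eval, zero_add]

theorem run_sumTensor_vec (arr : ℕ) {D L : NExpr} (e : SExpr) (hD : D.varsIn isDim = true)
    (hL : L.varsIn isDim = true) (ν : ℕ → ℕ) (m : Memory) {w : ℕ}
    (hLw : L.eval ν = w) (hw : 0 < w) {i : ℕ} (hi : i < D.eval ν) :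
    (sumTensor arr (.const 0) (.const 1) (.const 1) D L e).run ν m arr i
      = ∑ l ∈ Finset.range w, e.eval (tensorEnv ν 0 0 i l) m := by
  subst hLw
  rw [← (run_sumTensor arr (.const 0) (D₀ := .const 1) (D₁ := .const 1) e rfl rfl hD hL ν m hw).1 0
    Nat.zero_lt_one 0 Nat.zero_lt_one i hi]
  simp [NExpr.eval]

theorem matAt_run_prodTree (arr : ℕ) (harr : arr ≠ tmpArr) {K L d : NExpr}
    (hK : K.varsIn isDim = true) (hL : L.varsIn isDim = true) (hd : d.varsIn isDim = true)
    (ν : ℕ → ℕ) (m : Memory) {n w z : ℕ} (hKn : K.eval ν = n) (hLw : L.eval ν = w)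
    (hdz : d.eval ν = z) (hw : 0 < w) (hz : 0 < z) (g : ℕ → ℕ → Matrix (Fin z) (Fin z) ℂ)
    (hg : ∀ k < n, ∀ i < 2 * w, matAt (m arr) z (i * n + k) = if i < w then g k i else 1)
    {k : ℕ} (hk : k < n) :
    matAt ((prodTree arr K L d).run ν m arr) z k = ((List.range w).map (g k)).prod := by
  subst hKn hLw hdz
  exact (run_prodTree arr harr hK hL hd ν m hw hz g hg).1 k hk

/-- Entry `(x, y)` of the `i`-th matrix of size `d` in an array. -/
def SExpr.entry (arr : ℕ) (i x y d : NExpr) : SExpr :=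
  .read arr (.add (.mul (.add (.mul i d) x) d) y)

/-- The Kronecker delta. -/
def SExpr.delta (x y : NExpr) : SExpr :=
  .ifLE (.nat x) (.nat y) (.ifLE (.nat y) (.nat x) (.nat (.const 1)) (.nat (.const 0)))
    (.nat (.const 0))

theorem SExpr.eval_entry (arr : ℕ) (i x y d : NExpr) (ν : ℕ → ℕ) (m : Memory) :
    (SExpr.entry arr i x y d).eval ν m
      = m arr ((i.eval ν * d.eval ν + x.eval ν) * d.eval ν + y.eval ν) := rfl

theorem SExpr.eval_delta (x y : NExpr) (ν : ℕ → ℕ) (m : Memory) :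
    (SExpr.delta x y).eval ν m = if x.eval ν = y.eval ν then 1 else 0 := by
  simp only [delta, eval, NExpr.eval, Complex.natCast_re, Nat.cast_le, Nat.cast_one, Nat.cast_zero]
  split_ifs <;> first | rfl | omega

theorem delta_fin {d : ℕ} (x y : Fin d) :
    (if (x : ℕ) = y then (1 : ℂ) else 0) = (1 : Matrix (Fin d) (Fin d) ℂ) x y := by
  rw [Matrix.one_apply]
  exact if_congr Fin.ext_iff.symm rfl rfl

/-- The product of the matrices in two arrays. -/
def mulProg (arr A B : ℕ) (d : NExpr) : Prog :=
  sumTensor arr (.const 0) (.const 1) d d d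
    (.mul (.entry A (.const 0) (.var 11) (.var 13) d) (.entry B (.const 0) (.var 13) (.var 12) d))

/-- The product of a matrix with the adjoint of a matrix. -/
def mulAdjProg (arr A B : ℕ) (d : NExpr) : Prog :=
  sumTensor arr (.const 0) (.const 1) d d d
    (.mul (.entry A (.const 0) (.var 11) (.var 13) d)
      (.conj (.entry B (.const 0) (.var 12) (.var 13) d)))

theorem matAt_mulProg (arr A B : ℕ) {d : NExpr} (hd : d.varsIn isDim = true) (ν : ℕ → ℕ)
    (m : Memory) {k : ℕ} (hdk : d.eval ν = k) (hk : 0 < k) :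
    matAt ((mulProg arr A B d).run ν m arr) k 0 = matAt (m A) k 0 * matAt (m B) k 0 := by
  rw [mulProg, matAt_run_sumTensor arr _ rfl hd hd ν m hdk hdk hk Nat.zero_lt_one]
  ext x y
  have h : ∀ l, d.eval (tensorEnv ν 0 x y l) = k := fun l =>
    (NExpr.eval_dim (by simp [tensorEnv]) (by simp [tensorEnv]) hd).trans hdk
  simp [Matrix.mul_apply, SExpr.eval, SExpr.eval_entry, NExpr.eval, h, tensorEnv, matAt]

theorem matAt_mulAdjProg (arr A B : ℕ) {d : NExpr} (hd : d.varsIn isDim = true) (ν : ℕ → ℕ)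
    (m : Memory) {k : ℕ} (hdk : d.eval ν = k) (hk : 0 < k) :
    matAt ((mulAdjProg arr A B d).run ν m arr) k 0 = matAt (m A) k 0 * (matAt (m B) k 0)ᴴ := by
  rw [mulAdjProg, matAt_run_sumTensor arr _ rfl hd hd ν m hdk hdk hk Nat.zero_lt_one]
  ext x y
  have h : ∀ l, d.eval (tensorEnv ν 0 x y l) = k := fun l =>
    (NExpr.eval_dim (by simp [tensorEnv]) (by simp [tensorEnv]) hd).trans hdk
  simp [Matrix.mul_apply, SExpr.eval, SExpr.eval_entry, NExpr.eval, h, tensorEnv, matAt]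

/-- `dim (C ⊗ V)`. -/
def dimCV : NExpr := .mul (.var 2) (.var 3)

theorem opAt_mulProg (arr A B : ℕ) {ν : ℕ → ℕ} (m : Memory) {c v : ℕ} (h2 : ν 2 = c)
    (h3 : ν 3 = v) (hcv : 0 < c * v) :
    (opAt ((mulProg arr A B dimCV).run ν m arr) 0 : Op c v) = opAt (m A) 0 * opAt (m B) 0 := by
  simp only [opAt_eq_submatrix]
  rw [matAt_mulProg arr A B rfl ν m (by simp [dimCV, NExpr.eval, h2, h3]) hcv,
    Matrix.submatrix_mul_equiv]

theorem opAt_mulAdjProg (arr A B : ℕ) {ν : ℕ → ℕ} (m : Memory) {c v : ℕ} (h2 : ν 2 = c)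
    (h3 : ν 3 = v) (hcv : 0 < c * v) :
    (opAt ((mulAdjProg arr A B dimCV).run ν m arr) 0 : Op c v)
      = opAt (m A) 0 * (opAt (m B) 0)ᴴ := by
  simp only [opAt_eq_submatrix]
  rw [matAt_mulAdjProg arr A B rfl ν m (by simp [dimCV, NExpr.eval, h2, h3]) hcv,
    Matrix.conjTranspose_submatrix, Matrix.submatrix_mul_equiv]

/-- The partial trace over `C` of the `i`-th operator of an array. -/
def traceProg (arr A : ℕ) (i : NExpr) : Prog :=
  sumTensor arr (.const 0) (.const 1) (.var 3) (.var 3) (.var 2)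
    (.entry A i (.add (.mul (.var 13) (.var 3)) (.var 11))
      (.add (.mul (.var 13) (.var 3)) (.var 12)) dimCV)

theorem pos_mk {c v : ℕ} (k : Fin c) (i : Fin v) : pos (k, i) = k * v + i := by
  simp [pos, finProdFinEquiv, mul_comm, add_comm]

theorem pos_lt {c v : ℕ} (x : CV c v) : pos x < c * v := (finProdFinEquiv x).2

theorem pos_div {c v : ℕ} (x : CV c v) : pos x / v = x.1 := by
  have hv : 0 < v := x.2.pos
  obtain ⟨k, i⟩ := x
  rw [pos_mk, add_comm, Nat.add_mul_div_right _ _ hv, Nat.div_eq_of_lt i.2, zero_add]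

theorem pos_mod {c v : ℕ} (x : CV c v) : pos x % v = x.2 := by
  obtain ⟨k, i⟩ := x
  rw [pos_mk, mul_comm, Nat.mul_add_mod, Nat.mod_eq_of_lt i.2]

theorem pos_injective {c v : ℕ} : Function.Injective (pos : CV c v → ℕ) :=
  Fin.val_injective.comp finProdFinEquiv.injective

theorem matAt_traceProg (arr A : ℕ) {i : NExpr} {ν : ℕ → ℕ} (m : Memory) {c v k : ℕ} (h2 : ν 2 = c)
    (h3 : ν 3 = v) (hc : 0 < c) (hi : ∀ x y l, i.eval (tensorEnv ν 0 x y l) = k) :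
    matAt ((traceProg arr A i).run ν m arr) v 0 = trC (opAt (m A) k : Op c v) := by
  rw [traceProg, matAt_run_sumTensor arr (D := .const 1) (d := .var 3) (L := .var 2) _ rfl rfl rfl ν
    m h3 h2 hc Nat.zero_lt_one]
  ext x y
  simp only [SExpr.eval_entry, NExpr.eval, dimCV, hi, tensorEnv, trC, opAt, entry, pos_mk, h2, h3]

/-! ### The interpolated inverse square root -/

/-- All the powers arise at once as products of equally long lists, filled up with `1`. -/
theorem prod_map_ite_le {M : Type} [Monoid M] (x : M) {k n : ℕ} (hk : k < n) :
    ((List.range n).map fun i => if i ≤ k then x else 1).prod = x ^ (k + 1) := by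
  obtain ⟨r, rfl⟩ := Nat.exists_eq_add_of_lt hk
  rw [show k + r + 1 = (k + 1) + r by ring, List.range_add, List.map_append, List.prod_append,
    List.map_map, List.prod_eq_one (l := List.map _ (List.range r)), mul_one]
  · rw [List.map_congr_left (g := fun _ => x) fun i hi => if_pos (by
      have := List.mem_range.1 hi; omega)]
    simp
  · intro z hz
    obtain ⟨i, -, rfl⟩ := List.mem_map.1 hz
    have : ¬ k + 1 + i ≤ k := by omega
    simp [this]

/-- The powers of exponents `1, …, dim V` of the matrix in array `A`. -/
def powersProg (arr A : ℕ) : Prog :=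
  .seq (sumTensor arr (.const 0) (.mul (.mul (.const 2) (.var 3)) (.var 3)) (.var 3) (.var 3)
      (.const 1)
      -- Factor `i` of list `k` is the matrix if `i ≤ k` and the identity otherwise. As `k < dim V`,
      -- the same test produces the padding `i ≥ dim V`.
      (.ifLE (.nat (.div (.var 10) (.var 3))) (.nat (.mod (.var 10) (.var 3)))
        (.entry A (.const 0) (.var 11) (.var 12) (.var 3)) (.delta (.var 11) (.var 12))))
    (prodTree arr (.var 3) (.var 3) (.var 3))

theorem matAt_powersProg {arr A : ℕ} (harr : arr ≠ tmpArr) {ν : ℕ → ℕ} (m : Memory) {v k : ℕ}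
    (h3 : ν 3 = v) (hk : k < v) :
    matAt ((powersProg arr A).run ν m arr) v k = matAt (m A) v 0 ^ (k + 1) := by
  have hv : 0 < v := by omega
  rw [powersProg, Prog.run]
  refine (matAt_run_prodTree arr harr (K := .var 3) (L := .var 3) (d := .var 3) rfl rfl rfl ν _ h3 h3
    h3 hv hv (fun k i => if i ≤ k then matAt (m A) v 0 else 1) (fun k hk i hi => ?_) hk).trans
    (prod_map_ite_le _ hk)
  have hdiv : (i * v + k) / v = i := by
    rw [add_comm, Nat.add_mul_div_right _ _ hv, Nat.div_eq_of_lt hk, zero_add]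
  have hmod : (i * v + k) % v = k := by
    rw [mul_comm, Nat.mul_add_mod, Nat.mod_eq_of_lt hk]
  rw [matAt_run_sumTensor arr (d := .var 3) (L := .const 1) (w := 1) _ rfl rfl rfl ν m h3 rfl Nat.zero_lt_one
    (by simp only [NExpr.eval, h3]; nlinarith)]
  have key : (if i < v then (if i ≤ k then matAt (m A) v 0 else 1) else 1)
      = (if i ≤ k then matAt (m A) v 0 else 1) := by
    split_ifs <;> first | rfl | omega
  rw [key]
  ext x y
  simp only [SExpr.eval, SExpr.eval_entry, SExpr.eval_delta, NExpr.eval, tensorEnv, h3, hdiv, hmod,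
    Finset.univ_unique, Finset.sum_singleton, Complex.natCast_re, Nat.cast_le, delta_fin]
  split_ifs <;> rfl

/-- The matrix of Newton's recursion for the power sums in array `P`, to the power `dim V`. -/
def newtonProg (arr P : ℕ) : Prog :=
  .seq (sumTensor arr (.const 0) (.mul (.const 2) (.var 3)) (.add (.var 3) (.const 1))
      (.add (.var 3) (.const 1)) (.const 1)
      (.ifLE (.nat (.add (.var 10) (.const 1))) (.nat (.var 3))
        (.ifLE (.nat (.var 11)) (.nat (.const 0))
          (.ifLE (.nat (.var 12)) (.nat (.const 0)) (.nat (.const 1)) (.nat (.const 0)))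
          (.ifLE (.nat (.add (.var 12) (.const 1))) (.nat (.var 11))
            (.mul (.sub (.nat (.const 0))
              (.read P (.sub (.sub (.var 11) (.var 12)) (.const 1)))) (.inv (.nat (.var 11))))
            (.nat (.const 0))))
        (.delta (.var 11) (.var 12))))
    (prodTree arr (.const 1) (.var 3) (.add (.var 3) (.const 1)))

theorem matAt_newtonProg {arr P : ℕ} (harr : arr ≠ tmpArr) {ν : ℕ → ℕ} (m : Memory) {v : ℕ}
    (h3 : ν 3 = v) (hv : 0 < v) :
    matAt ((newtonProg arr P).run ν m arr) (v + 1) 0 = newtonMat v (m P) ^ v := by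
  have h3' : NExpr.eval ν (.add (.var 3) (.const 1)) = v + 1 := congrArg (· + 1) h3
  rw [newtonProg, Prog.run]
  refine (matAt_run_prodTree arr harr (K := .const 1) (n := 1) (L := .var 3) (d := .add (.var 3) (.const 1))
    rfl rfl rfl ν _ rfl h3 h3' hv (Nat.succ_pos _) (fun _ _ => newtonMat v (m P))
    (fun k hk i hi => ?_) Nat.zero_lt_one).trans ?_
  · obtain rfl : k = 0 := by omega
    rw [mul_one, add_zero, matAt_run_sumTensor arr (L := .const 1) (w := 1) _ rfl rfl rfl ν m h3' rfl
      Nat.zero_lt_one (by simpa only [NExpr.eval, h3] using hi)]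
    ext x y
    simp only [SExpr.eval, SExpr.eval_delta, NExpr.eval, tensorEnv, h3,
      Finset.univ_unique, Finset.sum_singleton, Complex.natCast_re, Nat.cast_le, delta_fin,
      Nat.succ_le_iff, Nat.cast_zero, Nat.cast_one]
    split_ifs <;> simp_all [newtonMat]
  · simp

/-- The matrix factors of the Lagrange basis polynomials for the nodes in array `r`, evaluated at
the matrix in array `A`, and their products. -/
def lagrangeProg (arr A r : ℕ) : Prog :=
  let m : NExpr := .mul (.const 2) (.var 3)
  let i : NExpr := .div (.var 10) m
  let k : NExpr := .mod (.var 10) m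
  let x : SExpr := .mul (.read r i) (.read r i)
  let y : SExpr := .mul (.read r k) (.read r k)
  let f : SExpr := .mul (.sub (.entry A (.const 0) (.var 11) (.var 12) (.var 3))
    (.mul x (.delta (.var 11) (.var 12)))) (.inv (.sub y x))
  let d : SExpr := .delta (.var 11) (.var 12)
  .seq (sumTensor arr (.const 0) (.mul (.mul (.const 2) m) m) (.var 3) (.var 3) (.const 1)
      -- Factors `i ≥ m` are padding; equality of the real nodes is tested by two comparisons.
      (.ifLE (.nat (.add i (.const 1))) (.nat m) (.ifLE x y (.ifLE y x d f) f) d))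
    (prodTree arr m m (.var 3))

theorem aeval_lagrangeFactor {d : ℕ} (M : Matrix (Fin d) (Fin d) ℂ) (r : ℕ → ℂ) (k i : ℕ) :
    Polynomial.aeval M (lagrangeFactor r k i) = if (r i * r i).re = (r k * r k).re then 1 else
      (r k * r k - r i * r i)⁻¹ • (M - (r i * r i) • (1 : Matrix (Fin d) (Fin d) ℂ)) := by
  rw [lagrangeFactor]
  split
  · simp
  · rw [map_mul, map_sub, Polynomial.aeval_X, Polynomial.aeval_C, Polynomial.aeval_C,
      Algebra.algebraMap_eq_smul_one, Algebra.algebraMap_eq_smul_one, Matrix.mul_smul,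
      Matrix.mul_one]

theorem matAt_lagrangeProg {arr A r : ℕ} (harr : arr ≠ tmpArr) {ν : ℕ → ℕ} (m : Memory) {v k : ℕ}
    (h3 : ν 3 = v) (hk : k < 2 * v) :
    matAt ((lagrangeProg arr A r).run ν m arr) v k = Polynomial.aeval (matAt (m A) v 0)
      ((List.range (2 * v)).map (lagrangeFactor (m r) k)).prod := by
  have hv : 0 < v := by omega
  have h3' : NExpr.eval ν (.mul (.const 2) (.var 3)) = 2 * v := congrArg (2 * ·) h3
  rw [lagrangeProg, Prog.run, map_list_prod, List.map_map]
  refine matAt_run_prodTree arr harr (K := .mul (.const 2) (.var 3)) (L := .mul (.const 2) (.var 3))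
    (d := .var 3) rfl rfl rfl ν _ h3' h3' h3 (by omega) hv
    (fun k i => Polynomial.aeval (matAt (m A) v 0) (lagrangeFactor (m r) k i))
    (fun k hk i hi => ?_) hk
  have hdiv : (i * (2 * v) + k) / (2 * v) = i := by
    rw [add_comm, Nat.add_mul_div_right _ _ (by omega), Nat.div_eq_of_lt hk, zero_add]
  have hmod : (i * (2 * v) + k) % (2 * v) = k := by
    rw [mul_comm, Nat.mul_add_mod, Nat.mod_eq_of_lt hk]
  rw [matAt_run_sumTensor arr (d := .var 3) (L := .const 1) (w := 1) _ rfl rfl rfl ν m h3 rfl Nat.zero_lt_one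
    (by simp only [NExpr.eval, h3]; nlinarith)]
  simp only [aeval_lagrangeFactor]
  ext x y
  simp only [SExpr.eval, SExpr.eval_entry, SExpr.eval_delta, NExpr.eval, tensorEnv, h3, hdiv, hmod,
    Finset.univ_unique, Finset.sum_singleton, Complex.natCast_re, Nat.cast_le, delta_fin,
    Nat.succ_le_iff]
  split_ifs with h1 h2 h3 h4 h4 h4
  · rfl
  · exact absurd (le_antisymm h2 h3) h4
  · exact absurd h4.ge h3
  · simp [Matrix.smul_apply, Matrix.sub_apply, matAt, mul_comm]
  · exact absurd h4.le h2
  · simp [Matrix.smul_apply, Matrix.sub_apply, matAt, mul_comm]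
  · rfl

/-- The value of the interpolation polynomial of the inverse square root, at the matrix in
array `11`. -/
def invSqrtProg : Prog :=
  let m : NExpr := .mul (.const 2) (.var 3)
  let rl : SExpr := .read 16 (.var 13)
  let ry : SExpr := .read 16 (.var 12)
  -- Arrays: `12` powers, `13` their traces, `14` Newton's matrix power, `15` coefficients of `∏ (X²
  -- - d_i)`, `16` its roots, `18` multiplicities of the nodes, `17` weights, `19` Lagrange
  -- products, `20` the result. The roots are extracted in degree `2 dim V`.
  .seq (powersProg 12 11) <|
  .seq (sumTensor 13 (.const 0) (.const 1) (.const 1) (.var 3) (.var 3)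
    (.entry 12 (.var 12) (.var 13) (.var 13) (.var 3))) <|
  .seq (newtonProg 14 13) <|
  .seq (sumTensor 15 (.const 0) (.const 1) (.const 1) (.add m (.const 1)) (.const 1)
    (.ifLE (.nat (.mod (.var 12) (.const 2))) (.nat (.const 0))
      (.entry 14 (.const 0) (.sub (.var 3) (.div (.var 12) (.const 2))) (.const 0)
        (.add (.var 3) (.const 1))) (.nat (.const 0)))) <|
  .seq (sumTensor 16 (.const 0) (.const 1) (.const 1) m (.const 1)
    (.root 15 (.const 0) m (.var 12))) <|
  .seq (sumTensor 18 (.const 0) (.const 1) (.const 1) m m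
    (.ifLE (.mul rl rl) (.mul ry ry) (.ifLE (.mul ry ry) (.mul rl rl) (.nat (.const 1))
      (.nat (.const 0))) (.nat (.const 0)))) <|
  .seq (sumTensor 17 (.const 0) (.const 1) (.const 1) m (.const 1)
    (.mul (.inv (.ifLE (.nat (.const 0)) ry ry (.sub (.nat (.const 0)) ry)))
      (.inv (.read 18 (.var 12))))) <|
  .seq (lagrangeProg 19 11 16)
  (sumTensor 20 (.const 0) (.const 1) (.var 3) (.var 3) m
    (.mul (.read 17 (.var 13)) (.entry 19 (.var 13) (.var 11) (.var 12) (.var 3))))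

theorem matAt_invSqrtProg {ν : ℕ → ℕ} (mem : Memory) {v : ℕ} (h3 : ν 3 = v) (hv : 0 < v)
    {s t : Matrix (Fin v) (Fin v) ℂ} (hs : s.PosSemidef) (ht : t.PosSemidef)
    (h11 : matAt (mem 11) v 0 = t * s) : ∃ q, InvSqrtOn q (t * s) ∧
      matAt (invSqrtProg.run ν mem 20) v 0 = Polynomial.aeval (t * s) q := by
  have h3' : NExpr.eval ν (.mul (.const 2) (.var 3)) = 2 * v := congrArg (2 * ·) h3
  have h3'' : NExpr.eval ν (.add (.mul (.const 2) (.var 3)) (.const 1)) = 2 * v + 1 :=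
    congrArg (2 * · + 1) h3
  unfold invSqrtProg
  simp only [Prog.run]
  -- powers and their traces
  set m₁ := (powersProg 12 11).run ν mem with hm₁
  have k₁ : ∀ i, (powersProg 12 11).keeps i = true → m₁ i = mem i := fun i hi =>
    Prog.run_of_keeps _ hi _ _
  have s₁ : ∀ k < v, matAt (m₁ 12) v k = (t * s) ^ (k + 1) := fun k hk => by
    rw [hm₁, matAt_powersProg (by decide) _ h3 hk, h11]
  clear_value m₁
  generalize hp₂ : sumTensor 13 (.const 0) (.const 1) (.const 1) (.var 3) (.var 3)
    (.entry 12 (.var 12) (.var 13) (.var 13) (.var 3)) = p₂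
  set m₂ := p₂.run ν m₁ with hm₂
  have k₂ : ∀ i, p₂.keeps i = true → m₂ i = m₁ i := fun i hi => Prog.run_of_keeps _ hi _ _
  have s₂ : ∀ k < v, m₂ 13 k = ((t * s) ^ (k + 1)).trace := fun k hk => by
    rw [hm₂, ← hp₂, run_sumTensor_vec 13 (D := .var 3) (L := .var 3) (w := v) _ rfl rfl ν _ h3 hv
      (by simpa only [NExpr.eval, h3] using hk), ← s₁ k hk, Matrix.trace,
      ← Fin.sum_univ_eq_sum_range (fun l => SExpr.eval (tensorEnv ν 0 0 k l) m₁ _)]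
    simp [SExpr.eval_entry, NExpr.eval, tensorEnv, h3, matAt]
  clear_value m₂
  -- coefficients and roots
  set m₃ := (newtonProg 14 13).run ν m₂ with hm₃
  have k₃ : ∀ i, (newtonProg 14 13).keeps i = true → m₃ i = m₂ i := fun i hi =>
    Prog.run_of_keeps _ hi _ _
  have s₃ : matAt (m₃ 14) (v + 1) 0 = newtonMat v (m₂ 13) ^ v := by
    rw [hm₃, matAt_newtonProg (by decide) _ h3 hv]
  clear_value m₃
  generalize hp₄ : sumTensor 15 (.const 0) (.const 1) (.const 1)
    (.add (.mul (.const 2) (.var 3)) (.const 1)) (.const 1)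
    (.ifLE (.nat (.mod (.var 12) (.const 2))) (.nat (.const 0))
      (.entry 14 (.const 0) (.sub (.var 3) (.div (.var 12) (.const 2))) (.const 0)
        (.add (.var 3) (.const 1))) (.nat (.const 0))) = p₄
  set m₄ := p₄.run ν m₃ with hm₄
  have k₄ : ∀ i, p₄.keeps i = true → m₄ i = m₃ i := fun i hi => Prog.run_of_keeps _ hi _ _
  have s₄ : ∀ z < 2 * v + 1, m₄ 15 z = if z % 2 = 0 then
      (newtonMat v (m₂ 13) ^ v) (Fin.ofNat (v + 1) (v - z / 2)) 0 else 0 := fun z hz => by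
    rw [hm₄, ← hp₄, run_sumTensor_vec 15 (L := .const 1) (w := 1) _ rfl rfl ν _ rfl
      Nat.zero_lt_one (by rwa [h3'']), ← s₃]
    have hlt : v - z / 2 < v + 1 := by omega
    simp [SExpr.eval, SExpr.eval_entry, NExpr.eval, tensorEnv, h3, matAt, Nat.mod_eq_of_lt hlt]
  clear_value m₄
  generalize hp₅ : sumTensor 16 (.const 0) (.const 1) (.const 1) (.mul (.const 2) (.var 3))
    (.const 1) (.root 15 (.const 0) (.mul (.const 2) (.var 3)) (.var 12)) = p₅
  set m₅ := p₅.run ν m₄ with hm₅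
  have k₅ : ∀ i, p₅.keeps i = true → m₅ i = m₄ i := fun i hi => Prog.run_of_keeps _ hi _ _
  have s₅ : ∀ k < 2 * v, m₅ 16 k = kthRoot (m₄ 15) (2 * v) k := fun k hk => by
    rw [hm₅, ← hp₅, run_sumTensor_vec 16 (L := .const 1) (w := 1) _ rfl rfl ν _ rfl
      Nat.zero_lt_one (by rwa [h3'])]
    simp [SExpr.eval, NExpr.eval, tensorEnv, h3]
  clear_value m₅
  have hq := invSqrtOn_invSqrtPoly hs ht s₂ s₄ s₅
  refine ⟨_, hq, ?_⟩
  -- interpolation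
  generalize hp₆ : sumTensor 18 _ _ _ _ _ _ = p₆
  set m₆ := p₆.run ν m₅ with hm₆
  have k₆ : ∀ i, p₆.keeps i = true → m₆ i = m₅ i := fun i hi => Prog.run_of_keeps _ hi _ _
  have s₆ : ∀ k < 2 * v, m₆ 18 k = ∑ l ∈ Finset.range (2 * v),
      if (m₅ 16 l * m₅ 16 l).re = (m₅ 16 k * m₅ 16 k).re then (1 : ℂ) else 0 := fun k hk => by
    rw [hm₆, ← hp₆, run_sumTensor_vec 18 (w := 2 * v) _ rfl rfl ν _ h3' (by omega) (by rwa [h3'])]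
    refine Finset.sum_congr rfl fun l _ => ?_
    simp only [SExpr.eval, NExpr.eval, tensorEnv, Nat.cast_one, Nat.cast_zero]
    split_ifs with h1 h2 h4 h4 h4
    · rfl
    · exact absurd (le_antisymm h1 h2) h4
    · exact absurd h4.ge h2
    · rfl
    · exact absurd h4.le h1
    · rfl
  clear_value m₆
  generalize hp₇ : sumTensor 17 _ _ _ _ _ _ = p₇
  set m₇ := p₇.run ν m₆ with hm₇
  have k₇ : ∀ i, p₇.keeps i = true → m₇ i = m₆ i := fun i hi => Prog.run_of_keeps _ hi _ _
  have s₇ : ∀ k < 2 * v, m₇ 17 k = nodeWeight (m₅ 16) (2 * v) k := fun k hk => by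
    rw [hm₇, ← hp₇, run_sumTensor_vec 17 (L := .const 1) (w := 1) _ rfl rfl ν _ rfl
      Nat.zero_lt_one (by rwa [h3']), nodeWeight, ← s₆ k hk]
    have : m₆ 16 = m₅ 16 := k₆ 16 (by rw [← hp₆]; rfl)
    simp [SExpr.eval, NExpr.eval, tensorEnv, this]
  clear_value m₇
  have e₇ : m₇ 11 = mem 11 ∧ m₇ 16 = m₅ 16 := by
    subst hp₂ hp₄ hp₅ hp₆ hp₇
    constructor
    · rw [k₇ 11 rfl, k₆ 11 rfl, k₅ 11 rfl, k₄ 11 rfl, k₃ 11 rfl, k₂ 11 rfl, k₁ 11 rfl]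
    · rw [k₇ 16 rfl, k₆ 16 rfl]
  set m₈ := (lagrangeProg 19 11 16).run ν m₇ with hm₈
  have e₈ : m₈ 17 = m₇ 17 := Prog.run_of_keeps _ rfl _ _
  have s₈ : ∀ k < 2 * v, matAt (m₈ 19) v k = Polynomial.aeval (t * s)
      ((List.range (2 * v)).map (lagrangeFactor (m₅ 16) k)).prod := fun k hk => by
    rw [hm₈, matAt_lagrangeProg (by decide) _ h3 hk, e₇.1, e₇.2, h11]
  clear_value m₈
  rw [matAt_run_sumTensor 20 (D := .const 1) (d := .var 3) (k := v) (w := 2 * v) _ rfl rfl rfl ν _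
    h3 h3' (by omega) Nat.zero_lt_one, invSqrtPoly, map_sum, ← Fin.sum_univ_eq_sum_range
      (fun k => Polynomial.aeval (t * s) (Polynomial.C (nodeWeight (m₅ 16) (2 * v) k)
        * ((List.range (2 * v)).map (lagrangeFactor (m₅ 16) k)).prod))]
  ext x y
  rw [Matrix.sum_apply]
  refine Finset.sum_congr rfl fun k _ => ?_
  rw [map_mul, ← s₈ k k.2, Polynomial.aeval_C, Algebra.algebraMap_eq_smul_one, smul_one_mul,
    Matrix.smul_apply, ← s₇ k k.2, ← e₈]
  simp [SExpr.eval, SExpr.eval_entry, NExpr.eval, tensorEnv, h3, matAt]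

/-! ### The rounding program -/

theorem opAt_run_sumTensor (arr : ℕ) {L : NExpr} (e : SExpr) (hL : L.varsIn isDim = true)
    {ν : ℕ → ℕ} (m : Memory) {c v w : ℕ} (h2 : ν 2 = c) (h3 : ν 3 = v) (hLw : L.eval ν = w)
    (hw : 0 < w) :
    (opAt ((sumTensor arr (.const 0) (.const 1) dimCV dimCV L e).run ν m arr) 0 : Op c v)
      = fun x y => ∑ l : Fin w, e.eval (tensorEnv ν 0 (pos x) (pos y) l) m := by
  rw [opAt_eq_submatrix, matAt_run_sumTensor arr (D := .const 1) (d := dimCV) e rfl rfl hL ν m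
    (by simp [dimCV, NExpr.eval, h2, h3]) hLw hw Nat.zero_lt_one]
  rfl

/-- The marginals on `V` of `V_i ρ'_i V_i*` and of `ρ_{i+1}`, into the arrays `9` and `10`, and
their product, where `ρ'_i` is in array `5` and `i` in variable `4`. -/
def marginalsProg : Prog :=
  .seq (sumTensor 6 (.const 0) (.const 1) dimCV dimCV (.const 1)
    -- `V_0 = I` is not part of the input, and `V_i` is stored at position `i - 1`.
    (.ifLE (.nat (.var 4)) (.nat (.const 0)) (.delta (.var 11) (.var 12))
      (.entry 1 (.sub (.var 4) (.const 1)) (.var 11) (.var 12) dimCV))) <|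
  .seq (mulProg 7 6 5 dimCV) <|
  .seq (mulAdjProg 8 7 6 dimCV) <|
  .seq (traceProg 9 8 (.const 0)) <|
  .seq (traceProg 10 3 (.var 4)) (mulProg 11 10 9 (.var 3))

theorem marginalsProg_spec {ν : ℕ → ℕ} (m : Memory) {c v i : ℕ} (h2 : ν 2 = c) (h3 : ν 3 = v)
    (h4 : ν 4 = i) (hc : 0 < c) (hv : 0 < v) {W ρ' ρ : Op c v} (h5 : opAt (m 5) 0 = ρ')
    (hρ : opAt (m 3) i = ρ) (hW₀ : i = 0 → W = 1) (hW : 0 < i → opAt (m 1) (i - 1) = W) :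
    matAt (marginalsProg.run ν m 9) v 0 = trC (W * ρ' * Wᴴ) ∧
    matAt (marginalsProg.run ν m 10) v 0 = trC ρ ∧
    matAt (marginalsProg.run ν m 11) v 0 = trC ρ * trC (W * ρ' * Wᴴ) := by
  have hcv : 0 < c * v := Nat.mul_pos hc hv
  have hn : dimCV.eval ν = c * v := by simp [dimCV, NExpr.eval, h2, h3]
  unfold marginalsProg
  simp only [Prog.run]
  generalize hp₁ : sumTensor 6 _ _ _ _ _ _ = p₁
  set m₁ := p₁.run ν m with hm₁
  have k₁ : ∀ j, p₁.keeps j = true → m₁ j = m j := fun j hj => Prog.run_of_keeps _ hj _ _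
  have s₁ : opAt (m₁ 6) 0 = W := by
    rw [hm₁, ← hp₁, opAt_run_sumTensor 6 (L := .const 1) (w := 1) _ rfl _ h2 h3 rfl Nat.zero_lt_one]
    ext x y
    simp only [Finset.univ_unique, Finset.sum_singleton, SExpr.eval,
      SExpr.eval_entry, SExpr.eval_delta, NExpr.eval, tensorEnv, dimCV, h2, h3, h4,
      Complex.natCast_re, Nat.cast_le, Nat.le_zero]
    split
    · rename_i h
      rw [hW₀ h, Matrix.one_apply]
      exact if_congr pos_injective.eq_iff rfl rfl
    · rename_i h
      rw [← hW (Nat.pos_of_ne_zero h)]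
      rfl
  have e₁ : m₁ 5 = m 5 ∧ m₁ 3 = m 3 := by
    subst hp₁
    exact ⟨k₁ 5 rfl, k₁ 3 rfl⟩
  clear_value m₁
  set m₂ := (mulProg 7 6 5 dimCV).run ν m₁ with hm₂
  have s₂ : opAt (m₂ 7) 0 = W * ρ' := by
    rw [hm₂, opAt_mulProg 7 6 5 _ h2 h3 hcv, s₁, e₁.1, h5]
  have e₂ : m₂ 6 = m₁ 6 ∧ m₂ 3 = m₁ 3 :=
    ⟨Prog.run_of_keeps _ rfl _ _, Prog.run_of_keeps _ rfl _ _⟩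
  clear_value m₂
  set m₃ := (mulAdjProg 8 7 6 dimCV).run ν m₂ with hm₃
  have s₃ : opAt (m₃ 8) 0 = W * ρ' * Wᴴ := by
    rw [hm₃, opAt_mulAdjProg 8 7 6 _ h2 h3 hcv, s₂, e₂.1, s₁]
  have e₃ : m₃ 3 = m₂ 3 := Prog.run_of_keeps _ rfl _ _
  clear_value m₃
  set m₄ := (traceProg 9 8 (.const 0)).run ν m₃ with hm₄
  have s₄ : matAt (m₄ 9) v 0 = trC (W * ρ' * Wᴴ) := by
    rw [hm₄, matAt_traceProg 9 8 _ h2 h3 hc fun _ _ _ => rfl, s₃]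
  have e₄ : m₄ 3 = m₃ 3 := Prog.run_of_keeps _ rfl _ _
  clear_value m₄
  set m₅ := (traceProg 10 3 (.var 4)).run ν m₄ with hm₅
  have s₅ : matAt (m₅ 10) v 0 = trC ρ := by
    rw [hm₅, matAt_traceProg 10 3 (k := i) _ h2 h3 hc fun _ _ _ => by
      simpa only [NExpr.eval, tensorEnv] using h4, e₄, e₃, e₂.2, e₁.2, hρ]
  have e₅ : m₅ 9 = m₄ 9 := Prog.run_of_keeps _ rfl _ _
  clear_value m₅
  have k₆ : ∀ j, (mulProg 11 10 9 (.var 3)).keeps j = true →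
      (mulProg 11 10 9 (.var 3)).run ν m₅ j = m₅ j := fun j hj => Prog.run_of_keeps _ hj _ _
  refine ⟨?_, ?_, ?_⟩
  · rw [k₆ 9 rfl, e₅, s₄]
  · rw [k₆ 10 rfl, s₅]
  · rw [matAt_mulProg 11 10 9 (d := .var 3) rfl ν _ h3 hv, s₅, e₅, s₄]

/-- The corrected state, from its marginal in array `9`, the marginal of `ρ_{i+1}` in array `10`
and the polynomial in array `20`. It goes to array `5` and to position `i` of array `4`. -/
def correctionProg : Prog :=
  .seq (mulProg 21 9 20 (.var 3)) <|
  .seq (mulProg 22 21 10 (.var 3)) <|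
  .seq (mulAdjProg 23 22 21 (.var 3)) <|
  -- A position divided by `dim V` gives the index in `C`, with the index in `V` as remainder. Since
  -- `1 ⊗ T` preserves the index in `C`, only the one in `V` is summed.
  .seq (sumTensor 24 (.const 0) (.const 1) dimCV dimCV (.var 3)
    (.mul (.entry 21 (.const 0) (.mod (.var 11) (.var 3)) (.var 13) (.var 3))
      (.entry 3 (.var 4) (.add (.mul (.div (.var 11) (.var 3)) (.var 3)) (.var 13)) (.var 12)
        dimCV))) <|
  .seq (sumTensor 25 (.const 0) (.const 1) dimCV dimCV (.var 3)
    (.mul (.entry 24 (.const 0) (.var 11)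
        (.add (.mul (.div (.var 12) (.var 3)) (.var 3)) (.var 13)) dimCV)
      (.conj (.entry 21 (.const 0) (.mod (.var 12) (.var 3)) (.var 13) (.var 3))))) <|
  .seq (sumTensor 5 (.const 0) (.const 1) dimCV dimCV (.const 1)
    (.add (.entry 25 (.const 0) (.var 11) (.var 12) dimCV)
      (.ifLE (.nat (.div (.var 11) (.var 3))) (.nat (.const 0))
        (.ifLE (.nat (.div (.var 12) (.var 3))) (.nat (.const 0))
          (.sub
            (.entry 9 (.const 0) (.mod (.var 11) (.var 3)) (.mod (.var 12) (.var 3)) (.var 3))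
            (.entry 23 (.const 0) (.mod (.var 11) (.var 3)) (.mod (.var 12) (.var 3)) (.var 3)))
          (.nat (.const 0))) (.nat (.const 0)))))
  (sumTensor 4 (.mul (.var 4) (.mul dimCV dimCV)) (.const 1) dimCV dimCV (.const 1)
    (.entry 5 (.const 0) (.var 11) (.var 12) dimCV))

theorem onV_mul_apply {c v : ℕ} (T : Matrix (Fin v) (Fin v) ℂ) (M : Op c v) (x y : CV c v) :
    ((onV T : Op c v) * M : Op c v) x y = ∑ l, T x.2 l * M (x.1, l) y := by
  rw [Matrix.mul_apply, Fintype.sum_prod_type, Finset.sum_eq_single x.1]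
  · simp [onV, Matrix.kroneckerMap_apply]
  · intro k _ hk
    simp [onV, Matrix.kroneckerMap_apply, Matrix.one_apply_ne hk.symm]
  · simp

theorem mul_conjTranspose_onV_apply {c v : ℕ} (T : Matrix (Fin v) (Fin v) ℂ) (M : Op c v)
    (x y : CV c v) : (M * (onV T : Op c v)ᴴ : Op c v) x y = ∑ l, M x (y.1, l) * star (T y.2 l) := by
  rw [Matrix.mul_apply, Fintype.sum_prod_type, Finset.sum_eq_single y.1]
  · simp [onV, Matrix.kroneckerMap_apply]
  · intro k _ hk
    simp [onV, Matrix.kroneckerMap_apply, Matrix.one_apply_ne hk.symm]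
  · simp

theorem corner_apply {c v : ℕ} (M : Matrix (Fin v) (Fin v) ℂ) (x y : CV c v) :
    (corner M : Op c v) x y = if (x.1 : ℕ) = 0 then if (y.1 : ℕ) = 0 then M x.2 y.2 else 0
      else 0 := by
  rw [corner, Matrix.kroneckerMap_apply, Matrix.diagonal_apply]
  split_ifs with h1 h2 h3 h3 h4
  · rw [one_mul]
  · exact absurd (h1 ▸ h2) h3
  · rw [zero_mul]
  · exact absurd (Fin.ext (h3.trans h4.symm)) h1
  · rw [zero_mul]
  · rw [zero_mul]

theorem correctionProg_spec {ν : ℕ → ℕ} (m : Memory) {c v i : ℕ} (h2 : ν 2 = c) (h3 : ν 3 = v)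
    (h4 : ν 4 = i) (hc : 0 < c) (hv : 0 < v) {ρ : Op c v} {s q : Matrix (Fin v) (Fin v) ℂ}
    (hρ : opAt (m 3) i = ρ) (h9 : matAt (m 9) v 0 = s) (h10 : matAt (m 10) v 0 = trC ρ)
    (h20 : matAt (m 20) v 0 = q) :
    opAt (correctionProg.run ν m 5) 0 = roundStep s (s * q) ρ ∧
    opAt (correctionProg.run ν m 4) i = roundStep s (s * q) ρ ∧
    ∀ j < i, (opAt (correctionProg.run ν m 4) j : Op c v) = opAt (m 4) j := by
  have hcv : 0 < c * v := Nat.mul_pos hc hv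
  have hn : ∀ ν' : ℕ → ℕ, ν' 2 = c → ν' 3 = v → dimCV.eval ν' = c * v := fun ν' h2 h3 => by
    simp [dimCV, NExpr.eval, h2, h3]
  unfold correctionProg
  simp only [Prog.run]
  set m₁ := (mulProg 21 9 20 (.var 3)).run ν m with hm₁
  have k₁ : ∀ j, (mulProg 21 9 20 (.var 3)).keeps j = true → m₁ j = m j := fun j hj =>
    Prog.run_of_keeps _ hj _ _
  have s₁ : matAt (m₁ 21) v 0 = s * q := by
    rw [hm₁, matAt_mulProg 21 9 20 (d := .var 3) rfl ν _ h3 hv, h9, h20]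
  clear_value m₁
  set m₂ := (mulProg 22 21 10 (.var 3)).run ν m₁ with hm₂
  have k₂ : ∀ j, (mulProg 22 21 10 (.var 3)).keeps j = true → m₂ j = m₁ j := fun j hj =>
    Prog.run_of_keeps _ hj _ _
  have s₂ : matAt (m₂ 22) v 0 = s * q * trC ρ := by
    rw [hm₂, matAt_mulProg 22 21 10 (d := .var 3) rfl ν _ h3 hv, s₁, k₁ 10 rfl, h10]
  clear_value m₂
  set m₃ := (mulAdjProg 23 22 21 (.var 3)).run ν m₂ with hm₃
  have k₃ : ∀ j, (mulAdjProg 23 22 21 (.var 3)).keeps j = true → m₃ j = m₂ j := fun j hj =>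
    Prog.run_of_keeps _ hj _ _
  have s₃ : matAt (m₃ 23) v 0 = s * q * trC ρ * (s * q)ᴴ := by
    rw [hm₃, matAt_mulAdjProg 23 22 21 (d := .var 3) rfl ν _ h3 hv, s₂, k₂ 21 rfl, s₁]
  have e₃ : m₃ 21 = m₁ 21 ∧ m₃ 9 = m 9 ∧ m₃ 3 = m 3 ∧ m₃ 4 = m 4 :=
    ⟨by rw [k₃ 21 rfl, k₂ 21 rfl], by rw [k₃ 9 rfl, k₂ 9 rfl, k₁ 9 rfl],
      by rw [k₃ 3 rfl, k₂ 3 rfl, k₁ 3 rfl], by rw [k₃ 4 rfl, k₂ 4 rfl, k₁ 4 rfl]⟩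
  clear_value m₃
  generalize hp₄ : sumTensor 24 _ _ _ _ _ _ = p₄
  set m₄ := p₄.run ν m₃ with hm₄
  have k₄ : ∀ j, p₄.keeps j = true → m₄ j = m₃ j := fun j hj => Prog.run_of_keeps _ hj _ _
  have s₄ : opAt (m₄ 24) 0 = onV (s * q) * ρ := by
    rw [hm₄, ← hp₄, opAt_run_sumTensor 24 (L := .var 3) (w := v) _ rfl _ h2 h3 h3 hv]
    ext x y
    rw [onV_mul_apply]
    refine Finset.sum_congr rfl fun l _ => ?_
    rw [← s₁, ← hρ, ← e₃.1, ← e₃.2.2.1]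
    simp [SExpr.eval, SExpr.eval_entry, NExpr.eval, tensorEnv, dimCV, h2, h3, h4, pos_div, pos_mod,
      matAt, opAt, entry, pos_mk]
  have e₄ : m₄ 21 = m₁ 21 ∧ m₄ 9 = m 9 ∧ m₄ 23 = m₃ 23 ∧ m₄ 4 = m 4 := by
    subst hp₄
    exact ⟨by rw [k₄ 21 rfl, e₃.1], by rw [k₄ 9 rfl, e₃.2.1], by rw [k₄ 23 rfl],
      by rw [k₄ 4 rfl, e₃.2.2.2]⟩
  clear_value m₄
  generalize hp₅ : sumTensor 25 _ _ _ _ _ _ = p₅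
  set m₅ := p₅.run ν m₄ with hm₅
  have k₅ : ∀ j, p₅.keeps j = true → m₅ j = m₄ j := fun j hj => Prog.run_of_keeps _ hj _ _
  have s₅ : opAt (m₅ 25) 0 = onV (s * q) * ρ * (onV (s * q))ᴴ := by
    rw [hm₅, ← hp₅, opAt_run_sumTensor 25 (L := .var 3) (w := v) _ rfl _ h2 h3 h3 hv]
    ext x y
    rw [mul_conjTranspose_onV_apply]
    refine Finset.sum_congr rfl fun l _ => ?_
    rw [← s₄, ← s₁, ← e₄.1]
    simp [SExpr.eval, SExpr.eval_entry, NExpr.eval, tensorEnv, dimCV, h2, h3, pos_div, pos_mod,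
      matAt, opAt, entry, pos_mk]
  have e₅ : m₅ 9 = m 9 ∧ m₅ 23 = m₃ 23 ∧ m₅ 4 = m 4 := by
    subst hp₅
    exact ⟨by rw [k₅ 9 rfl, e₄.2.1], by rw [k₅ 23 rfl, e₄.2.2.1], by rw [k₅ 4 rfl, e₄.2.2.2]⟩
  clear_value m₅
  generalize hp₆ : sumTensor 5 _ _ _ _ _ _ = p₆
  set m₆ := p₆.run ν m₅ with hm₆
  have s₆ : opAt (m₆ 5) 0 = roundStep s (s * q) ρ := by
    rw [hm₆, ← hp₆, opAt_run_sumTensor 5 (L := .const 1) (w := 1) _ rfl _ h2 h3 rfl Nat.zero_lt_one]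
    ext x y
    rw [roundStep, Matrix.add_apply, ← s₅, corner_apply, Matrix.sub_apply, ← s₃, ← h9,
      ← e₅.1, ← e₅.2.1]
    simp only [Finset.univ_unique, Finset.sum_singleton]
    simp [SExpr.eval, SExpr.eval_entry, NExpr.eval, tensorEnv, dimCV, h2, h3, pos_div, pos_mod,
      matAt, opAt, entry]
  have e₆ : m₆ 4 = m 4 := by
    subst hp₆
    exact (Prog.run_of_keeps _ rfl _ _).trans e₅.2.2
  clear_value m₆
  have hs := run_sumTensor 4 (.mul (.var 4) (.mul dimCV dimCV)) (D₀ := .const 1) (D₁ := dimCV)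
    (D₂ := dimCV) (L := .const 1) (.entry 5 (.const 0) (.var 11) (.var 12) dimCV) rfl rfl rfl rfl ν
    m₆ Nat.zero_lt_one
  have hoff : NExpr.eval ν (.mul (.var 4) (.mul dimCV dimCV)) = i * (c * v) * (c * v) := by
    rw [NExpr.eval, NExpr.eval, NExpr.eval, h4, hn ν h2 h3]
    ring
  rw [hoff, hn ν h2 h3] at hs
  refine ⟨?_, ?_, fun j hj => ?_⟩
  · rw [← s₆]
    exact congrArg (fun q => (opAt q 0 : Op c v)) (Prog.run_of_keeps _ rfl _ _)
  · rw [← s₆]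
    funext x y
    have h := hs.1 0 Nat.zero_lt_one (pos x) (pos_lt x) (pos y) (pos_lt y)
    rw [opAt, entry, show (i * (c * v) + pos x) * (c * v) + pos y
      = i * (c * v) * (c * v) + ((0 * (c * v) + pos x) * (c * v) + pos y) by ring, h]
    simp [SExpr.eval_entry, NExpr.eval, tensorEnv, dimCV, h2, h3, opAt, entry]
  · rw [← e₆]
    funext x y
    refine hs.2 4 _ (by decide) fun _ => Or.inl ?_
    have hx := pos_lt x
    have hy := pos_lt y
    rw [entry]
    calc (j * (c * v) + pos x) * (c * v) + pos y
        < (j * (c * v) + pos x + 1) * (c * v) := by rw [add_mul _ 1, one_mul]; omega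
      _ ≤ ((j + 1) * (c * v)) * (c * v) := by gcongr; rw [add_mul j, one_mul]; omega
      _ ≤ _ := by gcongr; omega

/-- One round of the rounding procedure. -/
def stepProg : Prog := .seq marginalsProg (.seq invSqrtProg correctionProg)

theorem stepProg_spec {ν : ℕ → ℕ} (m : Memory) {c v i : ℕ} (h2 : ν 2 = c) (h3 : ν 3 = v)
    (h4 : ν 4 = i) (hc : 0 < c) (hv : 0 < v) {W ρ' ρ : Op c v} (h5 : opAt (m 5) 0 = ρ')
    (hρ : opAt (m 3) i = ρ) (hW₀ : i = 0 → W = 1) (hW : 0 < i → opAt (m 1) (i - 1) = W)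
    (hρ' : (trC (W * ρ' * Wᴴ)).PosSemidef) (hρpos : ρ.PosSemidef) :
    ∃ q, InvSqrtOn q (trC ρ * trC (W * ρ' * Wᴴ)) ∧
      opAt (stepProg.run ν m 5) 0 = roundStep (trC (W * ρ' * Wᴴ)) (trC (W * ρ' * Wᴴ) *
        Polynomial.aeval (trC ρ * trC (W * ρ' * Wᴴ)) q) ρ ∧
      opAt (stepProg.run ν m 4) i = (opAt (stepProg.run ν m 5) 0 : Op c v) ∧
      ∀ j < i, (opAt (stepProg.run ν m 4) j : Op c v) = opAt (m 4) j := by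
  obtain ⟨s9, s10, s11⟩ := marginalsProg_spec m h2 h3 h4 hc hv h5 hρ hW₀ hW
  have k₁ : ∀ j, marginalsProg.keeps j = true → marginalsProg.run ν m j = m j := fun j hj =>
    Prog.run_of_keeps _ hj _ _
  unfold stepProg
  simp only [Prog.run]
  set m₁ := marginalsProg.run ν m
  clear_value m₁
  obtain ⟨q, hq, s20⟩ := matAt_invSqrtProg m₁ h3 hv hρ' (posSemidef_trC hρpos) s11
  have k₂ : ∀ j, invSqrtProg.keeps j = true → invSqrtProg.run ν m₁ j = m₁ j := fun j hj =>
    Prog.run_of_keeps _ hj _ _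
  set m₂ := invSqrtProg.run ν m₁
  clear_value m₂
  obtain ⟨t5, t4, t4'⟩ := correctionProg_spec m₂ h2 h3 h4 hc hv
    (by rw [k₂ 3 rfl, k₁ 3 rfl, hρ]) (by rw [k₂ 9 rfl, s9]) (by rw [k₂ 10 rfl, s10]) s20
  refine ⟨q, hq, t5, by rw [t4, t5], fun j hj => ?_⟩
  rw [t4' j hj, k₂ 4 rfl, k₁ 4 rfl]

/-- The algorithm that rounds `ρ_1, …, ρ_a` to states consistent with the referee. -/
def roundingProg : Prog :=
  .seq (sumTensor 5 (.const 0) (.const 1) dimCV dimCV (.const 1)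
    (.mul (.read 0 (.var 11)) (.conj (.read 0 (.var 12)))))
  (.loop 4 (.var 0) stepProg)

theorem storeVec_pos {c v : ℕ} (f : CV c v → ℂ) (x : CV c v) : storeVec f (pos x) = f x := by
  simp [storeVec, pos_injective.eq_iff]

theorem entry_inj {c v : ℕ} {i j : ℕ} {x y x' y' : CV c v} :
    entry i x y = entry j x' y' ↔ i = j ∧ x = x' ∧ y = y' := by
  refine ⟨fun h => ?_, fun ⟨h₁, h₂, h₃⟩ => by rw [h₁, h₂, h₃]⟩
  have hpos : 0 < c * v := (Nat.zero_le _).trans_lt (pos_lt x)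
  simp only [entry] at h
  have h1 : (i * (c * v) + pos x) = (j * (c * v) + pos x') := by
    have := congrArg (· / (c * v)) h
    simpa [Nat.mul_add_div hpos, mul_comm _ (c * v), Nat.div_eq_of_lt (pos_lt _)] using this
  have h2 : pos y = pos y' := by rw [h1] at h; omega
  have h3 : i = j := by
    have := congrArg (· / (c * v)) h1
    simpa [Nat.mul_add_div hpos, mul_comm _ (c * v), Nat.div_eq_of_lt (pos_lt _)] using this
  exact ⟨h3, pos_injective (by rw [h3] at h1; omega), pos_injective h2⟩

theorem opAt_storeMats {c v n : ℕ} (M : Fin n → Op c v) (i : Fin n) :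
    opAt (storeMats M) i = M i := by
  funext x y
  rw [opAt, storeMats, Finset.sum_eq_single i, Finset.sum_eq_single x, Finset.sum_eq_single y]
  · simp
  · intro y' _ h
    simp [entry_inj, h]
  · simp
  · intro x' _ h
    simp [entry_inj, h]
  · simp
  · intro j _ h
    simp [entry_inj, Fin.val_inj, h]
  · simp

/-! ### Correctness of the rounding program -/

namespace Referee

variable {a b c v : ℕ} (R : Referee a b c v)

/-- Array `5` carries the current state `ρ'_t` and array `4` collects the states. That `ρ'_t` is a
density operator belongs to the invariant, because the inverse square root is only guaranteed for
positive semidefinite marginals. -/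
theorem isRounding_output {ρ : Fin a → Op c v} (hρ : ∀ i, IsDensity (ρ i)) :
    R.IsRounding ρ (roundingProg.output R ρ) := by
  have hc := R.pos_c
  have hv := R.pos_v
  set ν := sizes a b c v with hν
  generalize hp : sumTensor 5 (.const 0) (.const 1) dimCV dimCV (.const 1)
    (.mul (.read 0 (.var 11)) (.conj (.read 0 (.var 12)))) = p
  let M : ℕ → Memory := fun t => Nat.rec (p.run ν (inputMem R ρ))
    (fun i m' => stepProg.run (Function.update ν 4 i) m') t
  have hout : roundingProg.output R ρ = loadMats (M a 4) := by
    rw [Prog.output, roundingProg, hp]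
    rfl
  have hstep : ∀ t, M (t + 1) = stepProg.run (Function.update ν 4 t) (M t) := fun _ => rfl
  have hkeep : ∀ t, M t 1 = storeMats R.V ∧ M t 3 = storeMats ρ := by
    intro t
    induction t with
    | zero =>
      subst hp
      exact ⟨Prog.run_of_keeps _ rfl _ _, Prog.run_of_keeps _ rfl _ _⟩
    | succ t ih =>
      rw [hstep]
      exact ⟨(Prog.run_of_keeps _ rfl _ _).trans ih.1, (Prog.run_of_keeps _ rfl _ _).trans ih.2⟩
  let σ : ℕ → Op c v := fun t => opAt (M t 5) 0
  have hσ₀ : σ 0 = Matrix.vecMulVec R.psi (star R.psi) := by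
    change opAt (p.run ν (inputMem R ρ) 5) 0 = _
    rw [← hp, opAt_run_sumTensor 5 (L := .const 1) (w := 1) _ rfl _ (c := c) (v := v) rfl rfl rfl
      Nat.zero_lt_one]
    funext x y
    simp [SExpr.eval, NExpr.eval, tensorEnv, inputMem, storeVec_pos, Matrix.vecMulVec_apply]
  have hspec : ∀ t < a, IsDensity (σ t) → ∃ q,
      InvSqrtOn q (trC (R.tr ρ (t + 1)) * trC (R.W t * σ t * (R.W t)ᴴ)) ∧
      σ (t + 1) = roundStep (trC (R.W t * σ t * (R.W t)ᴴ)) (trC (R.W t * σ t * (R.W t)ᴴ) *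
        Polynomial.aeval (trC (R.tr ρ (t + 1)) * trC (R.W t * σ t * (R.W t)ᴴ)) q)
        (R.tr ρ (t + 1)) ∧
      opAt (M (t + 1) 4) t = σ (t + 1) ∧
      ∀ j < t, (opAt (M (t + 1) 4) j : Op c v) = opAt (M t 4) j := by
    intro t ht hd
    refine stepProg_spec (ν := Function.update ν 4 t) (M t) (by simp [hν, sizes])
      (by simp [hν, sizes]) (by simp) hc hv rfl ?_ ?_ ?_ (hd.conj (R.W_unitary t)).trC.1
      (R.isDensity_tr hρ ht).1
    · rw [(hkeep t).2, opAt_storeMats ρ ⟨t, ht⟩, tr, dif_pos ht]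
    · rintro rfl
      rfl
    · intro h0
      obtain ⟨k, rfl⟩ := Nat.exists_eq_add_of_lt h0
      have hk : k < a + b := by omega
      rw [show M (0 + k + 1) 1 = storeMats R.V from (hkeep (0 + k + 1)).1, show 0 + k + 1 - 1 = k by omega, opAt_storeMats R.V ⟨k, hk⟩, zero_add, W,
        dif_pos hk]
  have hdens : ∀ t ≤ a, IsDensity (σ t) := by
    intro t ht
    induction t with
    | zero =>
      rw [hσ₀]
      exact R.isDensity_psi
    | succ t ih =>
      have hd := ih (by omega)
      obtain ⟨q, hq, h, -⟩ := hspec t ht hd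
      have hs := (hd.conj (R.W_unitary t)).trC
      have hr := R.isDensity_tr hρ ht
      rw [h]
      exact isDensity_roundStep hc hr.1 hs.2 (transport hs.1 hr.trC.1 hq rfl).1
  have hstore : ∀ t ≤ a, ∀ j < t, opAt (M t 4) j = σ (j + 1) := by
    intro t ht
    induction t with
    | zero => exact fun j hj => absurd hj (Nat.not_lt_zero j)
    | succ t ih =>
      intro j hj
      obtain ⟨q, -, -, h, h'⟩ := hspec t ht (hdens t (by omega))
      rcases Nat.lt_succ_iff_lt_or_eq.1 hj with hjt | rfl
      · rw [h' j hjt, ih (by omega) j hjt]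
      · exact h
  have htr : ∀ t ≤ a, R.tr (roundingProg.output R ρ) t = σ t := by
    intro t ht
    cases t with
    | zero => exact hσ₀.symm
    | succ t =>
      rw [tr, dif_pos (Nat.lt_of_succ_le ht), hout]
      exact hstore a le_rfl t ht
  intro i hi
  rw [htr i hi.le, htr (i + 1) hi]
  obtain ⟨q, hq, h, -⟩ := hspec i hi (hdens i hi.le)
  exact ⟨q, hq, h⟩

end Referee

/-! ### Running time of the rounding program -/

theorem exists_time_roundingProg_le (r : ℕ) : ∃ K k : ℕ, ∀ a b c v : ℕ, 0 < c → 0 < v →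
    roundingProg.time r (sizes a b c v) ≤ K * max a 1 * (1 + Nat.log 2 (c * v)) ^ k := by
  unfold roundingProg
  generalize hp : sumTensor 5 (.const 0) (.const 1) dimCV dimCV (.const 1)
    (.mul (.read 0 (.var 11)) (.conj (.read 0 (.var 12)))) = p
  obtain ⟨k₁, h₁⟩ := p.polylogBdd_time isDim r (by subst hp; decide)
  obtain ⟨k₂, h₂⟩ := stepProg.polylogBdd_time isDim r (by decide)
  refine ⟨5 * 2 ^ (k₁ + k₂), k₁ + k₂, fun a b c v hc hv => ?_⟩
  have hcv : 0 < c * v := Nat.mul_pos hc hv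
  have hc' : c ≤ 2 * (c * v) := (Nat.le_mul_of_pos_right c hv).trans (by omega)
  have hv' : v ≤ 2 * (c * v) := (Nat.le_mul_of_pos_left v hc).trans (by omega)
  have hdim : ∀ ν : ℕ → ℕ, ν 2 = c → ν 3 = v → ∀ i, isDim i = true → ν i ≤ 2 * (c * v) := by
    intro ν h2 h3 i hi
    simp only [isDim, Bool.or_eq_true, beq_iff_eq] at hi
    rcases hi with rfl | rfl
    · rwa [h2]
    · rwa [h3]
  -- The polylogarithmic bounds need a base of at least 2 and `c * v` may be 1, hence `2 * (c * v)`.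
  -- This at most doubles `1 + log₂ (c * v)`.
  set X := 1 + Nat.log 2 (2 * (c * v)) with hX
  have hX1 : 1 ≤ X := Nat.le_add_right _ _
  have hX2 : X ≤ 2 * (1 + Nat.log 2 (c * v)) := by
    rw [hX, mul_comm 2, Nat.log_mul_base (by norm_num) hcv.ne']
    omega
  have b₁ : p.time r (sizes a b c v) ≤ X ^ (k₁ + k₂) :=
    (h₁ _ _ (by omega) (hdim _ rfl rfl)).trans (Nat.pow_le_pow_right hX1 (Nat.le_add_right _ _))
  have b₂ : ∀ i, stepProg.time r (Function.update (sizes a b c v) 4 i) ≤ X ^ (k₁ + k₂) := fun i =>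
    (h₂ _ _ (by omega) (hdim _ (by simp [sizes]) (by simp [sizes]))).trans
      (Nat.pow_le_pow_right hX1 (Nat.le_add_left _ _))
  have b₃ : ∑ i ∈ Finset.range a, (1 + stepProg.time r (Function.update (sizes a b c v) 4 i))
      ≤ a * (1 + X ^ (k₁ + k₂)) := by
    refine (Finset.sum_le_card_nsmul _ _ (1 + X ^ (k₁ + k₂)) fun i _ =>
      Nat.add_le_add_left (b₂ i) 1).trans ?_
    simp
  have hpow : 1 ≤ X ^ (k₁ + k₂) := Nat.one_le_pow _ _ hX1
  have hpow2 : X ^ (k₁ + k₂) ≤ 2 ^ (k₁ + k₂) * (1 + Nat.log 2 (c * v)) ^ (k₁ + k₂) := by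
    rw [← mul_pow]
    exact Nat.pow_le_pow_left hX2 _
  have ha : a ≤ max a 1 := le_max_left _ _
  have ha1 : 1 ≤ max a 1 := le_max_right _ _
  calc Prog.time r (.seq p (.loop 4 (.var 0) stepProg)) (sizes a b c v)
      = p.time r (sizes a b c v) + (1 + 1 + ∑ i ∈ Finset.range a,
        (1 + stepProg.time r (Function.update (sizes a b c v) 4 i))) := rfl
    _ ≤ X ^ (k₁ + k₂) + (1 + 1 + a * (1 + X ^ (k₁ + k₂))) := by gcongr
    -- The five summands `X ^ k`, `1`, `1`, `a` and `a * X ^ k`, with `k = k₁ + k₂`, are each at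
    -- most `max a 1 * X ^ k`.
    _ ≤ 5 * (max a 1 * X ^ (k₁ + k₂)) := by nlinarith
    _ ≤ 5 * (max a 1 * (2 ^ (k₁ + k₂) * (1 + Nat.log 2 (c * v)) ^ (k₁ + k₂))) := by gcongr
    _ = _ := by ring

theorem exists_work_roundingProg_le (r : ℕ) : ∃ K k : ℕ, ∀ a b c v : ℕ, 0 < c → 0 < v →
    roundingProg.work r (sizes a b c v) ≤ K * (max a 1 * (c * v)) ^ k := by
  -- Variable `1` holds `b`. The program does not use it, so the bound is independent of `b`.
  obtain ⟨k, hk⟩ := roundingProg.polyBdd_work (fun i => i != 1) r (by decide)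
  refine ⟨2 ^ k, k, fun a b c v hc hv => ?_⟩
  rw [← mul_pow]
  have hcv : 0 < c * v := Nat.mul_pos hc hv
  have ha1 : 0 < max a 1 := lt_of_lt_of_le Nat.zero_lt_one (le_max_right _ _)
  have hle : c * v ≤ max a 1 * (c * v) := Nat.le_mul_of_pos_left _ ha1
  have ha : a ≤ max a 1 * (c * v) := (le_max_left _ _).trans (Nat.le_mul_of_pos_right _ hcv)
  have hc' : c ≤ c * v := Nat.le_mul_of_pos_right c hv
  have hv' : v ≤ c * v := Nat.le_mul_of_pos_left v hc
  refine hk _ _ (by omega) fun i hi => ?_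
  simp only [bne_iff_ne, ne_eq] at hi
  unfold sizes
  split <;> omega

end DQIP

/-! ### The rounding theorem -/

theorem mainTheorem4 :
    (∀ (a b c v : ℕ) (R : DQIP.Referee a b c v) (ε δ : ℝ), 0 < ε → 0 < δ →
      (R.mu ε ≤ R.lam ∧ R.lam - ε < R.mu ε) ∧
      (∀ X : R.Response, DQIP.MaxOptimal (R.penalized ε) (R.mu ε) δ X →
        DQIP.MaxOptimal R.payoff R.lam (δ + ε) X.1)) ∧
    (∃ p : DQIP.Prog, ∀ r : ℕ, ∃ K k : ℕ,
      ∀ (a b c v : ℕ) (R : DQIP.Referee a b c v) (ε δ : ℝ), 0 < ε → 0 < δ →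
      ∀ ρ : R.Tuple, DQIP.MinOptimal (R.penalized ε) (R.mu ε) δ ρ →
        R.Consistent (p.output R ρ.1) ∧
        (∃ h : R.tr (p.output R ρ.1) a ∈ R.admA,
          DQIP.MinOptimal R.payoff R.lam (δ + ε) ⟨R.tr (p.output R ρ.1) a, h⟩) ∧
        p.time r (DQIP.sizes a b c v) ≤ K * max a 1 * (1 + Nat.log 2 (c * v)) ^ k ∧
        p.work r (DQIP.sizes a b c v) ≤ K * (max a 1 * (c * v)) ^ k) := by
  refine ⟨fun a b c v R ε δ hε _ => ?_, DQIP.roundingProg, fun r => ?_⟩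
  -- The output of the program also serves as the rounding whose existence the bound on the values
  -- requires.
  · have hlt := R.lam_sub_lt_mu hε fun ρ => ⟨_, R.isRounding_output ρ.2⟩
    exact ⟨⟨R.mu_le_lam hε, hlt⟩, fun X hX => R.maxOptimal_of_maxOptimal hε hlt hX⟩
  · obtain ⟨K₁, k₁, h₁⟩ := DQIP.exists_time_roundingProg_le r
    obtain ⟨K₂, k₂, h₂⟩ := DQIP.exists_work_roundingProg_le r
    refine ⟨max K₁ K₂, max k₁ k₂, fun a b c v R ε δ hε _ ρ hρ => ?_⟩
    have hc := R.pos_c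
    have hv := R.pos_v
    have hcv : 0 < c * v := Nat.mul_pos hc hv
    obtain ⟨hcons, hopt⟩ := R.minOptimal_of_isRounding hε hρ (R.isRounding_output ρ.2)
    refine ⟨hcons, hopt, (h₁ a b c v hc hv).trans ?_, (h₂ a b c v hc hv).trans ?_⟩
    · gcongr
      · exact le_max_left _ _
      · exact Nat.le_add_right _ _
      · exact le_max_left _ _
    · gcongr
      · exact le_max_right _ _
      · exact Nat.mul_pos (lt_of_lt_of_le Nat.zero_lt_one (le_max_right _ _)) hcv
      · exact le_max_right _ _
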